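/- **Setting.** Let $k$ be a field of characteristic $0$ and $\mathcal G=(\mathcal G_0,\mathcal G_1)$ a finite groupoid with source and target maps $s,t$; $gh$ is defined when $s(g)=t(h)$, $e_{\mathrm x}$ is the identity of $\mathrm x\in\mathcal G_0$, and $\Gamma^{\mathrm x}=\{g: s(g)=t(g)=\mathrm x\}$. The Drinfeld double $D=D(k[\mathcal G])$ of the quantum groupoid $k[\mathcal G]$ has basis $\{\gamma_g^x : g,x\in\mathcal G_1,\ s(g)=t(g)=t(x)\}$, product $\gamma_g^x\gamma_h^y=\delta_{x^{-1}gx,\,h}\,\gamma_g^{xy}$, unit $1=\sum_{\mathrm x}1^{\mathrm x}$ with $1^{\mathrm x}=\sum_{g\in\Gamma^{\mathrm x}}\gamma_g^{e_{\mathrm x}}$, coproduct $\Delta_D(\gamma_g^x)=\sum_{g_1g_2=g}\gamma_{g_1}^x\otimes\gamma_{g_2}^x$, counit $\varepsilon_D(\gamma_g^x)=\delta_{g,xx^{-1}}$, antipode $S(\gamma_g^x)=\gamma_{x^{-1}g^{-1}x}^{x^{-1}}$, and R-matrix $R=\sum_{\mathrm x}\sum_{g,h\in\Gamma^{\mathrm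 x}}\gamma_g^{e_{\mathrm x}}\otimes\gamma_h^g$. Write $\Delta_D(1)=1_{(1)}\otimes 1_{(2)}$ and $R=R^{(1)}\otimes R^{(2)}$. $\mathrm{Rep}(D)$ is the braided monoidal category of finite dimensional left $D$-modules $(\rho,A)$ and $D$-linear maps, with $A_1\widehat\otimes A_2=\{a\in A_1\otimes_kA_2:\rho_{12}(1)a=a\}$, $\rho_{12}(h)=(\rho_1\otimes\rho_2)(\Delta_D(h))$; the monoidal product of morphisms is the restriction of the tensor product of linear maps; the associator is the trivial one; the unit object is $D_t=\varepsilon_t(D)$, $\varepsilon_t(h)=\varepsilon_D(1_{(1)}h)1_{(2)}$, with action $\sigma_t(h)z=\varepsilon_t(hz)$; the unit morphisms are $l_A(\sigma_t(1_{(1)})z\otimes\rho(1_{(2)})a)=\rho(z)a$ and $r_A(\rho(1_{(1)})a\otimes\sigma_t(1_{(2)})z)=\rho(S(z))a$; the braiding is $a\otimes b\mapsto\rho_2(R^{(2)})b\otimes\rho_1(R^{(1)})a$. A *Frobenius object* $(A,m,\Delta,\mu,\varepsilon)$ of a braided monoidal category is a commutative algebra object $(A,m,\mu)$ and co-commutative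 coalgebra object $(A,\Delta,\varepsilon)$ with $\Delta\circ m=(m\otimes \mathrm{id})\circ\Phi^{-1}\circ(\mathrm{id}\otimes\Delta)=(\mathrm{id}\otimes m)\circ\Phi\circ(\Delta\otimes \mathrm{id})$, where $\Phi$ is the associator. A *$\mathcal G$-Frobenius algebra* ($\mathcal G$-FA) is a finite dimensional unital associative $k$-algebra $A=\bigoplus_{\mathrm x\in\mathcal G_0}A^{\mathrm x}$ with a bilinear form $\eta$ and an action $\varphi$ of $\mathcal G$ by algebra isomorphisms $\varphi(f):A^{s(f)}\to A^{t(f)}$ (so $\varphi(h)\varphi(g)=\varphi(hg)$ and $\varphi(e_{\mathrm x})=\mathrm{id}$), such that: (i) $A^{\mathrm x}=\bigoplus_{g\in\Gamma^{\mathrm x}}A^{\mathrm x}_g$ is a $\Gamma^{\mathrm x}$-graded algebra; (ii) $A^{\mathrm x}A^{\mathrm x}\subset A^{\mathrm x}$, and $A^{\mathrm x}A^{\mathrm y}=0$ for $\mathrm x\ne\mathrm y$; (iii) $\eta(ab,c)=\eta(a,bc)$; (iv) $\eta(\varphi(f)a,\varphi(f)b)=\eta(a,b)$ for $a,b\in A^{s(f)}$;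 (v) $\varphi(f)A^{s(f)}_g\subset A^{t(f)}_{fgf^{-1}}$; (vi) for $g,h\in\Gamma^{\mathrm x}$, $\eta|_{A^{\mathrm x}_g\times A^{\mathrm x}_h}$ is nondegenerate if $gh=e_{\mathrm x}$ and zero otherwise; (vii) $ab=(\varphi(g)b)a\in A^{\mathrm x}_{gh}$ for $a\in A^{\mathrm x}_g$, $b\in A^{\mathrm x}_h$; (viii) $\varphi(g)|_{A^{\mathrm x}_g}=\mathrm{id}$; (ix) for $g,h\in\Gamma^{\mathrm x}$ and $c\in A^{\mathrm x}_{ghg^{-1}h^{-1}}$, with $l_c$ the left multiplication by $c$, $\mathrm{Tr}(l_c\circ\varphi(h)|_{A^{\mathrm x}_g})=\mathrm{Tr}(\varphi(g^{-1})\circ l_c|_{A^{\mathrm x}_h})$. A Frobenius object $((\rho,A),m,\Delta,\mu,\varepsilon)$ in $\mathrm{Rep}(D)$ *induces* on $A$ the following data: $A^{\mathrm x}=\rho(1^{\mathrm x})A$ and $A^{\mathrm x}_g=\rho(\gamma_g^{e_{\mathrm x}})A$; product $ab=\sum_{\mathrm x}m(a^{\mathrm x}\otimes b^{\mathrm x})$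 with $a^{\mathrm x}=\rho(1^{\mathrm x})a$; unit $\mathbf 1_A=\mu(1)$; $\eta(a,b)=\varepsilon'(ab)$, where $\varepsilon':A\to k$ is the linear form with $\varepsilon(a)=\sum_{\mathrm x}\varepsilon'(a^{\mathrm x})1^{\mathrm x}$; and $\varphi(f)=\sum_{g\in\Gamma^{t(f)}}\rho(\gamma_g^f)|_{A^{s(f)}}$. **Theorem.** Consider the following conditions on a Frobenius object $((\rho,A),m,\Delta,\mu,\varepsilon)$ in $\mathrm{Rep}(D(k[\mathcal G]))$: (1) $\sum_{\mathrm x\in\mathcal G_0}\sum_{g\in\Gamma^{\mathrm x}}\rho(\gamma_g^g)=\mathrm{id}_A$; (2) $\mathrm{Tr}\big(l_c\circ\rho(\gamma_{hgh^{-1}}^h)\big)=\mathrm{Tr}\big(\rho(\gamma_h^{g^{-1}})\circ l_c\circ\rho(\gamma_h^{e_{\mathrm x}})\big)$ for all $\mathrm x\in\mathcal G_0$, $g,h\in\Gamma^{\mathrm x}$ and $c\in\rho(\gamma_{ghg^{-1}h^{-1}}^{e_{\mathrm x}})A$, where $l_c(v)=m(c\otimes v)$ for $v\in\rho(1^{\mathrm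 x})A$. (a) For every $\mathcal G$-FA $\mathcal A$ with underlying vector space $A$ there is a Frobenius object $((\rho,A),m,\Delta,\mu,\varepsilon)$ in $\mathrm{Rep}(D(k[\mathcal G]))$ on the same vector space which satisfies (1) and (2) and whose induced data is exactly $\mathcal A$. (b) For every Frobenius object in $\mathrm{Rep}(D(k[\mathcal G]))$ which satisfies (1) and (2), the induced data is a $\mathcal G$-FA. -/

import Mathlib

open CategoryTheory MonoidalCategory TensorProduct

universe u v w

noncomputable section

namespace GroupoidFA

/-! ### Conventions

`𝒢` is a groupoid whose type of objects is `𝒢`; a morphism `g` with source `x` and target `y` is a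
term `g : x ⟶ y`.  The product `gh` of morphisms with `s(g) = t(h)` is `h ≫ g`, the loops at `x`
(the elements of `Γ^x`) are the terms of `x ⟶ x`, and `𝟙 x` is the identity `e_x`. -/

/-- The pairs `(g, x)` of morphisms with `s(g) = t(g) = t(x)`, which index the basis of the
Drinfeld double. Here `loop` is `g` and `arr` is `x`. -/
@[ext] structure DBasis (𝒢 : Type u) [Groupoid.{v} 𝒢] where
  {src : 𝒢}
  {tgt : 𝒢}
  loop : tgt ⟶ tgt
  arr : src ⟶ tgt

/-- The underlying vector space of `D(k[𝒢])`: it is freely spanned by the pairs `(g, x)`. -/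
def DD (k : Type w) [Field k] (𝒢 : Type u) [Groupoid.{v} 𝒢] : Type (max u v w) := DBasis 𝒢 →₀ k

namespace DD

section Basic

variable {k : Type w} [Field k] {𝒢 : Type u} [Groupoid.{v} 𝒢]

instance : AddCommGroup (DD k 𝒢) := inferInstanceAs (AddCommGroup (DBasis 𝒢 →₀ k))

instance : Module k (DD k 𝒢) := inferInstanceAs (Module k (DBasis 𝒢 →₀ k))

/-- The basis element `γ_g^x` of `D(k[𝒢])` for morphisms `g`, `x` with `s(g) = t(g) = t(x)`. -/
def γ {s t : 𝒢} (g : t ⟶ t) (x : s ⟶ t) : DD k 𝒢 :=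
  (Finsupp.single (DBasis.mk g x) (1 : k) : DBasis 𝒢 →₀ k)

/-- The linear map on `D(k[𝒢])` with prescribed values on the basis. -/
def lift {M : Type*} [AddCommGroup M] [Module k M] (f : DBasis 𝒢 → M) : DD k 𝒢 →ₗ[k] M :=
  Finsupp.lift M k (DBasis 𝒢) f

@[simp] theorem lift_γ {M : Type*} [AddCommGroup M] [Module k M] (f : DBasis 𝒢 → M)
    {s t : 𝒢} (g : t ⟶ t) (x : s ⟶ t) : lift f (γ (k := k) g x) = f ⟨g, x⟩ := by
  have e : lift f (γ (k := k) g x) = (Finsupp.single (DBasis.mk g x) (1 : k)).sum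
      fun a r => r • f a := Finsupp.lift_apply M k (DBasis 𝒢) f _
  rw [e, Finsupp.sum_single_index (by simp), one_smul]

theorem induction {p : DD k 𝒢 → Prop} (a : DD k 𝒢) (zero : p 0)
    (add : ∀ a b, p a → p b → p (a + b)) (smul : ∀ (r : k) a, p a → p (r • a))
    (basis : ∀ {s t : 𝒢} (g : t ⟶ t) (x : s ⟶ t), p (γ g x)) : p a := by
  refine Finsupp.induction_linear (motive := p) a zero add ?_
  intro b r
  have e : (Finsupp.single b r : DBasis 𝒢 →₀ k) = (r • γ b.loop b.arr : DD k 𝒢) := by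
    change _ = r • (Finsupp.single b (1 : k) : DBasis 𝒢 →₀ k)
    rw [Finsupp.smul_single, smul_eq_mul, mul_one]
  have := smul r _ (basis b.loop b.arr)
  rw [← e] at this
  exact this

theorem hom_ext {M : Type*} [AddCommGroup M] [Module k M] {f f' : DD k 𝒢 →ₗ[k] M}
    (h : ∀ {s t : 𝒢} (g : t ⟶ t) (x : s ⟶ t), f (γ g x) = f' (γ g x)) : f = f' := by
  refine Finsupp.lhom_ext' (fun b => LinearMap.ext_ring ?_)
  exact h b.loop b.arr

open Classical in
/-- The product of two basis elements: `γ_g^x · γ_h^y = γ_g^{xy}` if `x⁻¹gx = h` (an equality of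
loops, which forces `s(x) = t(y)`), and `0` otherwise. -/
def mulBasis (a b : DBasis 𝒢) : DD k 𝒢 :=
  if h : (⟨a.src, a.arr ≫ a.loop ≫ inv a.arr⟩ : Σ z : 𝒢, (z ⟶ z)) = ⟨b.tgt, b.loop⟩ then
    γ a.loop (b.arr ≫ eqToHom (congrArg Sigma.fst h).symm ≫ a.arr)
  else 0

/-- The multiplication of `D(k[𝒢])` as a bilinear map. -/
def mulLin : DD k 𝒢 →ₗ[k] DD k 𝒢 →ₗ[k] DD k 𝒢 :=
  lift fun a => lift fun b => mulBasis a b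

instance : Mul (DD k 𝒢) := ⟨fun a b => mulLin a b⟩

theorem mul_def (a b : DD k 𝒢) : a * b = mulLin a b := rfl

theorem γ_mul_γ' {s t s' t' : 𝒢} (g : t ⟶ t) (x : s ⟶ t) (h : t' ⟶ t') (y : s' ⟶ t') :
    (γ g x * γ h y : DD k 𝒢) = mulBasis ⟨g, x⟩ ⟨h, y⟩ := by
  simp [mul_def, mulLin]

open Classical in
theorem γ_mul_γ {s t s' : 𝒢} (g : t ⟶ t) (x : s ⟶ t) (h : s ⟶ s) (y : s' ⟶ s) :
    (γ g x * γ h y : DD k 𝒢) = if x ≫ g ≫ inv x = h then γ g (y ≫ x) else 0 := by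
  rw [γ_mul_γ']
  by_cases e : x ≫ g ≫ inv x = h
  · subst e
    simp [mulBasis]
  · simp [mulBasis, e]

theorem γ_mul_γ_of_ne {s t s' t' : 𝒢} (g : t ⟶ t) (x : s ⟶ t) (h : t' ⟶ t') (y : s' ⟶ t')
    (e : s ≠ t') : (γ g x * γ h y : DD k 𝒢) = 0 := by
  rw [γ_mul_γ', mulBasis, dif_neg]
  intro h
  exact e (congrArg Sigma.fst h)

instance : NonUnitalRing (DD k 𝒢) where
  left_distrib a b c := by simp [mul_def]
  right_distrib a b c := by simp [mul_def]
  zero_mul a := by simp [mul_def]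
  mul_zero a := by simp [mul_def]
  mul_assoc := by
    have key : ∀ {s t s' t' s'' t'' : 𝒢} (g : t ⟶ t) (x : s ⟶ t) (h : t' ⟶ t') (y : s' ⟶ t')
        (l : t'' ⟶ t'') (z : s'' ⟶ t''),
        (γ g x * γ h y * γ l z : DD k 𝒢) = γ g x * (γ h y * γ l z) := by
      intro s t s' t' s'' t'' g x h y l z
      have z1 : ∀ a : DD k 𝒢, a * 0 = 0 := fun a => by simp [mul_def]
      have z2 : ∀ a : DD k 𝒢, 0 * a = 0 := fun a => by simp [mul_def]
      by_cases e1 : s = t'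
      · subst e1
        by_cases e2 : s' = t''
        · subst e2
          rw [γ_mul_γ, γ_mul_γ]
          by_cases e3 : x ≫ g ≫ inv x = h
          · subst e3
            by_cases e4 : y ≫ (x ≫ g ≫ inv x) ≫ inv y = l
            · subst e4
              simp [γ_mul_γ]
            · have e5 : ¬ (y ≫ x) ≫ g ≫ inv (y ≫ x) = l := by simpa using e4
              rw [if_pos rfl, if_neg e4, γ_mul_γ, if_neg e5, z1]
          · rw [if_neg e3, z2]
            split_ifs
            · rw [γ_mul_γ, if_neg e3]
            · rw [z1]
        · rw [γ_mul_γ_of_ne h y l z e2, z1, γ_mul_γ]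
          split_ifs
          · rw [γ_mul_γ_of_ne _ _ _ _ e2]
          · rw [z2]
      · rw [γ_mul_γ_of_ne g x h y e1, z2]
        by_cases e2 : s' = t''
        · subst e2
          rw [γ_mul_γ]
          split_ifs
          · rw [γ_mul_γ_of_ne _ _ _ _ e1]
          · rw [z1]
        · rw [γ_mul_γ_of_ne h y l z e2, z1]
    intro a b c
    induction a using DD.induction with
    | zero => simp [mul_def]
    | add a a' h h' => simp only [mul_def, map_add, LinearMap.add_apply] at *; rw [h, h']
    | smul r a h => simp only [mul_def, map_smul, LinearMap.smul_apply] at *; rw [h]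
    | basis g x =>
      induction b using DD.induction with
      | zero => simp [mul_def]
      | add a a' h h' => simp only [mul_def, map_add, LinearMap.add_apply] at *; rw [h, h']
      | smul r a h => simp only [mul_def, map_smul, LinearMap.smul_apply] at *; rw [h]
      | basis h y =>
        induction c using DD.induction with
        | zero => simp [mul_def]
        | add a a' h h' => simp only [mul_def, map_add] at *; rw [h, h']
        | smul r a h => simp only [mul_def, map_smul] at *; rw [h]
        | basis l z => exact key g x h y l z

instance : SMulCommClass k (DD k 𝒢) (DD k 𝒢) :=
  ⟨fun r a b => by simp [mul_def]⟩

instance : IsScalarTower k (DD k 𝒢) (DD k 𝒢) :=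
  ⟨fun r a b => by simp [mul_def]⟩

section Finite

variable [∀ x y : 𝒢, Fintype (x ⟶ y)]

/-- `1^x = ∑_{g ∈ Γ^x} γ_g^{e_x}`. -/
def e (x : 𝒢) : DD k 𝒢 := ∑ g : x ⟶ x, γ g (𝟙 x)

theorem e_mul_γ_of_ne {x s t : 𝒢} (g : t ⟶ t) (y : s ⟶ t) (h : x ≠ t) :
    (e x * γ g y : DD k 𝒢) = 0 := by
  simp only [e, Finset.sum_mul]
  exact Finset.sum_eq_zero fun l _ => γ_mul_γ_of_ne _ _ _ _ h

theorem γ_mul_e_of_ne {x s t : 𝒢} (g : t ⟶ t) (y : s ⟶ t) (h : s ≠ x) :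
    (γ g y * e x : DD k 𝒢) = 0 := by
  simp only [e, Finset.mul_sum]
  exact Finset.sum_eq_zero fun l _ => γ_mul_γ_of_ne _ _ _ _ h

@[simp] theorem e_mul_γ {s t : 𝒢} (g : t ⟶ t) (y : s ⟶ t) :
    (e t * γ g y : DD k 𝒢) = γ g y := by
  classical
  simp [e, Finset.sum_mul, γ_mul_γ]

@[simp] theorem γ_mul_e {s t : 𝒢} (g : t ⟶ t) (y : s ⟶ t) :
    (γ g y * e s : DD k 𝒢) = γ g y := by
  classical
  simp [e, Finset.mul_sum, γ_mul_γ]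

variable [Fintype 𝒢]

instance : One (DD k 𝒢) := ⟨∑ x : 𝒢, e x⟩

theorem one_def : (1 : DD k 𝒢) = ∑ x : 𝒢, e x := rfl

instance : Ring (DD k 𝒢) :=
  { (inferInstance : NonUnitalRing (DD k 𝒢)) with
    one := 1
    one_mul := fun a => by
      induction a using DD.induction with
      | zero => exact mul_zero _
      | add a b h h' => rw [mul_add, h, h']
      | smul r a h => rw [mul_smul_comm, h]
      | @basis s t g x =>
        rw [one_def, Finset.sum_mul, Finset.sum_eq_single t]
        · exact e_mul_γ g x
        · intro b _ hb; exact e_mul_γ_of_ne g x hb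
        · simp
    mul_one := fun a => by
      induction a using DD.induction with
      | zero => exact zero_mul _
      | add a b h h' => rw [add_mul, h, h']
      | smul r a h => rw [smul_mul_assoc, h]
      | @basis s t g x =>
        rw [one_def, Finset.mul_sum, Finset.sum_eq_single s]
        · exact γ_mul_e g x
        · intro b _ hb; exact γ_mul_e_of_ne g x hb.symm
        · simp }

instance : Algebra k (DD k 𝒢) :=
  Algebra.ofModule (fun r a b => smul_mul_assoc r a b) (fun r a b => mul_smul_comm r a b)

instance : Finite (DBasis 𝒢) :=
  Finite.of_injective
    (fun b : DBasis 𝒢 => (⟨b.tgt, b.src, b.loop, b.arr⟩ :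
      Σ t : 𝒢, Σ s : 𝒢, (t ⟶ t) × (s ⟶ t))) (by
    rintro ⟨g, x⟩ ⟨h, y⟩ hb
    simp only [Sigma.mk.injEq] at hb
    obtain ⟨rfl, hb⟩ := hb
    simp only [heq_eq_eq, Sigma.mk.injEq] at hb
    obtain ⟨rfl, hb⟩ := hb
    simp only [heq_eq_eq, Prod.mk.injEq] at hb
    obtain ⟨rfl, rfl⟩ := hb
    rfl)

instance : Module.Finite k (DD k 𝒢) := inferInstanceAs (Module.Finite k (DBasis 𝒢 →₀ k))

/-- The coproduct `Δ_D(γ_g^x) = ∑_{g₁g₂ = g} γ_{g₁}^x ⊗ γ_{g₂}^x`. -/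
def comul : DD k 𝒢 →ₗ[k] DD k 𝒢 ⊗[k] DD k 𝒢 :=
  open Classical in
  lift fun b => ∑ g₁ : b.tgt ⟶ b.tgt, ∑ g₂ : b.tgt ⟶ b.tgt,
    if g₂ ≫ g₁ = b.loop then γ g₁ b.arr ⊗ₜ[k] γ g₂ b.arr else 0

/-- The counit `ε_D(γ_g^x) = δ_{g, xx⁻¹}`. -/
def counit : DD k 𝒢 →ₗ[k] k :=
  open Classical in
  lift fun b => if b.loop = inv b.arr ≫ b.arr then 1 else 0

/-- The antipode `S(γ_g^x) = γ_{x⁻¹g⁻¹x}^{x⁻¹}`. -/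
def antipode : DD k 𝒢 →ₗ[k] DD k 𝒢 :=
  lift fun b => γ (b.arr ≫ inv b.loop ≫ inv b.arr) (inv b.arr)

/-- The R-matrix `R = ∑_x ∑_{g, h ∈ Γ^x} γ_g^{e_x} ⊗ γ_h^g`. -/
def R : DD k 𝒢 ⊗[k] DD k 𝒢 :=
  ∑ x : 𝒢, ∑ g : x ⟶ x, ∑ h : x ⟶ x, γ g (𝟙 x) ⊗ₜ[k] γ h g

/-- The map `ε_t(h) = ε(1_{(1)} h) 1_{(2)}`. -/
def epsT : DD k 𝒢 →ₗ[k] DD k 𝒢 where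
  toFun h := TensorProduct.lid k (DD k 𝒢)
    (LinearMap.rTensor (DD k 𝒢) (counit ∘ₗ LinearMap.mulRight k h) (comul 1))
  map_add' a b := by
    have : LinearMap.mulRight k (a + b) = LinearMap.mulRight k a + LinearMap.mulRight k b := by
      ext c; simp [mul_add]
    rw [this, LinearMap.comp_add, LinearMap.rTensor_add]
    simp
  map_smul' r a := by
    have : LinearMap.mulRight k (r • a) = r • LinearMap.mulRight k a := by
      ext c; simp
    rw [this, LinearMap.comp_smul, LinearMap.rTensor_smul]
    simp

theorem comul_γ {s t : 𝒢} (g : t ⟶ t) (x : s ⟶ t) :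
    comul (γ (k := k) g x) = ∑ l : t ⟶ t, γ l x ⊗ₜ[k] γ (g ≫ inv l) x := by
  classical
  simp only [comul, lift_γ]
  refine Finset.sum_congr rfl fun l _ => ?_
  rw [Finset.sum_eq_single (g ≫ inv l)]
  · simp
  · intro b _ hb
    rw [if_neg]
    rintro rfl
    simp at hb
  · simp

open Classical in
@[simp] theorem counit_γ {s t : 𝒢} (g : t ⟶ t) (x : s ⟶ t) :
    counit (γ (k := k) g x) = if g = 𝟙 t then 1 else 0 := by
  simp [counit]

@[simp] theorem antipode_γ {s t : 𝒢} (g : t ⟶ t) (x : s ⟶ t) :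
    antipode (γ (k := k) g x) = γ (x ≫ inv g ≫ inv x) (inv x) := by
  simp [antipode]

/-- The element `∑_{h ∈ Γ^{t(x)}} γ_h^x`. -/
def U {s t : 𝒢} (x : s ⟶ t) : DD k 𝒢 := ∑ h : t ⟶ t, γ h x

theorem U_id (x : 𝒢) : (U (𝟙 x) : DD k 𝒢) = e x := rfl

theorem γ_mul_U {s t r : 𝒢} (g : t ⟶ t) (x : s ⟶ t) (y : r ⟶ s) :
    (γ g x * U y : DD k 𝒢) = γ g (y ≫ x) := by
  classical
  simp [U, Finset.mul_sum, γ_mul_γ]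

theorem U_mul_γ {s t r : 𝒢} (x : s ⟶ t) (h : s ⟶ s) (y : r ⟶ s) :
    (U x * γ h y : DD k 𝒢) = γ (inv x ≫ h ≫ x) (y ≫ x) := by
  classical
  simp only [U, Finset.sum_mul, γ_mul_γ]
  rw [Finset.sum_eq_single (inv x ≫ h ≫ x)]
  · simp
  · intro b _ hb
    rw [if_neg]
    rintro rfl
    simp at hb
  · simp

theorem U_mul_U {s t r : 𝒢} (x : s ⟶ t) (y : r ⟶ s) :
    (U x * U y : DD k 𝒢) = U (y ≫ x) := by
  conv_lhs => rw [show (U x : DD k 𝒢) = ∑ h, γ h x from rfl, Finset.sum_mul]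
  simp only [γ_mul_U]
  rfl

theorem comul_U {s t : 𝒢} (x : s ⟶ t) : comul (U (k := k) x) = U x ⊗ₜ[k] U x := by
  simp only [U, map_sum, comul_γ]
  rw [Finset.sum_comm, sum_tmul]
  refine Finset.sum_congr rfl fun l _ => ?_
  rw [tmul_sum]
  refine Fintype.sum_equiv ⟨fun h => h ≫ inv l, fun h => h ≫ l, fun _ => by simp,
    fun _ => by simp⟩ _ _ ?_
  intro h
  rfl

theorem comul_e (x : 𝒢) : comul (e (k := k) x) = e x ⊗ₜ[k] e x := comul_U (𝟙 x)

theorem comul_one : comul (1 : DD k 𝒢) = ∑ x : 𝒢, e x ⊗ₜ[k] e x := by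
  simp [one_def, comul_e]

theorem e_mul_e_of_ne {x y : 𝒢} (h : x ≠ y) : (e x * e y : DD k 𝒢) = 0 := by
  conv_lhs => rw [e, Finset.sum_mul]
  exact Finset.sum_eq_zero fun l _ => γ_mul_e_of_ne _ _ h

@[simp] theorem e_mul_e_self (x : 𝒢) : (e x * e x : DD k 𝒢) = e x := by
  have := U_mul_U (k := k) (𝟙 x) (𝟙 x)
  simpa [U_id] using this

theorem comul_mul (a b : DD k 𝒢) : comul (a * b) = comul a * comul b := by
  classical
  induction a using DD.induction with
  | zero => simp
  | add a a' h h' => simp only [add_mul, map_add, h, h']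
  | smul r a h => simp only [smul_mul_assoc, map_smul, h]
  | @basis s t g x =>
    induction b using DD.induction with
    | zero => simp
    | add a a' h h' => simp only [mul_add, map_add, h, h']
    | smul r a h => simp only [mul_smul_comm, map_smul, h]
    | @basis s' t' h y =>
      rw [comul_γ, comul_γ, Finset.sum_mul_sum]
      simp only [Algebra.TensorProduct.tmul_mul_tmul]
      by_cases e1 : s = t'
      · subst e1
        have key : ∀ l : t ⟶ t, ∑ l' : s ⟶ s, (γ l x * γ l' y : DD k 𝒢) ⊗ₜ[k]
            (γ (g ≫ inv l) x * γ (h ≫ inv l') y : DD k 𝒢) =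
            if x ≫ g ≫ inv x = h then γ l (y ≫ x) ⊗ₜ[k] γ (g ≫ inv l) (y ≫ x) else 0 := by
          intro l
          rw [Finset.sum_eq_single (x ≫ l ≫ inv x)]
          · rw [γ_mul_γ, if_pos rfl, γ_mul_γ]
            have e2 : x ≫ (g ≫ inv l) ≫ inv x = h ≫ inv (x ≫ l ≫ inv x) ↔
                x ≫ g ≫ inv x = h := by
              rw [← cancel_mono (x ≫ l ≫ inv x)]
              simp
            simp only [e2]
            split_ifs <;> simp
          · intro b _ hb
            rw [γ_mul_γ, if_neg (Ne.symm hb), zero_tmul]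
          · simp
        rw [Finset.sum_congr rfl fun l _ => key l, γ_mul_γ]
        split_ifs
        · rw [comul_γ]
        · simp
      · rw [γ_mul_γ_of_ne _ _ _ _ e1, map_zero]
        refine (Finset.sum_eq_zero fun l _ => Finset.sum_eq_zero fun l' _ => ?_).symm
        rw [γ_mul_γ_of_ne _ _ _ _ e1, zero_tmul]

theorem epsT_apply (h : DD k 𝒢) : epsT h = ∑ x : 𝒢, counit (e x * h) • e x := by
  simp [epsT, comul_one]

open Classical in
theorem epsT_γ {s t : 𝒢} (g : t ⟶ t) (x : s ⟶ t) :
    epsT (γ (k := k) g x) = if g = 𝟙 t then e t else 0 := by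
  rw [epsT_apply, Finset.sum_eq_single t]
  · simp
  · intro b _ hb
    rw [e_mul_γ_of_ne _ _ hb]
    simp
  · simp

@[simp] theorem epsT_e (x : 𝒢) : epsT (e (k := k) x) = e x := by
  classical
  conv_lhs => rw [e]
  simp [epsT_γ]

theorem epsT_one : epsT (1 : DD k 𝒢) = 1 := by
  simp [one_def]

theorem epsT_mul_epsT (a b : DD k 𝒢) : epsT (a * epsT b) = epsT (a * b) := by
  classical
  induction a using DD.induction with
  | zero => simp
  | add a a' h h' => simp only [add_mul, map_add, h, h']
  | smul r a h => simp only [smul_mul_assoc, map_smul, h]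
  | @basis s t g x =>
    induction b using DD.induction with
    | zero => simp
    | add a a' h h' => simp only [mul_add, map_add, h, h']
    | smul r a h => simp only [mul_smul_comm, map_smul, h]
    | @basis s' t' h y =>
      rw [epsT_γ]
      by_cases e1 : s = t'
      · subst e1
        rw [γ_mul_γ]
        have e2 : x ≫ g ≫ inv x = 𝟙 s ↔ g = 𝟙 t := by
          rw [← cancel_mono x, ← cancel_epi (inv x)]
          simp
        by_cases e3 : h = 𝟙 s
        · subst e3
          simp only [if_pos, γ_mul_e, e2]
          split_ifs <;> simp [epsT_γ, *]
        · rw [if_neg e3]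
          split_ifs with e4
          · rw [epsT_γ, if_neg, mul_zero, map_zero]
            rintro rfl
            apply e3
            simpa using e4.symm
          · simp
      · rw [γ_mul_γ_of_ne _ _ _ _ e1]
        split_ifs
        · rw [γ_mul_e_of_ne _ _ e1]
        · simp

@[simp] theorem antipode_e (x : 𝒢) : antipode (e (k := k) x) = e x := by
  simp only [e, map_sum, antipode_γ]
  refine Fintype.sum_equiv ⟨fun h => inv h, fun h => inv h, fun _ => by simp,
    fun _ => by simp⟩ _ _ ?_
  intro h
  simp

end Finite

end Basic
end DD
/-! ### The category `Rep(D(k[𝒢]))` -/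

section Rep

variable (k : Type w) [Field k] (𝒢 : Type u) [Groupoid.{v} 𝒢] [Fintype 𝒢]
  [∀ x y : 𝒢, Fintype (x ⟶ y)]

/-- Objects of `Rep(D(k[𝒢]))`: finite dimensional left `D(k[𝒢])`-modules `(ρ, V)`. -/
structure RepD where
  /-- the underlying vector space -/
  V : Type (max u v w)
  [addCommGroup : AddCommGroup V]
  [module : Module k V]
  [finite : FiniteDimensional k V]
  /-- the action -/
  ρ : DD k 𝒢 →ₐ[k] Module.End k V

attribute [instance] RepD.addCommGroup RepD.module RepD.finite

variable {k 𝒢}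

namespace RepD

/-- Morphisms of `Rep(D(k[𝒢]))`: the `D(k[𝒢])`-linear maps. -/
@[ext] structure Hom (X Y : RepD.{u, v, w} k 𝒢) where
  /-- the underlying linear map -/
  lin : X.V →ₗ[k] Y.V
  comm : ∀ (h : DD k 𝒢) (a : X.V), lin (X.ρ h a) = Y.ρ h (lin a)

instance : Category (RepD.{u, v, w} k 𝒢) where
  Hom := Hom
  id X := ⟨LinearMap.id, fun _ _ => rfl⟩
  comp f g := ⟨g.lin ∘ₗ f.lin, fun h a => by simp [f.comm, g.comm]⟩

@[ext] theorem hom_ext {X Y : RepD.{u, v, w} k 𝒢} {f g : X ⟶ Y} (h : f.lin = g.lin) : f = g :=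
  Hom.ext h

@[simp] theorem id_lin (X : RepD.{u, v, w} k 𝒢) : Hom.lin (𝟙 X) = LinearMap.id := rfl

@[simp] theorem comp_lin {X Y Z : RepD.{u, v, w} k 𝒢} (f : X ⟶ Y) (g : Y ⟶ Z) :
    (f ≫ g).lin = g.lin ∘ₗ f.lin := rfl

theorem ρ_mul_apply (X : RepD.{u, v, w} k 𝒢) (a b : DD k 𝒢) (x : X.V) :
    X.ρ (a * b) x = X.ρ a (X.ρ b x) := by simp

/-- A `D(k[𝒢])`-linear map with a linear inverse is an isomorphism. -/
def mkIso {X Y : RepD.{u, v, w} k 𝒢} (f : X ⟶ Y) (g : Y.V →ₗ[k] X.V)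
    (h₁ : ∀ a, g (f.lin a) = a) (h₂ : ∀ a, f.lin (g a) = a) : X ≅ Y where
  hom := f
  inv := ⟨g, fun h a => by
    conv_lhs => rw [← h₂ a, ← f.comm, h₁]⟩
  hom_inv_id := by ext a; exact h₁ a
  inv_hom_id := by ext a; exact h₂ a

/-- The algebra homomorphism `ρ₁ ⊗ ρ₂ : D(k[𝒢]) ⊗ D(k[𝒢]) → End(A₁ ⊗ A₂)`. -/
def act₂ (X Y : RepD.{u, v, w} k 𝒢) :
    DD k 𝒢 ⊗[k] DD k 𝒢 →ₐ[k] Module.End k (X.V ⊗[k] Y.V) :=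
  (Module.endTensorEndAlgHom (R := k) (S := k) (A := k) (M := X.V) (N := Y.V)).comp
    (Algebra.TensorProduct.map X.ρ Y.ρ)

@[simp] theorem act₂_tmul (X Y : RepD.{u, v, w} k 𝒢) (a b : DD k 𝒢) (x : X.V) (y : Y.V) :
    act₂ X Y (a ⊗ₜ b) (x ⊗ₜ y) = X.ρ a x ⊗ₜ Y.ρ b y := rfl

/-- The action `ρ₁₂(h) = (ρ₁ ⊗ ρ₂)(Δ(h))` on `A₁ ⊗ A₂` (which need not preserve the unit). -/
def act₁₂ (X Y : RepD.{u, v, w} k 𝒢) (h : DD k 𝒢) : Module.End k (X.V ⊗[k] Y.V) :=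
  act₂ X Y (DD.comul h)

theorem act₁₂_mul (X Y : RepD.{u, v, w} k 𝒢) (a b : DD k 𝒢) :
    act₁₂ X Y (a * b) = act₁₂ X Y a * act₁₂ X Y b := by
  simp [act₁₂, DD.comul_mul]

theorem act₁₂_mul_apply (X Y : RepD.{u, v, w} k 𝒢) (a b : DD k 𝒢) (t : X.V ⊗[k] Y.V) :
    act₁₂ X Y (a * b) t = act₁₂ X Y a (act₁₂ X Y b t) := by
  rw [act₁₂_mul]; rfl

/-- The subspace `{a ∈ A₁ ⊗ A₂ | ρ₁₂(1) a = a}`. -/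
def hat (X Y : RepD.{u, v, w} k 𝒢) : Submodule k (X.V ⊗[k] Y.V) :=
  LinearMap.eqLocus (act₁₂ X Y 1) LinearMap.id

theorem mem_hat {X Y : RepD.{u, v, w} k 𝒢} {t : X.V ⊗[k] Y.V} :
    t ∈ hat X Y ↔ act₁₂ X Y 1 t = t := Iff.rfl

theorem act₁₂_mem (X Y : RepD.{u, v, w} k 𝒢) (h : DD k 𝒢) (t : X.V ⊗[k] Y.V) :
    act₁₂ X Y h t ∈ hat X Y := by
  rw [mem_hat, ← act₁₂_mul_apply, one_mul]

/-- The monoidal product of objects: the subspace `hat X Y` of `A₁ ⊗ A₂` with the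
action `ρ₁₂`. -/
def tensorObj' (X Y : RepD.{u, v, w} k 𝒢) : RepD.{u, v, w} k 𝒢 where
  V := hat X Y
  ρ := AlgHom.ofLinearMap
    { toFun := fun h => (act₁₂ X Y h).restrict fun t _ => act₁₂_mem X Y h t
      map_add' := fun a b => by
        ext t
        simp [act₁₂]
      map_smul' := fun r a => by
        ext t
        simp [act₁₂] }
    (by
      ext t
      exact mem_hat.1 t.2)
    (fun a b => by
      ext t
      exact act₁₂_mul_apply X Y a b t)

/-- The inclusion of the monoidal product into `A₁ ⊗ A₂`. -/
def ι (X Y : RepD.{u, v, w} k 𝒢) : (tensorObj' X Y).V →ₗ[k] X.V ⊗[k] Y.V :=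
  (hat X Y).subtype

/-- The projection `ρ₁₂(1)` of `A₁ ⊗ A₂` onto the monoidal product. -/
def π (X Y : RepD.{u, v, w} k 𝒢) : X.V ⊗[k] Y.V →ₗ[k] (tensorObj' X Y).V :=
  (act₁₂ X Y 1).codRestrict (hat X Y) (act₁₂_mem X Y 1)

@[simp] theorem ι_π (X Y : RepD.{u, v, w} k 𝒢) (t : X.V ⊗[k] Y.V) :
    ι X Y (π X Y t) = act₁₂ X Y 1 t := rfl

theorem ι_injective (X Y : RepD.{u, v, w} k 𝒢) : Function.Injective (ι X Y) :=
  Subtype.val_injective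

theorem act₁₂_one_ι (X Y : RepD.{u, v, w} k 𝒢) (t : (tensorObj' X Y).V) :
    act₁₂ X Y 1 (ι X Y t) = ι X Y t := mem_hat.1 t.2

@[simp] theorem π_ι (X Y : RepD.{u, v, w} k 𝒢) (t : (tensorObj' X Y).V) :
    π X Y (ι X Y t) = t := ι_injective X Y (act₁₂_one_ι X Y t)

theorem ι_ρ (X Y : RepD.{u, v, w} k 𝒢) (h : DD k 𝒢) (t : (tensorObj' X Y).V) :
    ι X Y ((tensorObj' X Y).ρ h t) = act₁₂ X Y h (ι X Y t) := rfl

theorem ρ_π (X Y : RepD.{u, v, w} k 𝒢) (h : DD k 𝒢) (t : X.V ⊗[k] Y.V) :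
    (tensorObj' X Y).ρ h (π X Y t) = π X Y (act₁₂ X Y h t) := by
  apply ι_injective
  rw [ι_ρ, ι_π, ι_π, ← act₁₂_mul_apply, ← act₁₂_mul_apply, one_mul, mul_one]

/-- The image `π(x ⊗ y)` of a pure tensor in the monoidal product. -/
def pt {X Y : RepD.{u, v, w} k 𝒢} (x : X.V) (y : Y.V) : (tensorObj' X Y).V := π X Y (x ⊗ₜ y)

theorem lin_ext {X Y : RepD.{u, v, w} k 𝒢} {M : Type*} [AddCommGroup M] [Module k M]
    {f g : (tensorObj' X Y).V →ₗ[k] M} (h : ∀ x y, f (pt x y) = g (pt x y)) : f = g := by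
  have : f ∘ₗ π X Y = g ∘ₗ π X Y := TensorProduct.ext' h
  ext t
  have := LinearMap.congr_fun this (ι X Y t)
  simpa using this

theorem tensor_hom_ext {X Y Z : RepD.{u, v, w} k 𝒢} {f g : tensorObj' X Y ⟶ Z}
    (h : ∀ x y, f.lin (pt x y) = g.lin (pt x y)) : f = g :=
  hom_ext (lin_ext h)

/-- `pt` as a bilinear map. -/
def ptLin (X Y : RepD.{u, v, w} k 𝒢) : X.V →ₗ[k] Y.V →ₗ[k] (tensorObj' X Y).V :=
  (TensorProduct.mk k X.V Y.V).compr₂ (π X Y)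

theorem ptLin_apply {X Y : RepD.{u, v, w} k 𝒢} (x : X.V) (y : Y.V) : ptLin X Y x y = pt x y := rfl

theorem pt_sum_left {X Y : RepD.{u, v, w} k 𝒢} {J : Type*} (s : Finset J) (f : J → X.V) (y : Y.V) :
    pt (∑ i ∈ s, f i) y = ∑ i ∈ s, pt (f i) y := by
  simp [← ptLin_apply]

theorem pt_sum_right {X Y : RepD.{u, v, w} k 𝒢} {J : Type*} (s : Finset J) (f : J → Y.V) (x : X.V) :
    pt x (∑ i ∈ s, f i) = ∑ i ∈ s, pt x (f i) := by
  simp [← ptLin_apply]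

theorem act₁₂_one (X Y : RepD.{u, v, w} k 𝒢) (x : X.V) (y : Y.V) :
    act₁₂ X Y 1 (x ⊗ₜ y) = ∑ z : 𝒢, X.ρ (DD.e z) x ⊗ₜ[k] Y.ρ (DD.e z) y := by
  simp [act₁₂, DD.comul_one, LinearMap.sum_apply]

theorem ι_pt {X Y : RepD.{u, v, w} k 𝒢} (x : X.V) (y : Y.V) :
    ι X Y (pt x y) = ∑ z : 𝒢, X.ρ (DD.e z) x ⊗ₜ[k] Y.ρ (DD.e z) y :=
  act₁₂_one X Y x y

theorem ρ_e_e (X : RepD.{u, v, w} k 𝒢) (z : 𝒢) (x : X.V) :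
    X.ρ (DD.e z) (X.ρ (DD.e z) x) = X.ρ (DD.e z) x := by
  rw [← ρ_mul_apply, DD.e_mul_e_self]

theorem ρ_e_e_of_ne (X : RepD.{u, v, w} k 𝒢) {z z' : 𝒢} (h : z ≠ z') (x : X.V) :
    X.ρ (DD.e z) (X.ρ (DD.e z') x) = 0 := by
  rw [← ρ_mul_apply, DD.e_mul_e_of_ne h, map_zero, LinearMap.zero_apply]

theorem sum_ρ_e (X : RepD.{u, v, w} k 𝒢) (x : X.V) : ∑ z : 𝒢, X.ρ (DD.e z) x = x := by
  have : X.ρ 1 x = x := by simp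
  rw [DD.one_def] at this
  simpa [LinearMap.sum_apply] using this

theorem pt_e_e {X Y : RepD.{u, v, w} k 𝒢} (z : 𝒢) (x : X.V) (y : Y.V) :
    pt (X.ρ (DD.e z) x) (Y.ρ (DD.e z) y) = (tensorObj' X Y).ρ (DD.e z) (pt x y) := by
  rw [pt, pt, ρ_π, act₁₂, DD.comul_e, act₂_tmul]

theorem pt_e_left {X Y : RepD.{u, v, w} k 𝒢} (z : 𝒢) (x : X.V) (y : Y.V) :
    pt (X.ρ (DD.e z) x) y = (tensorObj' X Y).ρ (DD.e z) (pt x y) := by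
  rw [← pt_e_e]
  apply ι_injective
  rw [ι_pt, ι_pt]
  refine Finset.sum_congr rfl fun z' _ => ?_
  by_cases h : z' = z
  · subst h; rw [ρ_e_e Y]
  · rw [ρ_e_e_of_ne X h, zero_tmul, zero_tmul]

theorem pt_e_right {X Y : RepD.{u, v, w} k 𝒢} (z : 𝒢) (x : X.V) (y : Y.V) :
    pt x (Y.ρ (DD.e z) y) = (tensorObj' X Y).ρ (DD.e z) (pt x y) := by
  rw [← pt_e_e]
  apply ι_injective
  rw [ι_pt, ι_pt]
  refine Finset.sum_congr rfl fun z' _ => ?_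
  by_cases h : z' = z
  · subst h; rw [ρ_e_e X]
  · rw [ρ_e_e_of_ne Y h, tmul_zero, tmul_zero]

theorem sum_pt_e_e {X Y : RepD.{u, v, w} k 𝒢} (x : X.V) (y : Y.V) :
    ∑ z : 𝒢, pt (X.ρ (DD.e z) x) (Y.ρ (DD.e z) y) = pt x y := by
  simp only [pt_e_e]
  exact sum_ρ_e _ _

theorem ρ_γ_pt {X Y : RepD.{u, v, w} k 𝒢} {s t : 𝒢} (g : t ⟶ t) (f : s ⟶ t) (x : X.V) (y : Y.V) :
    (tensorObj' X Y).ρ (DD.γ g f) (pt x y) =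
      ∑ l : t ⟶ t, pt (X.ρ (DD.γ l f) x) (Y.ρ (DD.γ (g ≫ inv l) f) y) := by
  rw [pt, ρ_π, act₁₂, DD.comul_γ]
  simp [LinearMap.sum_apply, pt]

theorem ρ_U_pt {X Y : RepD.{u, v, w} k 𝒢} {s t : 𝒢} (f : s ⟶ t) (x : X.V) (y : Y.V) :
    (tensorObj' X Y).ρ (DD.U f) (pt x y) = pt (X.ρ (DD.U f) x) (Y.ρ (DD.U f) y) := by
  rw [pt, ρ_π, act₁₂, DD.comul_U, act₂_tmul, pt]

/-! #### Monoidal product of morphisms -/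

theorem map_act₁₂ {X X' Y Y' : RepD.{u, v, w} k 𝒢} (f : X ⟶ X') (g : Y ⟶ Y') (h : DD k 𝒢)
    (t : X.V ⊗[k] Y.V) :
    TensorProduct.map f.lin g.lin (act₁₂ X Y h t) =
      act₁₂ X' Y' h (TensorProduct.map f.lin g.lin t) := by
  rw [act₁₂, act₁₂]
  induction DD.comul h using TensorProduct.induction_on with
  | zero => simp
  | add a b ha hb => simp [ha, hb]
  | tmul a b =>
    induction t using TensorProduct.induction_on with
    | zero => simp
    | add a b ha hb => simp only [map_add, ha, hb]
    | tmul x y => simp [f.comm, g.comm]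

/-- The monoidal product of morphisms: the restriction of the usual tensor product of linear
maps. -/
def tensorHom' {X X' Y Y' : RepD.{u, v, w} k 𝒢} (f : X ⟶ X') (g : Y ⟶ Y') :
    tensorObj' X Y ⟶ tensorObj' X' Y' where
  lin := (TensorProduct.map f.lin g.lin).restrict (p := hat X Y) (q := hat X' Y') fun t ht => by
    rw [mem_hat] at ht ⊢
    rw [← map_act₁₂, ht]
  comm h t := by
    apply ι_injective
    exact map_act₁₂ f g h t.1

theorem ι_tensorHom' {X X' Y Y' : RepD.{u, v, w} k 𝒢} (f : X ⟶ X') (g : Y ⟶ Y')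
    (t : (tensorObj' X Y).V) :
    ι X' Y' ((tensorHom' f g).lin t) = TensorProduct.map f.lin g.lin (ι X Y t) := rfl

theorem tensorHom'_pt {X X' Y Y' : RepD.{u, v, w} k 𝒢} (f : X ⟶ X') (g : Y ⟶ Y')
    (x : X.V) (y : Y.V) :
    (tensorHom' f g).lin (pt x y) = pt (f.lin x) (g.lin y) := by
  apply ι_injective
  rw [ι_tensorHom', pt, ι_π, map_act₁₂, map_tmul, pt, ι_π]

/-! #### The associator -/

/-- The underlying linear map of the associator. -/
def assocLin (X Y Z : RepD.{u, v, w} k 𝒢) :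
    (tensorObj' (tensorObj' X Y) Z).V →ₗ[k] (tensorObj' X (tensorObj' Y Z)).V :=
  π X (tensorObj' Y Z) ∘ₗ LinearMap.lTensor X.V (π Y Z) ∘ₗ
    (TensorProduct.assoc k X.V Y.V Z.V).toLinearMap ∘ₗ
    LinearMap.rTensor Z.V (ι X Y) ∘ₗ ι (tensorObj' X Y) Z

/-- The underlying linear map of the inverse of the associator. -/
def assocInvLin (X Y Z : RepD.{u, v, w} k 𝒢) :
    (tensorObj' X (tensorObj' Y Z)).V →ₗ[k] (tensorObj' (tensorObj' X Y) Z).V :=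
  π (tensorObj' X Y) Z ∘ₗ LinearMap.rTensor Z.V (π X Y) ∘ₗ
    (TensorProduct.assoc k X.V Y.V Z.V).symm.toLinearMap ∘ₗ
    LinearMap.lTensor X.V (ι Y Z) ∘ₗ ι X (tensorObj' Y Z)

theorem ι_pt_e {X Y : RepD.{u, v, w} k 𝒢} (z : 𝒢) (x : X.V) (y : Y.V) :
    ι X Y ((tensorObj' X Y).ρ (DD.e z) (pt x y)) = X.ρ (DD.e z) x ⊗ₜ Y.ρ (DD.e z) y := by
  rw [← pt_e_e, ι_pt, Finset.sum_eq_single z]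
  · rw [ρ_e_e, ρ_e_e]
  · intro z' _ h
    rw [ρ_e_e_of_ne _ h, zero_tmul]
  · simp

theorem assocLin_pt {X Y Z : RepD.{u, v, w} k 𝒢} (x : X.V) (y : Y.V) (z : Z.V) :
    assocLin X Y Z (pt (pt x y) z) = pt x (pt y z) := by
  simp only [assocLin, LinearMap.comp_apply, ι_pt, map_sum, LinearMap.rTensor_tmul, ι_pt_e,
    LinearEquiv.coe_coe, TensorProduct.assoc_tmul, LinearMap.lTensor_tmul]
  rw [← sum_pt_e_e]
  refine Finset.sum_congr rfl fun c _ => ?_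
  rw [← pt_e_e]
  rfl

theorem assocInvLin_pt {X Y Z : RepD.{u, v, w} k 𝒢} (x : X.V) (y : Y.V) (z : Z.V) :
    assocInvLin X Y Z (pt x (pt y z)) = pt (pt x y) z := by
  simp only [assocInvLin, LinearMap.comp_apply, ι_pt, map_sum, LinearMap.lTensor_tmul, ι_pt_e,
    LinearEquiv.coe_coe, TensorProduct.assoc_symm_tmul, LinearMap.rTensor_tmul]
  rw [← sum_pt_e_e]
  refine Finset.sum_congr rfl fun c _ => ?_
  rw [← pt_e_e]
  rfl

theorem lin_ext₃ {X Y Z : RepD.{u, v, w} k 𝒢} {M : Type*} [AddCommGroup M] [Module k M]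
    {f g : (tensorObj' (tensorObj' X Y) Z).V →ₗ[k] M}
    (h : ∀ x y z, f (pt (pt x y) z) = g (pt (pt x y) z)) : f = g := by
  refine lin_ext fun t z => ?_
  have : f ∘ₗ (ptLin (tensorObj' X Y) Z).flip z = g ∘ₗ (ptLin (tensorObj' X Y) Z).flip z :=
    lin_ext fun x y => h x y z
  exact LinearMap.congr_fun this t

theorem lin_ext₃' {X Y Z : RepD.{u, v, w} k 𝒢} {M : Type*} [AddCommGroup M] [Module k M]
    {f g : (tensorObj' X (tensorObj' Y Z)).V →ₗ[k] M}
    (h : ∀ x y z, f (pt x (pt y z)) = g (pt x (pt y z))) : f = g := by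
  refine lin_ext fun x t => ?_
  have : f ∘ₗ ptLin X (tensorObj' Y Z) x = g ∘ₗ ptLin X (tensorObj' Y Z) x :=
    lin_ext fun y z => h x y z
  exact LinearMap.congr_fun this t

theorem lin_ext₄ {W X Y Z : RepD.{u, v, w} k 𝒢} {M : Type*} [AddCommGroup M] [Module k M]
    {f g : (tensorObj' (tensorObj' (tensorObj' W X) Y) Z).V →ₗ[k] M}
    (h : ∀ a x y z, f (pt (pt (pt a x) y) z) = g (pt (pt (pt a x) y) z)) : f = g := by
  refine lin_ext fun t z => ?_
  have : f ∘ₗ (ptLin _ Z).flip z = g ∘ₗ (ptLin _ Z).flip z :=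
    lin_ext₃ fun a x y => h a x y z
  exact LinearMap.congr_fun this t

/-- The associator. -/
def associator' (X Y Z : RepD.{u, v, w} k 𝒢) :
    tensorObj' (tensorObj' X Y) Z ≅ tensorObj' X (tensorObj' Y Z) :=
  mkIso
    { lin := assocLin X Y Z
      comm := fun h a => by
        suffices assocLin X Y Z ∘ₗ (tensorObj' (tensorObj' X Y) Z).ρ h =
          (tensorObj' X (tensorObj' Y Z)).ρ h ∘ₗ assocLin X Y Z from LinearMap.congr_fun this a
        refine lin_ext₃ fun x y z => ?_
        simp only [LinearMap.comp_apply, assocLin_pt]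
        induction h using DD.induction with
        | zero => simp
        | add a b ha hb => simp only [map_add, LinearMap.add_apply, ha, hb]
        | smul r a ha => simp only [map_smul, LinearMap.smul_apply, ha]
        | @basis s t g f =>
          simp only [ρ_γ_pt, pt_sum_left, pt_sum_right, map_sum, assocLin_pt]
          rw [Finset.sum_comm]
          refine Finset.sum_congr rfl fun l _ => ?_
          refine Fintype.sum_equiv ⟨fun h => h ≫ inv l, fun h => h ≫ l, fun _ => by simp,
            fun _ => by simp⟩ _ _ ?_
          intro m
          simp }
    (assocInvLin X Y Z)
    (fun a => by
      suffices assocInvLin X Y Z ∘ₗ assocLin X Y Z = LinearMap.id from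
        LinearMap.congr_fun this a
      exact lin_ext₃ fun x y z => by simp [assocLin_pt, assocInvLin_pt])
    (fun a => by
      suffices assocLin X Y Z ∘ₗ assocInvLin X Y Z = LinearMap.id from
        LinearMap.congr_fun this a
      exact lin_ext₃' fun x y z => by simp [assocLin_pt, assocInvLin_pt])

theorem ι_assocLin (X Y Z : RepD.{u, v, w} k 𝒢) (t : (tensorObj' (tensorObj' X Y) Z).V) :
    LinearMap.lTensor X.V (ι Y Z) (ι X (tensorObj' Y Z) (assocLin X Y Z t)) =
      TensorProduct.assoc k X.V Y.V Z.V
        (LinearMap.rTensor Z.V (ι X Y) (ι (tensorObj' X Y) Z t)) := by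
  suffices LinearMap.lTensor X.V (ι Y Z) ∘ₗ ι X (tensorObj' Y Z) ∘ₗ assocLin X Y Z =
      (TensorProduct.assoc k X.V Y.V Z.V).toLinearMap ∘ₗ
        LinearMap.rTensor Z.V (ι X Y) ∘ₗ ι (tensorObj' X Y) Z from LinearMap.congr_fun this t
  refine lin_ext₃ fun x y z => ?_
  simp only [LinearMap.comp_apply, assocLin_pt, ι_pt, map_sum, LinearMap.lTensor_tmul,
    LinearMap.rTensor_tmul, ι_pt_e, LinearEquiv.coe_coe, TensorProduct.assoc_tmul]

/-! #### The unit object and the unit morphisms -/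

variable (k 𝒢) in
/-- The unit object: `D(k[𝒢])_t = ε_t(D(k[𝒢]))` with the action `σ_t(h) z = ε_t(h z)`. -/
def unitObj : RepD.{u, v, w} k 𝒢 where
  V := LinearMap.range (DD.epsT : DD k 𝒢 →ₗ[k] DD k 𝒢)
  ρ := AlgHom.ofLinearMap
    { toFun := fun h => (DD.epsT ∘ₗ LinearMap.mulLeft k h ∘ₗ Submodule.subtype _).codRestrict _
        fun _ => LinearMap.mem_range_self _ _
      map_add' := fun a b => by
        ext t
        simp [add_mul]
      map_smul' := fun r a => by
        ext t
        simp }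
    (by
      ext ⟨t, c, rfl⟩
      have := DD.epsT_mul_epsT 1 c
      rw [one_mul c] at this
      exact this)
    (fun a b => by
      ext t
      have := DD.epsT_mul_epsT a (b * t.1)
      rw [← mul_assoc] at this
      exact this.symm)

/-- The element of `D(k[𝒢])` underlying an element of the unit object. -/
def toDD : (unitObj k 𝒢 : RepD.{u, v, w} k 𝒢).V →ₗ[k] DD k 𝒢 :=
  (LinearMap.range (DD.epsT : DD k 𝒢 →ₗ[k] DD k 𝒢)).subtype

theorem toDD_injective : Function.Injective (toDD (k := k) (𝒢 := 𝒢)) :=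
  Subtype.val_injective

theorem toDD_ρ (h : DD k 𝒢) (z : (unitObj k 𝒢 : RepD.{u, v, w} k 𝒢).V) :
    toDD ((unitObj k 𝒢).ρ h z) = DD.epsT (h * toDD z) := rfl

variable (k) in
/-- `1^x`, as an element of the unit object. -/
def E (x : 𝒢) : (unitObj k 𝒢 : RepD.{u, v, w} k 𝒢).V := ⟨DD.e x, DD.e x, DD.epsT_e x⟩

@[simp] theorem toDD_E (x : 𝒢) : toDD (E k x) = DD.e x := rfl

variable (k 𝒢) in
/-- The unit `1 ∈ D(k[𝒢])`, as an element of the unit object. -/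
def one' : (unitObj k 𝒢 : RepD.{u, v, w} k 𝒢).V := ⟨1, 1, DD.epsT_one⟩

theorem one'_eq_sum : one' k 𝒢 = ∑ x : 𝒢, E k x := by
  apply toDD_injective
  rw [map_sum]
  rfl

theorem eq_sum_E (z : (unitObj k 𝒢 : RepD.{u, v, w} k 𝒢).V) :
    ∃ c : 𝒢 → k, z = ∑ x, c x • E k x := by
  obtain ⟨z, h, rfl⟩ := z
  refine ⟨fun x => DD.counit (DD.e x * h), ?_⟩
  apply toDD_injective
  rw [map_sum]
  exact DD.epsT_apply h

theorem unit_lin_ext {M : Type*} [AddCommGroup M] [Module k M]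
    {f g : (unitObj k 𝒢 : RepD.{u, v, w} k 𝒢).V →ₗ[k] M}
    (h : ∀ x, f (E k x) = g (E k x)) : f = g := by
  ext z
  obtain ⟨c, rfl⟩ := eq_sum_E z
  simp [h]

theorem ρ_e_E (x : 𝒢) : (unitObj k 𝒢).ρ (DD.e x) (E k x) = E k x := by
  apply toDD_injective
  rw [toDD_ρ]
  simp

theorem ρ_γ_E_of_ne {s t x : 𝒢} (g : t ⟶ t) (f : s ⟶ t) (h : s ≠ x) :
    (unitObj k 𝒢).ρ (DD.γ g f) (E k x) = 0 := by
  apply toDD_injective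
  rw [toDD_ρ, toDD_E, DD.γ_mul_e_of_ne _ _ h, map_zero, map_zero]

open Classical in
theorem ρ_γ_E {s t : 𝒢} (g : t ⟶ t) (f : s ⟶ t) :
    (unitObj k 𝒢).ρ (DD.γ g f) (E k s) = if g = 𝟙 t then E k t else 0 := by
  apply toDD_injective
  rw [toDD_ρ, toDD_E, DD.γ_mul_e, DD.epsT_γ]
  split_ifs <;> simp

/-- The linear map underlying the left unit morphism,
`σ_t(1_{(1)}) z ⊗ ρ(1_{(2)}) a ↦ ρ(z) a`; it is the restriction of `z ⊗ a ↦ ρ(z) a`. -/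
def leftLin (X : RepD.{u, v, w} k 𝒢) : (tensorObj' (unitObj k 𝒢) X).V →ₗ[k] X.V :=
  TensorProduct.lift (X.ρ.toLinearMap ∘ₗ toDD) ∘ₗ ι (unitObj k 𝒢) X

/-- The linear map underlying the right unit morphism,
`ρ(1_{(1)}) a ⊗ σ_t(1_{(2)}) z ↦ ρ(S(z)) a`; it is the restriction of `a ⊗ z ↦ ρ(S(z)) a`. -/
def rightLin (X : RepD.{u, v, w} k 𝒢) : (tensorObj' X (unitObj k 𝒢)).V →ₗ[k] X.V :=
  TensorProduct.lift (X.ρ.toLinearMap ∘ₗ DD.antipode ∘ₗ toDD).flip ∘ₗ ι X (unitObj k 𝒢)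

theorem leftLin_pt_E (X : RepD.{u, v, w} k 𝒢) (x : 𝒢) (a : X.V) :
    leftLin X (pt (E k x) a) = X.ρ (DD.e x) a := by
  have : pt (X := unitObj k 𝒢) (E k x) a = (tensorObj' _ X).ρ (DD.e x) (pt (E k x) a) := by
    rw [← pt_e_left, ρ_e_E]
  rw [this, leftLin, LinearMap.comp_apply, ι_pt_e]
  simp [ρ_e_E, ← ρ_mul_apply, -map_mul]

theorem rightLin_pt_E (X : RepD.{u, v, w} k 𝒢) (x : 𝒢) (a : X.V) :
    rightLin X (pt a (E k x)) = X.ρ (DD.e x) a := by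
  have : pt (Y := unitObj k 𝒢) a (E k x) = (tensorObj' X _).ρ (DD.e x) (pt a (E k x)) := by
    rw [← pt_e_right, ρ_e_E]
  rw [this, rightLin, LinearMap.comp_apply, ι_pt_e]
  simp [ρ_e_E, ← ρ_mul_apply, -map_mul]

theorem leftLin_pt (X : RepD.{u, v, w} k 𝒢) (z : (unitObj k 𝒢 : RepD.{u, v, w} k 𝒢).V) (a : X.V) :
    leftLin X (pt z a) = X.ρ (toDD z) a := by
  suffices leftLin X ∘ₗ (ptLin _ X).flip a =
    (X.ρ.toLinearMap ∘ₗ toDD).flip a from LinearMap.congr_fun this z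
  exact unit_lin_ext fun x => leftLin_pt_E X x a

theorem rightLin_pt (X : RepD.{u, v, w} k 𝒢) (z : (unitObj k 𝒢 : RepD.{u, v, w} k 𝒢).V)
    (a : X.V) : rightLin X (pt a z) = X.ρ (DD.antipode (toDD z)) a := by
  suffices rightLin X ∘ₗ ptLin X _ a =
    (X.ρ.toLinearMap ∘ₗ DD.antipode ∘ₗ toDD).flip a from LinearMap.congr_fun this z
  exact unit_lin_ext fun x => by simp [ptLin_apply, rightLin_pt_E]

theorem lin_ext_left {X : RepD.{u, v, w} k 𝒢} {M : Type*} [AddCommGroup M] [Module k M]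
    {f g : (tensorObj' (unitObj k 𝒢) X).V →ₗ[k] M}
    (h : ∀ x a, f (pt (E k x) a) = g (pt (E k x) a)) : f = g := by
  refine lin_ext fun z a => ?_
  have : f ∘ₗ (ptLin _ X).flip a = g ∘ₗ (ptLin _ X).flip a := unit_lin_ext fun x => h x a
  exact LinearMap.congr_fun this z

theorem lin_ext_right {X : RepD.{u, v, w} k 𝒢} {M : Type*} [AddCommGroup M] [Module k M]
    {f g : (tensorObj' X (unitObj k 𝒢)).V →ₗ[k] M}
    (h : ∀ x a, f (pt a (E k x)) = g (pt a (E k x))) : f = g := by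
  refine lin_ext fun a z => ?_
  have : f ∘ₗ ptLin X _ a = g ∘ₗ ptLin X _ a := unit_lin_ext fun x => h x a
  exact LinearMap.congr_fun this z

theorem pt_one'_e {X : RepD.{u, v, w} k 𝒢} (x : 𝒢) (a : X.V) :
    pt (one' k 𝒢) (X.ρ (DD.e x) a) = pt (E k x) a := by
  classical
  rw [pt_e_right, ← pt_e_left, one'_eq_sum, map_sum, Finset.sum_eq_single x]
  · rw [ρ_e_E]
  · intro y _ hy
    rw [DD.e, map_sum, LinearMap.sum_apply]
    exact Finset.sum_eq_zero fun g _ => ρ_γ_E_of_ne _ _ (Ne.symm hy)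
  · simp

theorem pt_e_one' {X : RepD.{u, v, w} k 𝒢} (x : 𝒢) (a : X.V) :
    pt (X.ρ (DD.e x) a) (one' k 𝒢) = pt a (E k x) := by
  classical
  rw [pt_e_left, ← pt_e_right, one'_eq_sum, map_sum, Finset.sum_eq_single x]
  · rw [ρ_e_E]
  · intro y _ hy
    rw [DD.e, map_sum, LinearMap.sum_apply]
    exact Finset.sum_eq_zero fun g _ => ρ_γ_E_of_ne _ _ (Ne.symm hy)
  · simp

/-- The left unit isomorphism. -/
def leftUnitor' (X : RepD.{u, v, w} k 𝒢) : tensorObj' (unitObj k 𝒢) X ≅ X :=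
  mkIso
    { lin := leftLin X
      comm := fun h t => by
        suffices leftLin X ∘ₗ (tensorObj' _ X).ρ h = X.ρ h ∘ₗ leftLin X from
          LinearMap.congr_fun this t
        refine lin_ext_left fun x a => ?_
        simp only [LinearMap.comp_apply, leftLin_pt_E]
        induction h using DD.induction with
        | zero => simp
        | add a b ha hb => simp only [map_add, LinearMap.add_apply, ha, hb]
        | smul r a ha => simp only [map_smul, LinearMap.smul_apply, ha]
        | @basis s t g f =>
          classical
          rw [ρ_γ_pt, map_sum]
          by_cases hs : s = x
          · subst hs
            rw [Finset.sum_eq_single (𝟙 t)]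
            · simp only [ρ_γ_E, if_true, leftLin_pt_E, ← ρ_mul_apply]
              simp [DD.e_mul_γ, DD.γ_mul_e, -map_mul]
            · intro l _ hl
              rw [ρ_γ_E, if_neg hl, ← ptLin_apply]
              simp
            · simp
          · rw [← ρ_mul_apply, DD.γ_mul_e_of_ne _ _ hs, map_zero, LinearMap.zero_apply]
            refine Finset.sum_eq_zero fun l _ => ?_
            rw [ρ_γ_E_of_ne _ _ hs, ← ptLin_apply]
            simp }
    (ptLin (unitObj k 𝒢) X (one' k 𝒢))
    (fun t => by
      suffices ptLin (unitObj k 𝒢) X (one' k 𝒢) ∘ₗ leftLin X = LinearMap.id from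
        LinearMap.congr_fun this t
      refine lin_ext_left fun x a => ?_
      simp [leftLin_pt_E, ptLin_apply, pt_one'_e])
    (fun a => by
      change leftLin X (pt _ a) = a
      rw [leftLin_pt]
      change X.ρ 1 a = a
      simp)

/-- The right unit isomorphism. -/
def rightUnitor' (X : RepD.{u, v, w} k 𝒢) : tensorObj' X (unitObj k 𝒢) ≅ X :=
  mkIso
    { lin := rightLin X
      comm := fun h t => by
        suffices rightLin X ∘ₗ (tensorObj' X _).ρ h = X.ρ h ∘ₗ rightLin X from
          LinearMap.congr_fun this t
        refine lin_ext_right fun x a => ?_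
        simp only [LinearMap.comp_apply, rightLin_pt_E]
        induction h using DD.induction with
        | zero => simp
        | add a b ha hb => simp only [map_add, LinearMap.add_apply, ha, hb]
        | smul r a ha => simp only [map_smul, LinearMap.smul_apply, ha]
        | @basis s t g f =>
          classical
          rw [ρ_γ_pt, map_sum]
          by_cases hs : s = x
          · subst hs
            rw [Finset.sum_eq_single g]
            · rw [ρ_γ_E, if_pos (by simp), rightLin_pt_E, ← ρ_mul_apply, ← ρ_mul_apply]
              simp [DD.e_mul_γ, DD.γ_mul_e, -map_mul]
            · intro l _ hl
              rw [ρ_γ_E, if_neg, ← ptLin_apply]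
              · simp
              · intro h
                apply hl
                rw [← cancel_mono (inv l), h]
                simp
            · simp
          · rw [← ρ_mul_apply, DD.γ_mul_e_of_ne _ _ hs, map_zero, LinearMap.zero_apply]
            refine Finset.sum_eq_zero fun l _ => ?_
            rw [ρ_γ_E_of_ne _ _ hs, ← ptLin_apply]
            simp }
    ((ptLin X (unitObj k 𝒢)).flip (one' k 𝒢))
    (fun t => by
      suffices (ptLin X (unitObj k 𝒢)).flip (one' k 𝒢) ∘ₗ rightLin X = LinearMap.id from
        LinearMap.congr_fun this t
      refine lin_ext_right fun x a => ?_
      simp [rightLin_pt_E, ptLin_apply, pt_e_one'])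
    (fun a => by
      change rightLin X (pt a _) = a
      rw [one'_eq_sum, pt_sum_right, map_sum]
      simp only [rightLin_pt_E]
      exact sum_ρ_e X a)

instance : MonoidalCategoryStruct (RepD.{u, v, w} k 𝒢) where
  tensorObj := tensorObj'
  whiskerLeft X _ _ f := tensorHom' (𝟙 X) f
  whiskerRight f Y := tensorHom' f (𝟙 Y)
  tensorHom := tensorHom'
  tensorUnit := unitObj k 𝒢
  associator := associator'
  leftUnitor := leftUnitor'
  rightUnitor := rightUnitor'

theorem associator'_hom_pt {X Y Z : RepD.{u, v, w} k 𝒢} (x : X.V) (y : Y.V) (z : Z.V) :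
    (associator' X Y Z).hom.lin (pt (pt x y) z) = pt x (pt y z) := assocLin_pt x y z

theorem associator'_inv_pt {X Y Z : RepD.{u, v, w} k 𝒢} (x : X.V) (y : Y.V) (z : Z.V) :
    (associator' X Y Z).inv.lin (pt x (pt y z)) = pt (pt x y) z := assocInvLin_pt x y z

theorem leftUnitor'_hom_pt {X : RepD.{u, v, w} k 𝒢}
    (z : (unitObj k 𝒢 : RepD.{u, v, w} k 𝒢).V) (a : X.V) :
    (leftUnitor' X).hom.lin (pt z a) = X.ρ (toDD z) a := leftLin_pt X z a

theorem rightUnitor'_hom_pt {X : RepD.{u, v, w} k 𝒢}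
    (z : (unitObj k 𝒢 : RepD.{u, v, w} k 𝒢).V) (a : X.V) :
    (rightUnitor' X).hom.lin (pt a z) = X.ρ (DD.antipode (toDD z)) a := rightLin_pt X z a

instance : MonoidalCategory (RepD.{u, v, w} k 𝒢) :=
  MonoidalCategory.ofTensorHom
    (id_tensorHom_id := fun X Y => tensor_hom_ext fun x y => tensorHom'_pt _ _ x y)
    (id_tensorHom := fun _ _ _ _ => rfl)
    (tensorHom_id := fun _ _ => rfl)
    (tensorHom_comp_tensorHom := fun f₁ f₂ g₁ g₂ => tensor_hom_ext fun x y => by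
      change (tensorHom' g₁ g₂).lin ((tensorHom' f₁ f₂).lin (pt x y)) =
        (tensorHom' (f₁ ≫ g₁) (f₂ ≫ g₂)).lin (pt x y)
      simp [tensorHom'_pt])
    (associator_naturality := fun f₁ f₂ f₃ => hom_ext <| lin_ext₃ fun x y z => by
      change (associator' _ _ _).hom.lin ((tensorHom' (tensorHom' f₁ f₂) f₃).lin _) =
        (tensorHom' f₁ (tensorHom' f₂ f₃)).lin ((associator' _ _ _).hom.lin _)
      simp only [tensorHom'_pt, associator'_hom_pt])
    (leftUnitor_naturality := fun {X Y} f => tensor_hom_ext fun z a => by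
      change (leftUnitor' _).hom.lin ((tensorHom' (𝟙 (unitObj k 𝒢)) f).lin (pt z a)) =
        f.lin ((leftUnitor' _).hom.lin (pt z a))
      rw [tensorHom'_pt, leftUnitor'_hom_pt, leftUnitor'_hom_pt, f.comm]
      rfl)
    (rightUnitor_naturality := fun {X Y} f => tensor_hom_ext fun a z => by
      change (rightUnitor' _).hom.lin ((tensorHom' f (𝟙 (unitObj k 𝒢))).lin (pt a z)) =
        f.lin ((rightUnitor' _).hom.lin (pt a z))
      rw [tensorHom'_pt, rightUnitor'_hom_pt, rightUnitor'_hom_pt, f.comm]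
      rfl)
    (pentagon := fun W X Y Z => hom_ext <| lin_ext₄ fun a x y z => by
      change (tensorHom' (𝟙 W) (associator' X Y Z).hom).lin
          ((associator' W (tensorObj' X Y) Z).hom.lin
            ((tensorHom' (associator' W X Y).hom (𝟙 Z)).lin _)) =
        (associator' W X (tensorObj' Y Z)).hom.lin
          ((associator' (tensorObj' W X) Y Z).hom.lin _)
      simp only [tensorHom'_pt, associator'_hom_pt, id_lin, LinearMap.id_apply])
    (triangle := fun X Y => hom_ext <| lin_ext₃ fun x z y => by
      change (tensorHom' (𝟙 X) (leftUnitor' Y).hom).lin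
          ((associator' X (unitObj k 𝒢) Y).hom.lin (pt (pt x z) y)) =
        (tensorHom' (rightUnitor' X).hom (𝟙 Y)).lin (pt (pt x z) y)
      simp only [tensorHom'_pt, associator'_hom_pt, id_lin, LinearMap.id_apply,
        leftUnitor'_hom_pt, rightUnitor'_hom_pt]
      obtain ⟨c, rfl⟩ := eq_sum_E z
      simp only [map_sum, map_smul, toDD_E, DD.antipode_e, LinearMap.sum_apply,
        LinearMap.smul_apply, pt_sum_left, pt_sum_right]
      refine Finset.sum_congr rfl fun i _ => ?_
      rw [← ptLin_apply, ← ptLin_apply, map_smul, map_smul, LinearMap.smul_apply, ptLin_apply,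
        ptLin_apply, pt_e_left, pt_e_right])

/-! #### The braiding -/

/-- The linear map underlying the braiding,
`a ⊗ b ↦ ρ₂(R^{(2)}) b ⊗ ρ₁(R^{(1)}) a` for `a ⊗ b` in the monoidal product. -/
def braidLin (X Y : RepD.{u, v, w} k 𝒢) : (tensorObj' X Y).V →ₗ[k] (tensorObj' Y X).V :=
  π Y X ∘ₗ (TensorProduct.comm k X.V Y.V).toLinearMap ∘ₗ act₂ X Y DD.R ∘ₗ ι X Y

/-- The linear map underlying the inverse of the braiding. -/
def braidInvLin (X Y : RepD.{u, v, w} k 𝒢) : (tensorObj' Y X).V →ₗ[k] (tensorObj' X Y).V :=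
  π X Y ∘ₗ (∑ x : 𝒢, ∑ g : x ⟶ x, TensorProduct.map (X.ρ (DD.γ g (𝟙 x))) (Y.ρ (DD.U (inv g)))) ∘ₗ
    (TensorProduct.comm k Y.V X.V).toLinearMap ∘ₗ ι Y X

theorem R_eq : (DD.R : DD k 𝒢 ⊗[k] DD k 𝒢) =
    ∑ x : 𝒢, ∑ g : x ⟶ x, DD.γ g (𝟙 x) ⊗ₜ[k] DD.U g := by
  simp [DD.R, DD.U, tmul_sum]

theorem γ_one_mul_e (X : RepD.{u, v, w} k 𝒢) {z : 𝒢} (g : z ⟶ z) (x : X.V) :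
    X.ρ (DD.γ g (𝟙 z)) (X.ρ (DD.e z) x) = X.ρ (DD.γ g (𝟙 z)) x := by
  rw [← ρ_mul_apply, DD.γ_mul_e]

theorem γ_one_mul_e_of_ne (X : RepD.{u, v, w} k 𝒢) {z z' : 𝒢} (g : z ⟶ z) (x : X.V)
    (h : z ≠ z') : X.ρ (DD.γ g (𝟙 z)) (X.ρ (DD.e z') x) = 0 := by
  rw [← ρ_mul_apply, DD.γ_mul_e_of_ne _ _ h, map_zero, LinearMap.zero_apply]

theorem U_e (X : RepD.{u, v, w} k 𝒢) {s t : 𝒢} (f : s ⟶ t) (x : X.V) :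
    X.ρ (DD.U f) (X.ρ (DD.e s) x) = X.ρ (DD.U f) x := by
  rw [← ρ_mul_apply, ← DD.U_id, DD.U_mul_U, Category.id_comp]

theorem braidLin_pt {X Y : RepD.{u, v, w} k 𝒢} (x : X.V) (y : Y.V) :
    braidLin X Y (pt x y) =
      ∑ z : 𝒢, ∑ g : z ⟶ z, pt (Y.ρ (DD.U g) y) (X.ρ (DD.γ g (𝟙 z)) x) := by
  simp only [braidLin, LinearMap.comp_apply, ι_pt, map_sum, R_eq, LinearMap.sum_apply,
    act₂_tmul, LinearEquiv.coe_coe, TensorProduct.comm_tmul]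
  refine Finset.sum_congr rfl fun z _ => ?_
  rw [Finset.sum_eq_single z]
  · refine Finset.sum_congr rfl fun g _ => ?_
    rw [γ_one_mul_e, U_e]
    rfl
  · intro z' _ hz
    refine Finset.sum_eq_zero fun g _ => ?_
    rw [γ_one_mul_e_of_ne _ _ _ hz, tmul_zero, map_zero]
  · simp

theorem braidInvLin_pt {X Y : RepD.{u, v, w} k 𝒢} (x : X.V) (y : Y.V) :
    braidInvLin X Y (pt y x) =
      ∑ z : 𝒢, ∑ g : z ⟶ z, pt (X.ρ (DD.γ g (𝟙 z)) x) (Y.ρ (DD.U (inv g)) y) := by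
  simp only [braidInvLin, LinearMap.comp_apply, ι_pt, map_sum, LinearMap.sum_apply,
    TensorProduct.map_tmul, LinearEquiv.coe_coe, TensorProduct.comm_tmul]
  refine Finset.sum_congr rfl fun z _ => ?_
  rw [Finset.sum_eq_single z]
  · refine Finset.sum_congr rfl fun g _ => ?_
    rw [γ_one_mul_e, U_e]
    rfl
  · intro z' _ hz
    refine Finset.sum_eq_zero fun g _ => ?_
    rw [γ_one_mul_e_of_ne _ _ _ hz, zero_tmul, map_zero]
  · simp

theorem braidLin_pt_γ {X Y : RepD.{u, v, w} k 𝒢} {s t : 𝒢} (l : t ⟶ t) (f : s ⟶ t) (x : X.V)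
    (y : Y.V) : braidLin X Y (pt (X.ρ (DD.γ l f) x) y) =
      pt (Y.ρ (DD.U l) y) (X.ρ (DD.γ l f) x) := by
  classical
  rw [braidLin_pt, Finset.sum_eq_single t, Finset.sum_eq_single l]
  · rw [← ρ_mul_apply X, DD.γ_mul_γ, if_pos (by simp), Category.comp_id]
  · intro m _ hm
    rw [← ρ_mul_apply X, DD.γ_mul_γ, if_neg (by simpa using hm), map_zero, ← ptLin_apply]
    simp
  · simp
  · intro z _ hz
    refine Finset.sum_eq_zero fun m _ => ?_
    rw [← ρ_mul_apply X, DD.γ_mul_γ_of_ne _ _ _ _ hz, map_zero, ← ptLin_apply]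
    simp
  · simp

theorem braidInvLin_pt_γ {X Y : RepD.{u, v, w} k 𝒢} {s t : 𝒢} (l : t ⟶ t) (f : s ⟶ t) (x : X.V)
    (y : Y.V) : braidInvLin X Y (pt y (X.ρ (DD.γ l f) x)) =
      pt (X.ρ (DD.γ l f) x) (Y.ρ (DD.U (inv l)) y) := by
  classical
  rw [braidInvLin_pt, Finset.sum_eq_single t, Finset.sum_eq_single l]
  · rw [← ρ_mul_apply X, DD.γ_mul_γ, if_pos (by simp), Category.comp_id]
  · intro m _ hm
    rw [← ρ_mul_apply X, DD.γ_mul_γ, if_neg (by simpa using hm), map_zero, ← ptLin_apply]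
    simp
  · simp
  · intro z _ hz
    refine Finset.sum_eq_zero fun m _ => ?_
    rw [← ρ_mul_apply X, DD.γ_mul_γ_of_ne _ _ _ _ hz, map_zero, ← ptLin_apply]
    simp
  · simp

/-- Every element is the sum of its homogeneous components. -/
theorem sum_ρ_γ (X : RepD.{u, v, w} k 𝒢) (x : X.V) :
    ∑ z : 𝒢, ∑ g : z ⟶ z, X.ρ (DD.γ g (𝟙 z)) x = x := by
  conv_rhs => rw [← sum_ρ_e X x]
  simp [DD.e, LinearMap.sum_apply]

/-- Linear maps agree if they agree on `pt x y` with `x` homogeneous. -/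
theorem lin_ext_hom_left {X Y : RepD.{u, v, w} k 𝒢} {M : Type*} [AddCommGroup M] [Module k M]
    {f g : (tensorObj' X Y).V →ₗ[k] M}
    (h : ∀ (z : 𝒢) (l : z ⟶ z) x y, f (pt (X.ρ (DD.γ l (𝟙 z)) x) y) =
      g (pt (X.ρ (DD.γ l (𝟙 z)) x) y)) : f = g := by
  refine lin_ext fun x y => ?_
  rw [← sum_ρ_γ X x]
  simp only [pt_sum_left, map_sum, h]

theorem lin_ext_hom_right {X Y : RepD.{u, v, w} k 𝒢} {M : Type*} [AddCommGroup M] [Module k M]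
    {f g : (tensorObj' X Y).V →ₗ[k] M}
    (h : ∀ (z : 𝒢) (l : z ⟶ z) x y, f (pt x (Y.ρ (DD.γ l (𝟙 z)) y)) =
      g (pt x (Y.ρ (DD.γ l (𝟙 z)) y))) : f = g := by
  refine lin_ext fun x y => ?_
  rw [← sum_ρ_γ Y y]
  simp only [pt_sum_right, map_sum, h]

theorem ι_braidLin {X Y : RepD.{u, v, w} k 𝒢} (t : (tensorObj' X Y).V) :
    ι Y X (braidLin X Y t) = TensorProduct.comm k X.V Y.V (act₂ X Y DD.R (ι X Y t)) := by
  classical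
  suffices ι Y X ∘ₗ braidLin X Y =
      (TensorProduct.comm k X.V Y.V).toLinearMap ∘ₗ act₂ X Y DD.R ∘ₗ ι X Y from
    LinearMap.congr_fun this t
  refine lin_ext_hom_left fun c l x y => ?_
  have h1 : pt (X.ρ (DD.γ l (𝟙 c)) x) y =
      (tensorObj' X Y).ρ (DD.e c) (pt (X.ρ (DD.γ l (𝟙 c)) x) y) := by
    rw [← pt_e_left, ← ρ_mul_apply, DD.e_mul_γ]
  have h2 : pt (Y.ρ (DD.U l) y) (X.ρ (DD.γ l (𝟙 c)) x) =
      (tensorObj' Y X).ρ (DD.e c) (pt (Y.ρ (DD.U l) y) (X.ρ (DD.γ l (𝟙 c)) x)) := by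
    rw [← pt_e_right, ← ρ_mul_apply, DD.e_mul_γ]
  rw [LinearMap.comp_apply, braidLin_pt_γ, h2, ι_pt_e]
  simp only [LinearMap.comp_apply, LinearEquiv.coe_coe]
  rw [h1, ι_pt_e, R_eq]
  simp only [map_sum, LinearMap.sum_apply, act₂_tmul, TensorProduct.comm_tmul]
  rw [Finset.sum_eq_single c, Finset.sum_eq_single l]
  · rw [U_e, γ_one_mul_e, ← ρ_mul_apply X, ← ρ_mul_apply X, ← ρ_mul_apply Y, DD.e_mul_γ,
      DD.γ_mul_γ, ← DD.U_id c, DD.U_mul_U]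
    simp
  · intro m _ hm
    rw [γ_one_mul_e, ← ρ_mul_apply X, DD.γ_mul_γ, if_neg (by simpa using hm), map_zero,
      LinearMap.zero_apply, tmul_zero]
  · simp
  · intro z _ hz
    refine Finset.sum_eq_zero fun m _ => ?_
    rw [γ_one_mul_e_of_ne _ _ _ hz, tmul_zero]
  · simp

/-- The braiding. -/
def braiding' (X Y : RepD.{u, v, w} k 𝒢) : tensorObj' X Y ≅ tensorObj' Y X :=
  mkIso
    { lin := braidLin X Y
      comm := fun h t => by
        suffices braidLin X Y ∘ₗ (tensorObj' X Y).ρ h = (tensorObj' Y X).ρ h ∘ₗ braidLin X Y from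
          LinearMap.congr_fun this t
        refine lin_ext fun x y => ?_
        simp only [LinearMap.comp_apply]
        induction h using DD.induction with
        | zero => simp
        | add a b ha hb => simp only [map_add, LinearMap.add_apply, ha, hb]
        | smul r a ha => simp only [map_smul, LinearMap.smul_apply, ha]
        | @basis s t g f =>
          classical
          rw [ρ_γ_pt, map_sum]
          simp only [braidLin_pt_γ]
          rw [braidLin_pt, map_sum, Finset.sum_eq_single s, map_sum]
          · simp only [ρ_γ_pt, ← ρ_mul_apply]
            rw [Finset.sum_comm]
            have key : ∀ l : t ⟶ t, ∑ m : s ⟶ s, pt (X := Y) (Y := X)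
                (Y.ρ (DD.γ l f * DD.U m) y)
                (X.ρ (DD.γ (g ≫ inv l) f * DD.γ m (𝟙 s)) x) =
                pt (Y.ρ (DD.γ l (f ≫ g ≫ inv l)) y) (X.ρ (DD.γ (g ≫ inv l) f) x) := by
              intro l
              rw [Finset.sum_eq_single (f ≫ (g ≫ inv l) ≫ inv f)]
              · rw [DD.γ_mul_γ, if_pos rfl, DD.γ_mul_U]
                simp
              · intro m _ hm
                rw [DD.γ_mul_γ, if_neg hm.symm, map_zero, ← ptLin_apply]
                simp
              · simp
            rw [Finset.sum_congr rfl fun l _ => key l]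
            refine Fintype.sum_equiv ⟨fun h => inv h ≫ g, fun h => g ≫ inv h, fun _ => by simp,
              fun _ => by simp⟩ _ _ ?_
            intro l
            rw [DD.U_mul_γ]
            simp
          · intro z _ hz
            rw [map_sum]
            refine Finset.sum_eq_zero fun m _ => ?_
            rw [ρ_γ_pt]
            refine Finset.sum_eq_zero fun l _ => ?_
            rw [← ρ_mul_apply X, DD.γ_mul_γ_of_ne _ _ _ _ (Ne.symm hz), map_zero, ← ptLin_apply]
            simp
          · simp }
    (braidInvLin X Y)
    (fun t => by
      suffices braidInvLin X Y ∘ₗ braidLin X Y = LinearMap.id from LinearMap.congr_fun this t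
      refine lin_ext_hom_left fun z l x y => ?_
      rw [LinearMap.comp_apply, braidLin_pt_γ, braidInvLin_pt_γ, ← ρ_mul_apply, DD.U_mul_U,
        IsIso.hom_inv_id, DD.U_id, pt_e_right, ← pt_e_left, ← ρ_mul_apply, DD.e_mul_γ]
      rfl)
    (fun t => by
      suffices braidLin X Y ∘ₗ braidInvLin X Y = LinearMap.id from LinearMap.congr_fun this t
      refine lin_ext_hom_right fun z l x y => ?_
      rw [LinearMap.comp_apply, braidInvLin_pt_γ, braidLin_pt_γ, ← ρ_mul_apply, DD.U_mul_U,
        IsIso.inv_hom_id, DD.U_id, pt_e_left, ← pt_e_right, ← ρ_mul_apply, DD.e_mul_γ]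
      rfl)

theorem braiding'_hom_lin (X Y : RepD.{u, v, w} k 𝒢) : (braiding' X Y).hom.lin = braidLin X Y :=
  rfl

theorem lin_ext₃_hom_left {X Y Z : RepD.{u, v, w} k 𝒢} {M : Type*} [AddCommGroup M] [Module k M]
    {f g : (tensorObj' (tensorObj' X Y) Z).V →ₗ[k] M}
    (h : ∀ (c : 𝒢) (l : c ⟶ c) x y z, f (pt (pt (X.ρ (DD.γ l (𝟙 c)) x) y) z) =
      g (pt (pt (X.ρ (DD.γ l (𝟙 c)) x) y) z)) : f = g := by
  refine lin_ext₃ fun x y z => ?_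
  rw [← sum_ρ_γ X x]
  simp only [pt_sum_left, map_sum, h]

theorem pt_γ_γ {X Y : RepD.{u, v, w} k 𝒢} {c : 𝒢} (g h : c ⟶ c) (x : X.V) (y : Y.V) :
    pt (X.ρ (DD.γ g (𝟙 c)) x) (Y.ρ (DD.γ h (𝟙 c)) y) =
      (tensorObj' X Y).ρ (DD.γ (h ≫ g) (𝟙 c))
        (pt (X.ρ (DD.γ g (𝟙 c)) x) (Y.ρ (DD.γ h (𝟙 c)) y)) := by
  classical
  rw [ρ_γ_pt, Finset.sum_eq_single g]
  · simp only [← ρ_mul_apply, DD.γ_mul_γ]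
    simp
  · intro l _ hl
    rw [← ρ_mul_apply X, DD.γ_mul_γ, if_neg (by simpa using hl), map_zero, ← ptLin_apply]
    simp
  · simp

theorem pt_γ_γ_of_ne {X Y : RepD.{u, v, w} k 𝒢} {c d : 𝒢} (g : c ⟶ c) (h : d ⟶ d) (x : X.V)
    (y : Y.V) (hcd : c ≠ d) :
    pt (X.ρ (DD.γ g (𝟙 c)) x) (Y.ρ (DD.γ h (𝟙 d)) y) = 0 := by
  rw [← DD.e_mul_γ g, ρ_mul_apply, pt_e_left, ← pt_e_right, ← ρ_mul_apply,
    DD.e_mul_γ_of_ne _ _ hcd, map_zero, ← ptLin_apply]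
  simp

theorem lin_ext₃'_hom {X Y Z : RepD.{u, v, w} k 𝒢} {M : Type*} [AddCommGroup M] [Module k M]
    {f g : (tensorObj' X (tensorObj' Y Z)).V →ₗ[k] M}
    (h : ∀ (c : 𝒢) (l m : c ⟶ c) x y z,
      f (pt (X.ρ (DD.γ l (𝟙 c)) x) (pt (Y.ρ (DD.γ m (𝟙 c)) y) z)) =
      g (pt (X.ρ (DD.γ l (𝟙 c)) x) (pt (Y.ρ (DD.γ m (𝟙 c)) y) z))) : f = g := by
  refine lin_ext₃' fun x y z => ?_
  rw [← sum_ρ_γ X x, ← sum_ρ_γ Y y]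
  simp only [pt_sum_left, pt_sum_right, map_sum]
  refine Finset.sum_congr rfl fun c _ => Finset.sum_congr rfl fun m _ =>
    Finset.sum_congr rfl fun d _ => Finset.sum_congr rfl fun l _ => ?_
  by_cases hcd : c = d
  · subst hcd
    exact h _ _ _ _ _ _
  · have h0 : pt (X := X) (Y := tensorObj' Y Z) (X.ρ (DD.γ l (𝟙 d)) x)
        (pt (Y.ρ (DD.γ m (𝟙 c)) y) z) = 0 := by
      rw [← DD.e_mul_γ m, ρ_mul_apply, pt_e_left, pt_e_right, ← pt_e_left, ← ρ_mul_apply,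
        DD.e_mul_γ_of_ne _ _ hcd, map_zero, ← ptLin_apply]
      simp
    rw [h0, map_zero, map_zero]

instance : BraidedCategory (RepD.{u, v, w} k 𝒢) where
  braiding := braiding'
  braiding_naturality_right X Y Z f := hom_ext <| lin_ext_hom_left fun c l x y => by
    change braidLin X Z ((tensorHom' (𝟙 X) f).lin (pt _ _)) =
      (tensorHom' f (𝟙 X)).lin (braidLin X Y (pt _ _))
    simp only [tensorHom'_pt, braidLin_pt_γ, id_lin, LinearMap.id_apply, f.comm]
  braiding_naturality_left {X Y} f Z := hom_ext <| lin_ext_hom_left fun c l x y => by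
    change braidLin Y Z ((tensorHom' f (𝟙 Z)).lin (pt _ _)) =
      (tensorHom' (𝟙 Z) f).lin (braidLin X Z (pt _ _))
    simp only [tensorHom'_pt, braidLin_pt_γ, id_lin, LinearMap.id_apply, f.comm]
  hexagon_forward X Y Z := hom_ext <| lin_ext₃_hom_left fun c l x y z => by
    change (associator' Y Z X).hom.lin (braidLin X (tensorObj' Y Z)
        ((associator' X Y Z).hom.lin (pt (pt _ _) _))) =
      (tensorHom' (𝟙 Y) (braiding' X Z).hom).lin ((associator' Y X Z).hom.lin
        ((tensorHom' (braiding' X Y).hom (𝟙 Z)).lin (pt (pt _ _) _)))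
    simp only [tensorHom'_pt, associator'_hom_pt, braiding'_hom_lin, braidLin_pt_γ, id_lin,
      LinearMap.id_apply, ρ_U_pt]
  hexagon_reverse X Y Z := hom_ext <| lin_ext₃'_hom fun c l m x y z => by
    change (associator' Z X Y).inv.lin (braidLin (tensorObj' X Y) Z
        ((associator' X Y Z).inv.lin (pt _ (pt _ _)))) =
      (tensorHom' (braiding' X Z).hom (𝟙 Y)).lin ((associator' X Z Y).inv.lin
        ((tensorHom' (𝟙 X) (braiding' Y Z).hom).lin (pt _ (pt _ _))))
    simp only [tensorHom'_pt, associator'_inv_pt, braiding'_hom_lin, braidLin_pt_γ, id_lin,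
      LinearMap.id_apply]
    rw [pt_γ_γ, braidLin_pt_γ, ← pt_γ_γ, associator'_inv_pt, ← ρ_mul_apply, DD.U_mul_U]

end RepD
end Rep

/-! ### Frobenius objects in a braided monoidal category -/

/-- The structure of a Frobenius object on an object `A` of a braided monoidal category:
`(A, m, μ)` is a commutative algebra object, `(A, Δ, ε)` is a co-commutative coalgebra object, and
the two Frobenius relations hold. -/
structure FrobeniusStructure {𝒞 : Type*} [Category 𝒞] [MonoidalCategory 𝒞] [BraidedCategory 𝒞]
    (A : 𝒞) where
  /-- the product -/
  m : A ⊗ A ⟶ A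
  /-- the coproduct -/
  Δ : A ⟶ A ⊗ A
  /-- the unit -/
  μ : 𝟙_ 𝒞 ⟶ A
  /-- the counit -/
  ε : A ⟶ 𝟙_ 𝒞
  assoc : (α_ A A A).hom ≫ A ◁ m ≫ m = m ▷ A ≫ m
  unit_left : μ ▷ A ≫ m = (λ_ A).hom
  unit_right : A ◁ μ ≫ m = (ρ_ A).hom
  comm : (β_ A A).hom ≫ m = m
  coassoc : Δ ≫ A ◁ Δ = Δ ≫ Δ ▷ A ≫ (α_ A A A).hom
  counit_left : Δ ≫ ε ▷ A ≫ (λ_ A).hom = 𝟙 A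
  counit_right : Δ ≫ A ◁ ε ≫ (ρ_ A).hom = 𝟙 A
  cocomm : Δ ≫ (β_ A A).hom = Δ
  frobenius_left : m ≫ Δ = A ◁ Δ ≫ (α_ A A A).inv ≫ m ▷ A
  frobenius_right : m ≫ Δ = Δ ▷ A ≫ (α_ A A A).hom ≫ A ◁ m

/-! ### Groupoid Frobenius algebras -/

/-- The data `⟨𝒢, (A, ·, 1_A), η, φ⟩` of a `𝒢`-Frobenius algebra on a vector space `A`, including
the subspaces `A^x` and `A^x_g`. -/
structure GFAData (k : Type w) [Field k] (𝒢 : Type u) [Groupoid.{v} 𝒢] (A : Type*)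
    [AddCommGroup A] [Module k A] where
  /-- the product of `A` -/
  mul : A →ₗ[k] A →ₗ[k] A
  /-- the unit `1_A` -/
  one : A
  /-- the summand `A^x` -/
  comp : 𝒢 → Submodule k A
  /-- the summand `A^x_g` of `A^x`, for a loop `g` at `x` -/
  gr : ∀ {x : 𝒢}, (x ⟶ x) → Submodule k A
  /-- the bilinear form -/
  η : A →ₗ[k] A →ₗ[k] k
  /-- the action `φ(f) : A^x → A^y` of a morphism `f` with source `x` and target `y` -/
  φ : ∀ {x y : 𝒢}, (x ⟶ y) → (comp x →ₗ[k] comp y)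

/-- The axioms of a `𝒢`-Frobenius algebra. -/
structure GFAData.IsGFA {k : Type w} [Field k] {𝒢 : Type u} [Groupoid.{v} 𝒢] {A : Type*}
    [AddCommGroup A] [Module k A] (D : GFAData k 𝒢 A) : Prop where
  /- `A` is a finite dimensional unital associative algebra. -/
  finite : FiniteDimensional k A
  mul_assoc : ∀ a b c, D.mul (D.mul a b) c = D.mul a (D.mul b c)
  one_mul : ∀ a, D.mul D.one a = a
  mul_one : ∀ a, D.mul a D.one = a
  /- `A` is the direct sum of the `A^x`. -/
  comp_indep : iSupIndep D.comp
  comp_iSup : ⨆ x, D.comp x = ⊤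
  /- `φ` is an action of `𝒢` by algebra isomorphisms. -/
  φ_bijective : ∀ {x y : 𝒢} (f : x ⟶ y), Function.Bijective (D.φ f)
  φ_mul : ∀ {x y : 𝒢} (f : x ⟶ y) (a b c : D.comp x),
    (c : A) = D.mul a b → (D.φ f c : A) = D.mul (D.φ f a) (D.φ f b)
  φ_comp : ∀ {x y z : 𝒢} (g : x ⟶ y) (h : y ⟶ z) (a : D.comp x),
    D.φ (g ≫ h) a = D.φ h (D.φ g a)
  φ_id : ∀ (x : 𝒢) (a : D.comp x), D.φ (𝟙 x) a = a
  /- `A^x` is the direct sum of the `A^x_g`, and is a `Γ^x`-graded algebra (with unit). -/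
  gr_indep : ∀ x : 𝒢, iSupIndep fun g : x ⟶ x => D.gr g
  gr_iSup : ∀ x : 𝒢, ⨆ g : x ⟶ x, D.gr g = D.comp x
  gr_mul : ∀ {x : 𝒢} (g h : x ⟶ x) (a b : A), a ∈ D.gr g → b ∈ D.gr h →
    D.mul a b ∈ D.gr (h ≫ g)
  gr_one : ∀ x : 𝒢, ∃ u ∈ D.gr (𝟙 x), ∀ a ∈ D.comp x, D.mul u a = a ∧ D.mul a u = a
  /- The product of `A^x` and `A^y` is in `A^x` for `x = y`, and zero otherwise. -/
  comp_mul : ∀ (x : 𝒢) (a b : A), a ∈ D.comp x → b ∈ D.comp x → D.mul a b ∈ D.comp x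
  comp_mul_of_ne : ∀ (x y : 𝒢) (a b : A), x ≠ y → a ∈ D.comp x → b ∈ D.comp y → D.mul a b = 0
  /- Invariance of `η`. -/
  η_mul : ∀ a b c, D.η (D.mul a b) c = D.η a (D.mul b c)
  η_φ : ∀ {x y : 𝒢} (f : x ⟶ y) (a b : D.comp x),
    D.η (D.φ f a) (D.φ f b) = D.η a b
  /- `φ(f) A^x_g ⊆ A^y_{fgf⁻¹}`. -/
  φ_gr : ∀ {x y : 𝒢} (f : x ⟶ y) (g : x ⟶ x) (a : D.comp x), (a : A) ∈ D.gr g →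
    (D.φ f a : A) ∈ D.gr (inv f ≫ g ≫ f)
  /- `η` is a nondegenerate pairing of `A^x_g` and `A^x_h` if `gh = e_x`, and zero on them
  otherwise. -/
  η_nondeg_left : ∀ {x : 𝒢} (g h : x ⟶ x), h ≫ g = 𝟙 x → ∀ a ∈ D.gr g,
    (∀ b ∈ D.gr h, D.η a b = 0) → a = 0
  η_nondeg_right : ∀ {x : 𝒢} (g h : x ⟶ x), h ≫ g = 𝟙 x → ∀ b ∈ D.gr h,
    (∀ a ∈ D.gr g, D.η a b = 0) → b = 0
  η_gr : ∀ {x : 𝒢} (g h : x ⟶ x), h ≫ g ≠ 𝟙 x → ∀ a ∈ D.gr g, ∀ b ∈ D.gr h, D.η a b = 0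
  /- Twisted commutativity. -/
  twisted_comm : ∀ {x : 𝒢} (g h : x ⟶ x) (a b : D.comp x), (a : A) ∈ D.gr g → (b : A) ∈ D.gr h →
    D.mul a b = D.mul (D.φ g b) a
  /- `φ(g)` is the identity on `A^x_g`. -/
  φ_self : ∀ {x : 𝒢} (g : x ⟶ x) (a : D.comp x), (a : A) ∈ D.gr g → D.φ g a = a
  /- The trace axiom: for `c` in `A^x_{ghg⁻¹h⁻¹}`, the maps `l_c ∘ φ(h)` and `φ(g⁻¹) ∘ l_c`
  restrict to endomorphisms `T₁` of `A^x_g` and `T₂` of `A^x_h`, which have the same trace. -/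
  trace_eq : ∀ {x : 𝒢} (g h : x ⟶ x) (c : A), c ∈ D.gr (inv h ≫ inv g ≫ h ≫ g) →
    ∃ (T₁ : D.gr g →ₗ[k] D.gr g) (T₂ : D.gr h →ₗ[k] D.gr h),
      (∀ a : D.gr g, ∃ ha : (a : A) ∈ D.comp x, (T₁ a : A) = D.mul c (D.φ h ⟨a, ha⟩)) ∧
      (∀ b : D.gr h, ∃ hb : D.mul c b ∈ D.comp x, (T₂ b : A) = D.φ (inv g) ⟨D.mul c b, hb⟩) ∧
      LinearMap.trace k (D.gr g) T₁ = LinearMap.trace k (D.gr h) T₂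

/-! ### The `𝒢`-Frobenius algebra of a Frobenius object in `Rep(D(k[𝒢]))` -/

section Induced

variable {k : Type w} [Field k] {𝒢 : Type u} [Groupoid.{v} 𝒢] [Fintype 𝒢]
  [∀ x y : 𝒢, Fintype (x ⟶ y)] {X : RepD.{u, v, w} k 𝒢}

/-- The first condition: `∑_x ∑_{g ∈ Γ^x} ρ(γ_g^g) = id_A`. -/
def IdentityCondition (X : RepD.{u, v, w} k 𝒢) : Prop :=
  ∑ x : 𝒢, ∑ g : x ⟶ x, X.ρ (DD.γ g g) = LinearMap.id

/-- The product `ab = ∑_x m(a^x ⊗ b^x)`, where `a^x = ρ(1^x) a`. Note that `RepD.pt a b` is the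
element `∑_x a^x ⊗ b^x` of the monoidal product of `A` with itself. -/
def FrobeniusStructure.prod (F : FrobeniusStructure X) : X.V →ₗ[k] X.V →ₗ[k] X.V :=
  (RepD.ptLin X X).compr₂ F.m.lin

theorem FrobeniusStructure.prod_apply (F : FrobeniusStructure X) (a b : X.V) :
    F.prod a b = F.m.lin (RepD.pt a b) := rfl

/-- The trace condition: for loops `g`, `h` at `x` and `c ∈ ρ(γ_{ghg⁻¹h⁻¹}^{e_x}) A`,
`Tr(l_c ∘ ρ(γ_{hgh⁻¹}^h)) = Tr(ρ(γ_h^{g⁻¹}) ∘ l_c ∘ ρ(γ_h^{e_x}))`. On `ρ(1^x) A` the map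
`l_c = F.prod c` is `v ↦ m(c ⊗ v)`, and in both composites it is applied to such vectors only. -/
def TraceCondition (F : FrobeniusStructure X) : Prop :=
  ∀ (x : 𝒢) (g h : x ⟶ x),
    ∀ c ∈ LinearMap.range (X.ρ (DD.γ (inv h ≫ inv g ≫ h ≫ g) (𝟙 x))),
      LinearMap.trace k X.V (F.prod c ∘ₗ X.ρ (DD.γ (inv h ≫ g ≫ h) h)) =
        LinearMap.trace k X.V (X.ρ (DD.γ h (inv g)) ∘ₗ F.prod c ∘ₗ X.ρ (DD.γ h (𝟙 x)))

/-- The linear form `ε'` with `ε(a) = ∑_x ε'(a^x) 1^x`, see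
`FrobeniusStructure.counit_eq_sum`. -/
def FrobeniusStructure.ε' (F : FrobeniusStructure X) : X.V →ₗ[k] k :=
  DD.counit ∘ₗ RepD.toDD ∘ₗ F.ε.lin

theorem FrobeniusStructure.counit_eq_sum (F : FrobeniusStructure X) (a : X.V) :
    F.ε.lin a = ∑ x : 𝒢, F.ε' (X.ρ (DD.e x) a) • RepD.E k x := by
  classical
  have key : ∀ z : (RepD.unitObj k 𝒢 : RepD.{u, v, w} k 𝒢).V, z =
      ∑ x : 𝒢, DD.counit (RepD.toDD ((RepD.unitObj k 𝒢).ρ (DD.e x) z)) • RepD.E k x := by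
    intro z
    obtain ⟨c, rfl⟩ := RepD.eq_sum_E z
    refine Finset.sum_congr rfl fun x _ => ?_
    rw [map_sum, Finset.sum_eq_single x]
    · rw [map_smul, RepD.ρ_e_E, map_smul, map_smul, RepD.toDD_E]
      have : DD.counit (DD.e (k := k) x) = 1 := by simp [DD.e]
      rw [this, smul_eq_mul, _root_.mul_one]
    · intro y _ hy
      rw [map_smul, DD.e, map_sum, LinearMap.sum_apply, Finset.sum_eq_zero, smul_zero]
      intro g _
      exact RepD.ρ_γ_E_of_ne _ _ (Ne.symm hy)
    · simp
  refine (key (F.ε.lin a)).trans (Finset.sum_congr rfl fun x _ => ?_)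
  have h := F.ε.comm (DD.e x) a
  change _ = DD.counit (RepD.toDD (F.ε.lin (X.ρ (DD.e x) a))) • RepD.E k x
  rw [h]
  rfl

/-- The data of a `𝒢`-Frobenius algebra induced by a Frobenius object `(X, m, Δ, μ, ε)`:
* the product is `ab = ∑_x m(a^x ⊗ b^x)` with unit `μ(1)`;
* `A^x = ρ(1^x) A` and `A^x_g = ρ(γ_g^{e_x}) A`;
* `η(a, b) = ε'(ab)`;
* `φ(f)` is the restriction of `∑_{g ∈ Γ^{t(f)}} ρ(γ_g^f)` to `A^{s(f)}`. -/
def inducedGFA (F : FrobeniusStructure X) : GFAData k 𝒢 X.V where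
  mul := F.prod
  one := F.μ.lin (RepD.one' k 𝒢)
  comp x := LinearMap.range (X.ρ (DD.e x))
  gr {x} g := LinearMap.range (X.ρ (DD.γ g (𝟙 x)))
  η := F.prod.compr₂ F.ε'
  φ {x y} f := (∑ g : y ⟶ y, X.ρ (DD.γ g f)).restrict fun a _ => by
    refine ⟨(∑ g : y ⟶ y, X.ρ (DD.γ g f)) a, ?_⟩
    rw [LinearMap.sum_apply, map_sum]
    refine Finset.sum_congr rfl fun g _ => ?_
    rw [← RepD.ρ_mul_apply, DD.e_mul_γ]

end Induced

end GroupoidFA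

end

/-!
A module over the double `D(k[𝒢])` is a vector space graded by the loops of `𝒢` together with an
action of `𝒢` that conjugates the degrees: `γ_g^{e_x}` projects onto the component of degree `g`,
and `U f = ∑ γ_g^f` acts as `φ(f)`. Under this dictionary, commutativity with respect to the
braiding is twisted commutativity of the product, and the identity condition says that a loop `g`
fixes the component of degree `g` (`RepD.identityCondition_iff`). The two operators in the trace
condition take values in a single homogeneous component, so their traces are those of the trace
axiom (`FrobeniusStructure.traceCondition_iff`).

From a Frobenius object to a groupoid Frobenius algebra, the only axiom that involves the
coalgebra is the nondegeneracy of `η`: the Frobenius relations and the counit laws give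
`a = (id ⊗ ε)(Δ(1)(1 ⊗ a)) = (ε ⊗ id)((a ⊗ 1)Δ(1))`, so `a` vanishes if `η(·, a)` or `η(a, ·)`
does. All other axioms are the module calculus in the double.

Conversely, the action of the double on a groupoid Frobenius algebra is
`γ_g^f ↦ (projection to degree g) ∘ φ(f)`, and the missing structure is the coproduct. The form `η`
is nondegenerate on the whole space, and symmetric because twisted commutativity is commutativity
on `A_g × A_{g⁻¹}`. For dual bases `b`, `b'` the coproduct is `a ↦ ∑ a bᵢ ⊗ b'ᵢ`. An operator on
the second leg of `∑ bᵢ ⊗ b'ᵢ` equals its `η`-adjoint on the first leg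
(`IsDualPair.sum_adjoint`). As left and right multiplication by the same element are adjoint, and
the adjoint of an element of the double is its antipode, this single principle yields
coassociativity, the Frobenius relations, linearity over the double and cocommutativity
(`IsFrobeniusModuleAlgebra.frobeniusStructure`).
-/

noncomputable section

namespace GroupoidFA

section FrobeniusObjects

variable {k : Type w} [Field k] {𝒢 : Type u} [Groupoid.{v} 𝒢] [Fintype 𝒢]
  [∀ x y : 𝒢, Fintype (x ⟶ y)]

/-! ### Homogeneous components of a module over the double -/

/-- The ranges of pairwise orthogonal idempotents are independent. -/
theorem iSupIndep_range_of_orthogonal {V J : Type*} [AddCommGroup V] [Module k V]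
    (p : J → V →ₗ[k] V) (idem : ∀ i a, p i (p i a) = p i a)
    (orth : ∀ i j a, i ≠ j → p i (p j a) = 0) :
    iSupIndep fun i => LinearMap.range (p i) := by
  intro i
  rw [Submodule.disjoint_def]
  rintro _ ⟨a, rfl⟩ ha
  have : ⨆ j, ⨆ (_ : j ≠ i), LinearMap.range (p j) ≤ LinearMap.ker (p i) := by
    refine iSup₂_le fun j hj => ?_
    rintro _ ⟨b, rfl⟩
    exact orth i j b (Ne.symm hj)
  have h0 : p i (p i a) = 0 := this ha
  rwa [idem] at h0

namespace RepD

variable (X : RepD.{u, v, w} k 𝒢)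

theorem ρ_e_eq_sum (x : 𝒢) (a : X.V) : X.ρ (DD.e x) a = ∑ g : x ⟶ x, X.ρ (DD.γ g (𝟙 x)) a := by
  simp [DD.e, LinearMap.sum_apply]

open Classical in
theorem ρ_γ_ρ_γ {s t r : 𝒢} (g : t ⟶ t) (f : s ⟶ t) (h : s ⟶ s) (f' : r ⟶ s) (a : X.V) :
    X.ρ (DD.γ g f) (X.ρ (DD.γ h f') a) =
      if f ≫ g ≫ inv f = h then X.ρ (DD.γ g (f' ≫ f)) a else 0 := by
  rw [← ρ_mul_apply, DD.γ_mul_γ]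
  split_ifs <;> simp

theorem ρ_γ_ρ_γ_of_ne {s t s' t' : 𝒢} (g : t ⟶ t) (f : s ⟶ t) (h : t' ⟶ t') (f' : s' ⟶ t')
    (a : X.V) (hs : s ≠ t') : X.ρ (DD.γ g f) (X.ρ (DD.γ h f') a) = 0 := by
  rw [← ρ_mul_apply, DD.γ_mul_γ_of_ne _ _ _ _ hs, map_zero, LinearMap.zero_apply]

theorem ρ_γ_idem {s t : 𝒢} (g : t ⟶ t) (f : s ⟶ t) (a : X.V) :
    X.ρ (DD.γ g (𝟙 t)) (X.ρ (DD.γ g f) a) = X.ρ (DD.γ g f) a := by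
  simp [ρ_γ_ρ_γ]

theorem ρ_γ_orthogonal {s t : 𝒢} {g h : t ⟶ t} (f : s ⟶ t) (a : X.V) (hgh : g ≠ h) :
    X.ρ (DD.γ g (𝟙 t)) (X.ρ (DD.γ h f) a) = 0 := by
  simp [ρ_γ_ρ_γ, hgh]

theorem ρ_e_γ {s t : 𝒢} (g : t ⟶ t) (f : s ⟶ t) (a : X.V) :
    X.ρ (DD.e t) (X.ρ (DD.γ g f) a) = X.ρ (DD.γ g f) a := by
  rw [← ρ_mul_apply, DD.e_mul_γ]

theorem ρ_γ_e {s t : 𝒢} (g : t ⟶ t) (f : s ⟶ t) (a : X.V) :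
    X.ρ (DD.γ g f) (X.ρ (DD.e s) a) = X.ρ (DD.γ g f) a := by
  rw [← ρ_mul_apply, DD.γ_mul_e]

theorem ρ_U_γ {s t r : 𝒢} (f : s ⟶ t) (h : s ⟶ s) (f' : r ⟶ s) (a : X.V) :
    X.ρ (DD.U f) (X.ρ (DD.γ h f') a) = X.ρ (DD.γ (inv f ≫ h ≫ f) (f' ≫ f)) a := by
  rw [← ρ_mul_apply, DD.U_mul_γ]

theorem ρ_γ_U {s t r : 𝒢} (g : t ⟶ t) (f : s ⟶ t) (f' : r ⟶ s) (a : X.V) :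
    X.ρ (DD.γ g f) (X.ρ (DD.U f') a) = X.ρ (DD.γ g (f' ≫ f)) a := by
  rw [← ρ_mul_apply, DD.γ_mul_U]

theorem ρ_U_U {s t r : 𝒢} (f : s ⟶ t) (f' : r ⟶ s) (a : X.V) :
    X.ρ (DD.U f) (X.ρ (DD.U f') a) = X.ρ (DD.U (f' ≫ f)) a := by
  rw [← ρ_mul_apply, DD.U_mul_U]

theorem mem_range_e {X : RepD.{u, v, w} k 𝒢} {x : 𝒢} {a : X.V} :
    a ∈ LinearMap.range (X.ρ (DD.e x)) ↔ X.ρ (DD.e x) a = a :=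
  ⟨by rintro ⟨b, rfl⟩; exact ρ_e_e X x b, fun h => ⟨a, h⟩⟩

theorem mem_range_γ {X : RepD.{u, v, w} k 𝒢} {x : 𝒢} {g : x ⟶ x} {a : X.V} :
    a ∈ LinearMap.range (X.ρ (DD.γ g (𝟙 x))) ↔ X.ρ (DD.γ g (𝟙 x)) a = a :=
  ⟨by rintro ⟨b, rfl⟩; exact ρ_γ_idem X g (𝟙 x) b, fun h => ⟨a, h⟩⟩

theorem ρ_γ_mem {s t : 𝒢} (g : t ⟶ t) (f : s ⟶ t) (a : X.V) :
    X.ρ (DD.γ g f) a ∈ LinearMap.range (X.ρ (DD.γ g (𝟙 t))) :=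
  mem_range_γ.2 (ρ_γ_idem X g f a)

theorem range_γ_le_range_e {x : 𝒢} (g : x ⟶ x) :
    LinearMap.range (X.ρ (DD.γ g (𝟙 x))) ≤ LinearMap.range (X.ρ (DD.e x)) := by
  rintro _ ⟨a, rfl⟩
  exact mem_range_e.2 (ρ_e_γ X g (𝟙 x) a)

/-- The identity condition says that each loop `g` acts trivially on the component of degree
`g`. -/
theorem identityCondition_iff : IdentityCondition X ↔
    ∀ (x : 𝒢) (g : x ⟶ x) (a : X.V), X.ρ (DD.γ g g) a = X.ρ (DD.γ g (𝟙 x)) a := by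
  classical
  constructor
  · intro h x g a
    have h1 := LinearMap.congr_fun h (X.ρ (DD.γ g (𝟙 x)) a)
    simp only [LinearMap.sum_apply] at h1
    rw [Finset.sum_eq_single x, Finset.sum_eq_single g] at h1
    · simpa [ρ_γ_ρ_γ] using h1
    · intro l _ hl
      simp [ρ_γ_ρ_γ, hl]
    · simp
    · intro z _ hz
      exact Finset.sum_eq_zero fun l _ => ρ_γ_ρ_γ_of_ne _ _ _ _ _ _ hz
    · simp
  · intro h
    refine LinearMap.ext fun a => ?_
    simp only [LinearMap.sum_apply, h]
    exact sum_ρ_γ X a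

end RepD

/-! ### Frobenius objects in terms of elements -/

namespace FrobeniusStructure

open RepD

variable {X : RepD.{u, v, w} k 𝒢} (F : FrobeniusStructure X)

theorem prod_assoc (a b c : X.V) : F.prod (F.prod a b) c = F.prod a (F.prod b c) := by
  have h := LinearMap.congr_fun (congrArg Hom.lin F.assoc) (pt (pt a b) c)
  change F.m.lin ((tensorHom' (𝟙 X) F.m).lin ((associator' X X X).hom.lin _)) =
    F.m.lin ((tensorHom' F.m (𝟙 X)).lin _) at h
  rw [associator'_hom_pt, tensorHom'_pt, tensorHom'_pt] at h
  exact h.symm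

theorem ρ_γ_prod {s t : 𝒢} (g : t ⟶ t) (f : s ⟶ t) (a b : X.V) :
    X.ρ (DD.γ g f) (F.prod a b) =
      ∑ l : t ⟶ t, F.prod (X.ρ (DD.γ l f) a) (X.ρ (DD.γ (g ≫ inv l) f) b) := by
  have h := F.m.comm (DD.γ g f) (pt a b)
  change F.m.lin ((tensorObj' X X).ρ _ _) = _ at h
  rw [ρ_γ_pt, map_sum] at h
  exact h.symm

theorem ρ_U_prod {s t : 𝒢} (f : s ⟶ t) (a b : X.V) :
    X.ρ (DD.U f) (F.prod a b) = F.prod (X.ρ (DD.U f) a) (X.ρ (DD.U f) b) := by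
  have h := F.m.comm (DD.U f) (pt a b)
  change F.m.lin ((tensorObj' X X).ρ _ _) = _ at h
  rw [ρ_U_pt] at h
  exact h.symm

theorem ρ_e_prod (z : 𝒢) (a b : X.V) :
    X.ρ (DD.e z) (F.prod a b) = F.prod (X.ρ (DD.e z) a) b := by
  have h := F.m.comm (DD.e z) (pt a b)
  change F.m.lin ((tensorObj' X X).ρ _ _) = _ at h
  rw [← pt_e_left] at h
  exact h.symm

theorem prod_e_right (z : 𝒢) (a b : X.V) :
    F.prod a (X.ρ (DD.e z) b) = F.prod (X.ρ (DD.e z) a) b := by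
  rw [prod_apply, prod_apply, pt_e_right, pt_e_left]

theorem μ_prod (x : 𝒢) (a : X.V) : F.prod (F.μ.lin (E k x)) a = X.ρ (DD.e x) a := by
  have h := LinearMap.congr_fun (congrArg Hom.lin F.unit_left) (pt (X := unitObj k 𝒢) (E k x) a)
  change F.m.lin ((tensorHom' F.μ (𝟙 X)).lin _) = (leftUnitor' X).hom.lin _ at h
  rw [tensorHom'_pt, leftUnitor'_hom_pt] at h
  exact h

theorem prod_μ (x : 𝒢) (a : X.V) : F.prod a (F.μ.lin (E k x)) = X.ρ (DD.e x) a := by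
  have h := LinearMap.congr_fun (congrArg Hom.lin F.unit_right) (pt (Y := unitObj k 𝒢) a (E k x))
  change F.m.lin ((tensorHom' (𝟙 X) F.μ).lin _) = (rightUnitor' X).hom.lin _ at h
  rw [tensorHom'_pt, rightUnitor'_hom_pt, toDD_E, DD.antipode_e] at h
  exact h

theorem one_prod (a : X.V) : F.prod (F.μ.lin (one' k 𝒢)) a = a := by
  rw [one'_eq_sum, map_sum, map_sum, LinearMap.sum_apply]
  simp only [μ_prod]
  exact sum_ρ_e X a

theorem prod_one (a : X.V) : F.prod a (F.μ.lin (one' k 𝒢)) = a := by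
  rw [one'_eq_sum, map_sum, map_sum]
  simp only [prod_μ]
  exact sum_ρ_e X a

/-- Commutativity with respect to the braiding is twisted commutativity. -/
theorem prod_comm {x : 𝒢} (g : x ⟶ x) (a b : X.V) :
    F.prod (X.ρ (DD.γ g (𝟙 x)) a) b = F.prod (X.ρ (DD.U g) b) (X.ρ (DD.γ g (𝟙 x)) a) := by
  have h := LinearMap.congr_fun (congrArg Hom.lin F.comm) (pt (X.ρ (DD.γ g (𝟙 x)) a) b)
  change F.m.lin (braidLin X X _) = _ at h
  rw [braidLin_pt_γ] at h
  exact h.symm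

open Classical in
theorem ε'_ρ_γ {s t : 𝒢} (g : t ⟶ t) (f : s ⟶ t) (a : X.V) :
    F.ε' (X.ρ (DD.γ g f) a) = if g = 𝟙 t then F.ε' (X.ρ (DD.e s) a) else 0 := by
  have key : ∀ z : (unitObj k 𝒢 : RepD.{u, v, w} k 𝒢).V,
      DD.counit (toDD ((unitObj k 𝒢).ρ (DD.γ g f) z)) =
        if g = 𝟙 t then DD.counit (toDD ((unitObj k 𝒢).ρ (DD.e s) z)) else 0 := by
    intro z
    suffices DD.counit ∘ₗ toDD ∘ₗ (unitObj k 𝒢).ρ (DD.γ g f) =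
        (if g = 𝟙 t then (1 : k) else 0) • (DD.counit ∘ₗ toDD ∘ₗ (unitObj k 𝒢).ρ (DD.e s)) by
      have h := LinearMap.congr_fun this z
      split_ifs at h ⊢ <;> simpa using h
    have one_E : ∀ x : 𝒢, DD.counit (DD.e (k := k) x) = 1 := fun x => by simp [DD.e]
    refine unit_lin_ext fun x => ?_
    simp only [LinearMap.comp_apply, LinearMap.smul_apply]
    by_cases hx : s = x
    · subst hx
      rw [ρ_γ_E, ρ_e_E]
      split_ifs <;> simp [one_E]
    · have h0 : (unitObj k 𝒢).ρ (DD.e s) (E k x) = 0 := by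
        rw [ρ_e_eq_sum]
        exact Finset.sum_eq_zero fun l _ => ρ_γ_E_of_ne _ _ hx
      rw [ρ_γ_E_of_ne _ _ hx, h0]
      simp
  change DD.counit (toDD (F.ε.lin _)) = if g = 𝟙 t then DD.counit (toDD (F.ε.lin _)) else 0
  have h1 := F.ε.comm (DD.γ g f) a
  have h2 := F.ε.comm (DD.e s) a
  rw [h1, h2]
  exact key _

theorem ε'_ρ_U {s t : 𝒢} (f : s ⟶ t) (a : X.V) :
    F.ε' (X.ρ (DD.U f) a) = F.ε' (X.ρ (DD.e s) a) := by
  classical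
  simp [DD.U, LinearMap.sum_apply, ε'_ρ_γ]

/-- If `ε'(ba) = 0` for all `b`, then `a = (id ⊗ ε)(Δ(1)(1 ⊗ a)) = 0`. -/
theorem eq_zero_of_forall_prod_left (a : X.V) (ha : ∀ b, F.ε' (F.prod b a) = 0) : a = 0 := by
  have h1 := LinearMap.congr_fun (congrArg Hom.lin F.frobenius_right)
    (pt (F.μ.lin (one' k 𝒢)) a)
  change F.Δ.lin (F.prod _ _) = (tensorHom' (𝟙 X) F.m).lin ((associator' X X X).hom.lin
    ((tensorHom' F.Δ (𝟙 X)).lin _)) at h1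
  rw [one_prod, tensorHom'_pt] at h1
  have h2 := LinearMap.congr_fun (congrArg Hom.lin F.counit_right) a
  change (rightUnitor' X).hom.lin ((tensorHom' (𝟙 X) F.ε).lin (F.Δ.lin a)) = a at h2
  rw [h1] at h2
  have h3 : (tensorHom' (𝟙 X) F.ε).lin ∘ₗ (tensorHom' (𝟙 X) F.m).lin ∘ₗ
      (associator' X X X).hom.lin ∘ₗ (ptLin (tensorObj' X X) X).flip a = 0 := by
    refine lin_ext fun b c => ?_
    change (tensorHom' (𝟙 X) F.ε).lin ((tensorHom' (𝟙 X) F.m).lin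
      ((associator' X X X).hom.lin (pt (pt b c) a))) = 0
    rw [associator'_hom_pt, tensorHom'_pt, tensorHom'_pt]
    have h4 : F.ε.lin (F.m.lin (pt c a)) = 0 := by
      rw [counit_eq_sum, ← prod_apply]
      refine Finset.sum_eq_zero fun x _ => ?_
      rw [ρ_e_prod, ha, zero_smul]
    rw [h4, ← ptLin_apply, map_zero]
  rw [← h2]
  have h5 := LinearMap.congr_fun h3 (F.Δ.lin (F.μ.lin (one' k 𝒢)))
  exact (congrArg (rightUnitor' X).hom.lin h5).trans (map_zero _)

/-- If `ε'(ab) = 0` for all `b`, then `a = (ε ⊗ id)((a ⊗ 1)Δ(1)) = 0`. -/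
theorem eq_zero_of_forall_prod_right (a : X.V) (ha : ∀ b, F.ε' (F.prod a b) = 0) : a = 0 := by
  have h1 := LinearMap.congr_fun (congrArg Hom.lin F.frobenius_left)
    (pt a (F.μ.lin (one' k 𝒢)))
  change F.Δ.lin (F.prod _ _) = (tensorHom' F.m (𝟙 X)).lin ((associator' X X X).inv.lin
    ((tensorHom' (𝟙 X) F.Δ).lin _)) at h1
  rw [prod_one, tensorHom'_pt] at h1
  have h2 := LinearMap.congr_fun (congrArg Hom.lin F.counit_left) a
  change (leftUnitor' X).hom.lin ((tensorHom' F.ε (𝟙 X)).lin (F.Δ.lin a)) = a at h2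
  rw [h1] at h2
  have h3 : (tensorHom' F.ε (𝟙 X)).lin ∘ₗ (tensorHom' F.m (𝟙 X)).lin ∘ₗ
      (associator' X X X).inv.lin ∘ₗ ptLin X (tensorObj' X X) a = 0 := by
    refine lin_ext fun b c => ?_
    change (tensorHom' F.ε (𝟙 X)).lin ((tensorHom' F.m (𝟙 X)).lin
      ((associator' X X X).inv.lin (pt a (pt b c)))) = 0
    rw [associator'_inv_pt, tensorHom'_pt, tensorHom'_pt]
    have h4 : F.ε.lin (F.m.lin (pt a b)) = 0 := by
      rw [counit_eq_sum, ← prod_apply]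
      refine Finset.sum_eq_zero fun x _ => ?_
      rw [ρ_e_prod, ← prod_e_right, ha, zero_smul]
    rw [h4, ← ptLin_apply, map_zero, LinearMap.zero_apply]
  rw [← h2]
  have h5 := LinearMap.congr_fun h3 (F.Δ.lin (F.μ.lin (one' k 𝒢)))
  exact (congrArg (leftUnitor' X).hom.lin h5).trans (map_zero _)

end FrobeniusStructure

/-! ### The induced data of a Frobenius object -/

namespace FrobeniusStructure

open RepD

variable {X : RepD.{u, v, w} k 𝒢} (F : FrobeniusStructure X)

theorem prod_mem_range_γ {x : 𝒢} {g h : x ⟶ x} {a b : X.V}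
    (ha : a ∈ LinearMap.range (X.ρ (DD.γ g (𝟙 x)))) (hb : b ∈ LinearMap.range (X.ρ (DD.γ h (𝟙 x)))) :
    F.prod a b ∈ LinearMap.range (X.ρ (DD.γ (h ≫ g) (𝟙 x))) := by
  classical
  obtain ⟨a, rfl⟩ := ha
  rw [mem_range_γ] at hb
  rw [mem_range_γ, ρ_γ_prod, Finset.sum_eq_single g]
  · rw [ρ_γ_idem, Category.assoc, IsIso.hom_inv_id, Category.comp_id, hb]
  · intro l _ hl
    rw [ρ_γ_orthogonal _ _ _ hl, map_zero, LinearMap.zero_apply]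
  · simp

theorem inducedGFA_φ_coe {x y : 𝒢} (f : x ⟶ y) (a : (inducedGFA F).comp x) :
    ((inducedGFA F).φ f a : X.V) = X.ρ (DD.U f) a := by
  change (∑ g : y ⟶ y, X.ρ (DD.γ g f)) (a : X.V) = _
  rw [DD.U, map_sum]

theorem inducedGFA_η (a b : X.V) : (inducedGFA F).η a b = F.ε' (F.prod a b) := rfl

theorem prod_ρ_γ_mem {x : 𝒢} {g h : x ⟶ x} {c : X.V}
    (hc : c ∈ LinearMap.range (X.ρ (DD.γ (inv h ≫ inv g ≫ h ≫ g) (𝟙 x))))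
    (a : X.V) : (F.prod c ∘ₗ X.ρ (DD.γ (inv h ≫ g ≫ h) h)) a ∈
    LinearMap.range (X.ρ (DD.γ g (𝟙 x))) := by
  have := F.prod_mem_range_γ hc (ρ_γ_mem X (inv h ≫ g ≫ h) h a)
  simpa using this

theorem prod_ρ_γ_apply {x : 𝒢} {g h : x ⟶ x} {c a : X.V}
    (ha : a ∈ LinearMap.range (X.ρ (DD.γ g (𝟙 x)))) :
    (F.prod c ∘ₗ X.ρ (DD.γ (inv h ≫ g ≫ h) h)) a = F.prod c (X.ρ (DD.U h) a) := by
  classical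
  obtain ⟨a, rfl⟩ := ha
  rw [LinearMap.comp_apply, ρ_γ_ρ_γ, ρ_U_γ, if_pos (by simp)]

theorem ρ_γ_prod_apply {x : 𝒢} {g h : x ⟶ x} {c : X.V}
    (hc : c ∈ LinearMap.range (X.ρ (DD.γ (inv h ≫ inv g ≫ h ≫ g) (𝟙 x))))
    {b : X.V} (hb : b ∈ LinearMap.range (X.ρ (DD.γ h (𝟙 x)))) :
    (X.ρ (DD.γ h (inv g)) ∘ₗ F.prod c ∘ₗ X.ρ (DD.γ h (𝟙 x))) b =
      X.ρ (DD.U (inv g)) (F.prod c b) := by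
  classical
  have h1 : F.prod c b ∈ LinearMap.range (X.ρ (DD.γ (inv g ≫ h ≫ g) (𝟙 x))) := by
    have := F.prod_mem_range_γ hc hb
    simpa using this
  obtain ⟨d, hd⟩ := h1
  rw [LinearMap.comp_apply, LinearMap.comp_apply, mem_range_γ.1 hb, ← hd, ρ_γ_ρ_γ, ρ_U_γ,
    if_pos (by simp)]
  simp

theorem trace_eq_left {x : 𝒢} {g h : x ⟶ x} {c : X.V}
    (hc : c ∈ LinearMap.range (X.ρ (DD.γ (inv h ≫ inv g ≫ h ≫ g) (𝟙 x))))
    (T : LinearMap.range (X.ρ (DD.γ g (𝟙 x))) →ₗ[k] LinearMap.range (X.ρ (DD.γ g (𝟙 x))))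
    (hT : ∀ a, (T a : X.V) = F.prod c (X.ρ (DD.U h) a)) :
    LinearMap.trace k _ T =
      LinearMap.trace k X.V (F.prod c ∘ₗ X.ρ (DD.γ (inv h ≫ g ≫ h) h)) := by
  rw [← LinearMap.trace_restrict_eq_of_forall_mem _ _ (F.prod_ρ_γ_mem hc)]
  congr 1
  refine LinearMap.ext fun a => Subtype.ext ?_
  rw [hT, LinearMap.coe_restrict_apply, prod_ρ_γ_apply F a.2]

theorem trace_eq_right {x : 𝒢} {g h : x ⟶ x} {c : X.V}
    (hc : c ∈ LinearMap.range (X.ρ (DD.γ (inv h ≫ inv g ≫ h ≫ g) (𝟙 x))))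
    (T : LinearMap.range (X.ρ (DD.γ h (𝟙 x))) →ₗ[k] LinearMap.range (X.ρ (DD.γ h (𝟙 x))))
    (hT : ∀ b, (T b : X.V) = X.ρ (DD.U (inv g)) (F.prod c b)) :
    LinearMap.trace k _ T = LinearMap.trace k X.V
      (X.ρ (DD.γ h (inv g)) ∘ₗ F.prod c ∘ₗ X.ρ (DD.γ h (𝟙 x))) := by
  rw [← LinearMap.trace_restrict_eq_of_forall_mem _
    (X.ρ (DD.γ h (inv g)) ∘ₗ F.prod c ∘ₗ X.ρ (DD.γ h (𝟙 x))) fun b => ρ_γ_mem X h (inv g) _]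
  congr 1
  refine LinearMap.ext fun a => Subtype.ext ?_
  rw [hT, LinearMap.coe_restrict_apply, ρ_γ_prod_apply F hc a.2]

/-- Both operators in the trace condition take values in one homogeneous component, so their traces
on the whole space are the traces in the trace axiom of the induced data. -/
theorem traceCondition_iff : TraceCondition F ↔
    ∀ {x : 𝒢} (g h : x ⟶ x) (c : X.V), c ∈ (inducedGFA F).gr (inv h ≫ inv g ≫ h ≫ g) →
    ∃ (T₁ : (inducedGFA F).gr g →ₗ[k] (inducedGFA F).gr g)
      (T₂ : (inducedGFA F).gr h →ₗ[k] (inducedGFA F).gr h),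
      (∀ a : (inducedGFA F).gr g, ∃ ha : (a : X.V) ∈ (inducedGFA F).comp x,
        (T₁ a : X.V) = (inducedGFA F).mul c ((inducedGFA F).φ h ⟨a, ha⟩)) ∧
      (∀ b : (inducedGFA F).gr h, ∃ hb : (inducedGFA F).mul c b ∈ (inducedGFA F).comp x,
        (T₂ b : X.V) = (inducedGFA F).φ (inv g) ⟨(inducedGFA F).mul c b, hb⟩) ∧
      LinearMap.trace k ((inducedGFA F).gr g) T₁ = LinearMap.trace k ((inducedGFA F).gr h) T₂ := by
  constructor
  · intro H x g h c hc
    obtain ⟨T₁, hT₁⟩ : ∃ T₁ : (inducedGFA F).gr g →ₗ[k] (inducedGFA F).gr g,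
        ∀ a, (T₁ a : X.V) = F.prod c (X.ρ (DD.U h) a) :=
      ⟨(F.prod c ∘ₗ X.ρ (DD.γ (inv h ≫ g ≫ h) h)).restrict fun a _ => F.prod_ρ_γ_mem hc a,
        fun a => prod_ρ_γ_apply F a.2⟩
    obtain ⟨T₂, hT₂⟩ : ∃ T₂ : (inducedGFA F).gr h →ₗ[k] (inducedGFA F).gr h,
        ∀ b, (T₂ b : X.V) = X.ρ (DD.U (inv g)) (F.prod c b) :=
      ⟨(X.ρ (DD.γ h (inv g)) ∘ₗ F.prod c ∘ₗ X.ρ (DD.γ h (𝟙 x))).restrict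
        fun b _ => ρ_γ_mem X h (inv g) _, fun b => ρ_γ_prod_apply F hc b.2⟩
    refine ⟨T₁, T₂, fun a => ⟨range_γ_le_range_e X g a.2, ?_⟩, fun b =>
      ⟨range_γ_le_range_e X _ (F.prod_mem_range_γ hc b.2), ?_⟩, ?_⟩
    · rw [inducedGFA_φ_coe]
      exact hT₁ a
    · rw [inducedGFA_φ_coe]
      exact hT₂ b
    · exact (F.trace_eq_left hc _ hT₁).trans ((H x g h c hc).trans
        (F.trace_eq_right hc _ hT₂).symm)
  · intro H x g h c hc
    obtain ⟨T₁, T₂, h₁, h₂, e⟩ := H g h c hc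
    rw [← F.trace_eq_left hc T₁, ← F.trace_eq_right hc T₂]
    · exact e
    · intro b
      obtain ⟨hb, e⟩ := h₂ b
      rw [inducedGFA_φ_coe] at e
      exact e
    · intro a
      obtain ⟨ha, e⟩ := h₁ a
      rw [inducedGFA_φ_coe] at e
      exact e

/-- A Frobenius object that satisfies the identity and the trace condition induces a `𝒢`-Frobenius
algebra. -/
theorem inducedGFA_isGFA (h1 : IdentityCondition X) (h2 : TraceCondition F) :
    (inducedGFA F).IsGFA where
  finite := X.finite
  mul_assoc := F.prod_assoc
  one_mul := F.one_prod
  mul_one := F.prod_one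
  comp_indep := iSupIndep_range_of_orthogonal _ (ρ_e_e X) fun _ _ a h => ρ_e_e_of_ne X h a
  comp_iSup := by
    refine eq_top_iff.2 fun a _ => ?_
    rw [← sum_ρ_e X a]
    exact Submodule.sum_mem _ fun z _ => Submodule.mem_iSup_of_mem z ⟨a, rfl⟩
  φ_bijective {x y} f := by
    refine Function.bijective_iff_has_inverse.2 ⟨(inducedGFA F).φ (inv f), fun a => ?_, fun a => ?_⟩
    all_goals
      refine Subtype.ext ?_
      rw [inducedGFA_φ_coe, inducedGFA_φ_coe, ρ_U_U]
      simpa [DD.U_id] using mem_range_e.1 a.2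
  φ_mul f a b c hc := by
    rw [inducedGFA_φ_coe, inducedGFA_φ_coe, inducedGFA_φ_coe, hc]
    exact F.ρ_U_prod f a b
  φ_comp g h a := by
    refine Subtype.ext ?_
    rw [inducedGFA_φ_coe, inducedGFA_φ_coe, inducedGFA_φ_coe, ρ_U_U]
  φ_id x a := by
    refine Subtype.ext ?_
    rw [inducedGFA_φ_coe, DD.U_id]
    exact mem_range_e.1 a.2
  gr_indep x := iSupIndep_range_of_orthogonal (fun g : x ⟶ x => X.ρ (DD.γ g (𝟙 x)))
    (fun g => ρ_γ_idem X g (𝟙 x)) fun _ _ a h => ρ_γ_orthogonal X (𝟙 x) a h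
  gr_iSup x := by
    refine le_antisymm (iSup_le fun g => range_γ_le_range_e X g) ?_
    rintro _ ⟨a, rfl⟩
    rw [ρ_e_eq_sum]
    exact Submodule.sum_mem _ fun g _ =>
      Submodule.mem_iSup_of_mem (p := fun g => (inducedGFA F).gr g) g ⟨a, rfl⟩
  gr_mul g h a b ha hb := F.prod_mem_range_γ ha hb
  gr_one x := by
    classical
    refine ⟨F.μ.lin (E k x), ⟨F.μ.lin (E k x), ?_⟩, fun a ha => ⟨?_, ?_⟩⟩
    · rw [← F.μ.comm]
      exact congrArg F.μ.lin ((ρ_γ_E (𝟙 x) (𝟙 x)).trans (if_pos rfl))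
    · exact (F.μ_prod x a).trans (mem_range_e.1 ha)
    · exact (F.prod_μ x a).trans (mem_range_e.1 ha)
  comp_mul x a b ha hb := by
    refine mem_range_e.2 ((F.ρ_e_prod x a b).trans ?_)
    rw [mem_range_e.1 ha]
    rfl
  comp_mul_of_ne x y a b hxy ha hb := by
    change F.prod a b = 0
    rw [← mem_range_e.1 ha, ← mem_range_e.1 hb, prod_e_right, ρ_e_e_of_ne _ hxy.symm, map_zero,
      LinearMap.zero_apply]
  η_mul a b c := by
    change F.ε' (F.prod (F.prod a b) c) = F.ε' (F.prod a (F.prod b c))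
    rw [prod_assoc]
  η_φ f a b := by
    rw [inducedGFA_φ_coe, inducedGFA_φ_coe, inducedGFA_η, inducedGFA_η, ← ρ_U_prod, ε'_ρ_U,
      ρ_e_prod, mem_range_e.1 a.2]
  φ_gr f g a ha := by
    rw [inducedGFA_φ_coe, ← mem_range_γ.1 ha, ρ_U_γ]
    exact ρ_γ_mem X _ _ _
  η_nondeg_left {x} g h hgh a ha H := by
    classical
    refine F.eq_zero_of_forall_prod_right a fun b => ?_
    obtain ⟨a, rfl⟩ := ha
    rw [← sum_ρ_γ X b]
    simp only [map_sum]
    refine Finset.sum_eq_zero fun z _ => Finset.sum_eq_zero fun l _ => ?_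
    by_cases hz : x = z
    · subst hz
      by_cases hl : l = h
      · subst hl
        exact H _ ⟨b, rfl⟩
      · have h3 := F.prod_mem_range_γ (ρ_γ_mem X g (𝟙 x) a) (ρ_γ_mem X l (𝟙 x) b)
        rw [← mem_range_γ.1 h3, ε'_ρ_γ, if_neg]
        intro h4
        exact hl (by rw [← cancel_mono g, h4, hgh])
    · rw [← ρ_e_γ X l, prod_e_right, ← ρ_e_γ X g, ρ_e_e_of_ne _ (Ne.symm hz), map_zero,
        LinearMap.zero_apply, map_zero]
  η_nondeg_right {x} g h hgh b hb H := by
    classical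
    refine F.eq_zero_of_forall_prod_left b fun a => ?_
    obtain ⟨b, rfl⟩ := hb
    rw [← sum_ρ_γ X a]
    simp only [map_sum, LinearMap.sum_apply]
    refine Finset.sum_eq_zero fun z _ => Finset.sum_eq_zero fun l _ => ?_
    by_cases hz : x = z
    · subst hz
      by_cases hl : l = g
      · subst hl
        exact H _ ⟨a, rfl⟩
      · have h3 := F.prod_mem_range_γ (ρ_γ_mem X l (𝟙 x) a) (ρ_γ_mem X h (𝟙 x) b)
        rw [← mem_range_γ.1 h3, ε'_ρ_γ, if_neg]
        intro h4
        exact hl (by rw [← cancel_epi h, h4, hgh])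
    · rw [← ρ_e_γ X h, prod_e_right, ← ρ_e_γ X l, ρ_e_e_of_ne _ hz, map_zero,
        LinearMap.zero_apply, map_zero]
  η_gr g h hgh a ha b hb := by
    classical
    rw [inducedGFA_η, ← mem_range_γ.1 (F.prod_mem_range_γ ha hb), ε'_ρ_γ, if_neg hgh]
  twisted_comm g h a b ha hb := by
    rw [inducedGFA_φ_coe, ← mem_range_γ.1 ha]
    exact F.prod_comm g _ _
  φ_self {x} g a ha := by
    refine Subtype.ext ?_
    rw [inducedGFA_φ_coe, ← mem_range_γ.1 ha, ρ_U_γ]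
    simpa using (identityCondition_iff X).1 h1 x g a
  trace_eq := (traceCondition_iff F).1 h2

end FrobeniusStructure

end FrobeniusObjects

/-! ### Dual bases -/

/-- Finite families `b` and `b'` are dual with respect to the bilinear form `η`, expressed by the
expansions `v = ∑ η(b'ᵢ, v) bᵢ = ∑ η(v, bᵢ) b'ᵢ`. -/
structure IsDualPair {k V J : Type*} [Field k] [AddCommGroup V] [Module k V] [Fintype J]
    (η : V →ₗ[k] V →ₗ[k] k) (b b' : J → V) : Prop where
  sum_left : ∀ v, ∑ i, η (b' i) v • b i = v
  sum_right : ∀ v, ∑ i, η v (b i) • b' i = v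

theorem exists_isDualPair {k V : Type*} [Field k] [AddCommGroup V] [Module k V]
    [FiniteDimensional k V] {η : V →ₗ[k] V →ₗ[k] k} (symm : ∀ a b, η a b = η b a)
    (nondeg : ∀ a, (∀ b, η a b = 0) → a = 0) :
    ∃ (n : ℕ) (b b' : Fin n → V), IsDualPair η b b' := by
  have hη : LinearMap.BilinForm.Nondegenerate η :=
    ⟨nondeg, fun b h => nondeg b fun a => (symm b a).trans (h a)⟩
  have hs : LinearMap.BilinForm.IsSymm η := ⟨symm⟩
  let b := Module.finBasis k V
  refine ⟨_, b, LinearMap.BilinForm.dualBasis η hη b, fun v => ?_, fun v => ?_⟩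
  · have h : ∀ i, b.repr v i = η v (LinearMap.BilinForm.dualBasis η hη b i) := fun i => by
      have := LinearMap.BilinForm.dualBasis_repr_apply hη
        (LinearMap.BilinForm.dualBasis η hη b) v i
      rwa [LinearMap.BilinForm.dualBasis_dualBasis hη hs b] at this
    conv_rhs => rw [← b.sum_repr v]
    simp only [h, symm v]
  · conv_rhs => rw [← (LinearMap.BilinForm.dualBasis η hη b).sum_repr v]
    simp only [LinearMap.BilinForm.dualBasis_repr_apply]

namespace IsDualPair

variable {k V J : Type*} [Field k] [AddCommGroup V] [Module k V] [Fintype J]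
  {η : V →ₗ[k] V →ₗ[k] k} {b b' : J → V}

/-- An operator on the second leg of the Casimir element `∑ bᵢ ⊗ b'ᵢ` can be replaced by its
adjoint on the first leg. -/
theorem sum_adjoint (h : IsDualPair η b b') {M : Type*} [AddCommGroup M] [Module k M]
    (B : V →ₗ[k] V →ₗ[k] M) {f g : V →ₗ[k] V} (hfg : ∀ a c, η (f a) c = η a (g c)) :
    ∑ i, B (b i) (f (b' i)) = ∑ i, B (g (b i)) (b' i) := by
  have h1 : ∀ i, B (b i) (f (b' i)) = ∑ j, η (b' i) (g (b j)) • B (b i) (b' j) := by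
    intro i
    conv_lhs => rw [← h.sum_right (f (b' i))]
    simp [hfg]
  have h2 : ∀ j, B (g (b j)) (b' j) = ∑ i, η (b' i) (g (b j)) • B (b i) (b' j) := by
    intro j
    conv_lhs => rw [← h.sum_left (g (b j))]
    simp
  simp only [h1, h2]
  exact Finset.sum_comm

/-- The Casimir element of a symmetric form is symmetric. -/
theorem sum_swap (h : IsDualPair η b b') (symm : ∀ a c, η a c = η c a) {M : Type*}
    [AddCommGroup M] [Module k M] (B : V →ₗ[k] V →ₗ[k] M) :
    ∑ i, B (b i) (b' i) = ∑ i, B (b' i) (b i) := by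
  have h1 : ∀ i, B (b i) (b' i) = ∑ j, η (b i) (b j) • B (b' j) (b' i) := by
    intro i
    conv_lhs => rw [← h.sum_right (b i)]
    simp
  have h2 : ∀ j, B (b' j) (b j) = ∑ i, η (b i) (b j) • B (b' j) (b' i) := by
    intro j
    conv_lhs => rw [← h.sum_right (b j)]
    simp [symm (b j)]
  simp only [h1, h2]
  exact Finset.sum_comm

end IsDualPair

/-! ### From Frobenius module algebras to Frobenius objects -/

section ModuleAlgebra

variable {k : Type w} [Field k] {𝒢 : Type u} [Groupoid.{v} 𝒢] [Fintype 𝒢]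
  [∀ x y : 𝒢, Fintype (x ⟶ y)]

open Classical in
/-- A twisted commutative `D(k[𝒢])`-module algebra with an invariant, symmetric and nondegenerate
bilinear form. The compatibility with the action is stated on the basis `γ_g^f`; the
adjoint of the action of an element is the action of its antipode. -/
structure IsFrobeniusModuleAlgebra (X : RepD.{u, v, w} k 𝒢) (mul : X.V →ₗ[k] X.V →ₗ[k] X.V)
    (one : X.V) (η : X.V →ₗ[k] X.V →ₗ[k] k) : Prop where
  mul_assoc : ∀ a b c, mul (mul a b) c = mul a (mul b c)
  one_mul : ∀ a, mul one a = a
  mul_one : ∀ a, mul a one = a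
  ρ_γ_mul : ∀ {s t : 𝒢} (g : t ⟶ t) (f : s ⟶ t) (a b : X.V), X.ρ (DD.γ g f) (mul a b) =
    ∑ l : t ⟶ t, mul (X.ρ (DD.γ l f) a) (X.ρ (DD.γ (g ≫ inv l) f) b)
  ρ_γ_one : ∀ {s t : 𝒢} (g : t ⟶ t) (f : s ⟶ t),
    X.ρ (DD.γ g f) one = if g = 𝟙 t then X.ρ (DD.e t) one else 0
  comm : ∀ {x : 𝒢} (g : x ⟶ x) (a b : X.V),
    mul (X.ρ (DD.γ g (𝟙 x)) a) b = mul (X.ρ (DD.U g) b) (X.ρ (DD.γ g (𝟙 x)) a)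
  identity : IdentityCondition X
  η_mul : ∀ a b c, η (mul a b) c = η a (mul b c)
  η_symm : ∀ a b, η a b = η b a
  η_nondeg : ∀ a, (∀ b, η a b = 0) → a = 0
  η_ρ_γ : ∀ {s t : 𝒢} (g : t ⟶ t) (f : s ⟶ t) (a b : X.V),
    η (X.ρ (DD.γ g f) a) b = η a (X.ρ (DD.antipode (DD.γ g f)) b)

namespace IsFrobeniusModuleAlgebra

open RepD

variable {X : RepD.{u, v, w} k 𝒢} {mul : X.V →ₗ[k] X.V →ₗ[k] X.V} {one : X.V}
  {η : X.V →ₗ[k] X.V →ₗ[k] k}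

theorem ρ_U_mul (H : IsFrobeniusModuleAlgebra X mul one η) {s t : 𝒢} (f : s ⟶ t) (a b : X.V) :
    X.ρ (DD.U f) (mul a b) = mul (X.ρ (DD.U f) a) (X.ρ (DD.U f) b) := by
  conv_lhs => rw [DD.U, map_sum, LinearMap.sum_apply]
  simp only [H.ρ_γ_mul]
  rw [Finset.sum_comm, DD.U, map_sum, LinearMap.sum_apply, map_sum, LinearMap.sum_apply]
  refine Finset.sum_congr rfl fun l _ => ?_
  rw [LinearMap.sum_apply, map_sum]
  exact Fintype.sum_equiv ⟨fun h => h ≫ inv l, fun h => h ≫ l, fun _ => by simp,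
    fun _ => by simp⟩ _ _ fun _ => rfl

theorem ρ_e_mul_ρ_e (H : IsFrobeniusModuleAlgebra X mul one η) (z : 𝒢) (a b : X.V) :
    X.ρ (DD.e z) (mul a b) = mul (X.ρ (DD.e z) a) (X.ρ (DD.e z) b) :=
  H.ρ_U_mul (𝟙 z) a b

theorem mul_ρ_e_left (H : IsFrobeniusModuleAlgebra X mul one η) (z : 𝒢) (a b : X.V) :
    mul (X.ρ (DD.e z) a) b = X.ρ (DD.e z) (mul a b) := by
  rw [← sum_ρ_e X (mul (X.ρ (DD.e z) a) b), Finset.sum_eq_single z]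
  · rw [H.ρ_e_mul_ρ_e, H.ρ_e_mul_ρ_e, ρ_e_e]
  · intro z' _ hz
    rw [H.ρ_e_mul_ρ_e, ρ_e_e_of_ne _ hz, map_zero, LinearMap.zero_apply]
  · simp

theorem mul_ρ_e_right (H : IsFrobeniusModuleAlgebra X mul one η) (z : 𝒢) (a b : X.V) :
    mul a (X.ρ (DD.e z) b) = X.ρ (DD.e z) (mul a b) := by
  rw [← sum_ρ_e X (mul a (X.ρ (DD.e z) b)), Finset.sum_eq_single z]
  · rw [H.ρ_e_mul_ρ_e, H.ρ_e_mul_ρ_e, ρ_e_e]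
  · intro z' _ hz
    rw [H.ρ_e_mul_ρ_e, ρ_e_e_of_ne _ hz, map_zero]
  · simp

theorem η_ρ_e (H : IsFrobeniusModuleAlgebra X mul one η) (z : 𝒢) (a b : X.V) :
    η (X.ρ (DD.e z) a) b = η a (X.ρ (DD.e z) b) := by
  conv_rhs => rw [← DD.antipode_e]
  simp only [DD.e, map_sum, LinearMap.sum_apply, H.η_ρ_γ]

theorem η_ρ_U (H : IsFrobeniusModuleAlgebra X mul one η) {s t : 𝒢} (f : s ⟶ t) (a b : X.V) :
    η (X.ρ (DD.U f) a) b = η a (X.ρ (DD.U (inv f)) b) := by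
  simp only [DD.U, map_sum, LinearMap.sum_apply, H.η_ρ_γ, DD.antipode_γ]
  refine Fintype.sum_equiv ⟨fun h => f ≫ inv h ≫ inv f, fun h => inv f ≫ inv h ≫ f,
    fun _ => by simp, fun _ => by simp⟩ _ _ fun _ => rfl

theorem ρ_U_inv_γ (H : IsFrobeniusModuleAlgebra X mul one η) {x : 𝒢} (h : x ⟶ x) (a : X.V) :
    X.ρ (DD.U (inv h)) (X.ρ (DD.γ h (𝟙 x)) a) = X.ρ (DD.γ h (𝟙 x)) a := by
  have h1 := (identityCondition_iff X).1 H.identity x h a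
  conv_lhs => rw [← h1]
  rw [ρ_U_γ]
  simp

theorem lift_mul_ι_pt (H : IsFrobeniusModuleAlgebra X mul one η) (a b : X.V) :
    TensorProduct.lift mul (ι X X (pt a b)) = mul a b := by
  rw [ι_pt, map_sum]
  simp only [TensorProduct.lift.tmul, ← H.ρ_e_mul_ρ_e]
  exact sum_ρ_e X _

/-- The product as a morphism. -/
def mulHom (H : IsFrobeniusModuleAlgebra X mul one η) : tensorObj' X X ⟶ X where
  lin := TensorProduct.lift mul ∘ₗ ι X X
  comm h t := by
    suffices (TensorProduct.lift mul ∘ₗ ι X X) ∘ₗ (tensorObj' X X).ρ h =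
        X.ρ h ∘ₗ (TensorProduct.lift mul ∘ₗ ι X X) from LinearMap.congr_fun this t
    refine lin_ext fun a b => ?_
    simp only [LinearMap.comp_apply, H.lift_mul_ι_pt]
    induction h using DD.induction with
    | zero => simp
    | add a b ha hb => simp only [map_add, LinearMap.add_apply, ha, hb]
    | smul r a ha => simp only [map_smul, LinearMap.smul_apply, ha]
    | basis g f => simp only [ρ_γ_pt, map_sum, H.ρ_γ_mul, H.lift_mul_ι_pt]

theorem mulHom_pt (H : IsFrobeniusModuleAlgebra X mul one η) (a b : X.V) :
    H.mulHom.lin (pt a b) = mul a b :=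
  H.lift_mul_ι_pt a b

/-- The unit as a morphism: `z ↦ z · 1`. -/
def unitHom (H : IsFrobeniusModuleAlgebra X mul one η) : unitObj k 𝒢 ⟶ X where
  lin := X.ρ.toLinearMap.flip one ∘ₗ toDD
  comm h z := by
    classical
    suffices (X.ρ.toLinearMap.flip one ∘ₗ toDD) ∘ₗ (unitObj k 𝒢).ρ h =
        X.ρ h ∘ₗ (X.ρ.toLinearMap.flip one ∘ₗ toDD) from LinearMap.congr_fun this z
    refine unit_lin_ext fun x => ?_
    simp only [LinearMap.comp_apply, LinearMap.flip_apply, AlgHom.toLinearMap_apply, toDD_E]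
    induction h using DD.induction with
    | zero => simp
    | add a b ha hb => simp only [map_add, LinearMap.add_apply, ha, hb]
    | smul r a ha => simp only [map_smul, LinearMap.smul_apply, ha]
    | @basis s t g f =>
      by_cases hs : s = x
      · subst hs
        rw [ρ_γ_E, ρ_γ_e, H.ρ_γ_one]
        split_ifs <;> simp
      · rw [ρ_γ_E_of_ne _ _ hs, ← ρ_mul_apply, DD.γ_mul_e_of_ne _ _ hs]
        simp

theorem unitHom_lin (H : IsFrobeniusModuleAlgebra X mul one η)
    (z : (unitObj k 𝒢 : RepD.{u, v, w} k 𝒢).V) : H.unitHom.lin z = X.ρ (toDD z) one := rfl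

/-- The counit as a morphism: `a ↦ ∑ₓ η(1, aˣ) 1ˣ`. -/
def counitHom (H : IsFrobeniusModuleAlgebra X mul one η) : X ⟶ unitObj k 𝒢 where
  lin := ∑ x : 𝒢, (η one ∘ₗ X.ρ (DD.e x)).smulRight (E k x)
  comm h a := by
    classical
    simp only [LinearMap.sum_apply, LinearMap.smulRight_apply, LinearMap.comp_apply, map_sum,
      map_smul]
    induction h using DD.induction with
    | zero => simp
    | add a b ha hb =>
      simp only [map_add, LinearMap.add_apply, add_smul, smul_add, Finset.sum_add_distrib, ha, hb]
    | smul r a ha =>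
      simp only [map_smul, LinearMap.smul_apply, smul_assoc, ← Finset.smul_sum, ha, smul_comm _ r]
    | @basis s t g f =>
      rw [Finset.sum_eq_single t, Finset.sum_eq_single s]
      · rw [ρ_γ_E, ρ_e_γ, H.η_symm, H.η_ρ_γ, DD.antipode_γ, H.ρ_γ_one, ← H.η_ρ_e, H.η_symm]
        have : f ≫ inv g ≫ inv f = 𝟙 s ↔ g = 𝟙 t := by
          rw [← cancel_mono f, ← cancel_epi (inv f)]
          simpa using IsIso.inv_eq_inv (f := g) (g := 𝟙 t)
        simp only [this]
        split_ifs <;> simp [H.η_symm one, H.η_ρ_e]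
      · intro z _ hz
        rw [ρ_γ_E_of_ne _ _ (Ne.symm hz), smul_zero]
      · simp
      · intro z _ hz
        rw [← ρ_mul_apply, DD.e_mul_γ_of_ne _ _ hz, map_zero, LinearMap.zero_apply, map_zero,
          zero_smul]
      · simp

theorem counitHom_lin (H : IsFrobeniusModuleAlgebra X mul one η) (a : X.V) :
    H.counitHom.lin a = ∑ x : 𝒢, η one (X.ρ (DD.e x) a) • E k x := by
  simp [counitHom]

section Comul

variable {J : Type*} [Fintype J] {b b' : J → X.V}

/-- The coproduct as a morphism: `a ↦ ∑ a bᵢ ⊗ b'ᵢ`. -/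
def comulHom (H : IsFrobeniusModuleAlgebra X mul one η) (hb : IsDualPair η b b') :
    X ⟶ tensorObj' X X where
  lin := ∑ i, (ptLin X X).flip (b' i) ∘ₗ mul.flip (b i)
  comm h a := by
    classical
    simp only [LinearMap.sum_apply, LinearMap.comp_apply, LinearMap.flip_apply, ptLin_apply,
      map_sum]
    induction h using DD.induction with
    | zero => simp [← ptLin_apply]
    | add a b ha hb =>
      simp only [map_add, LinearMap.add_apply, ← ptLin_apply, Finset.sum_add_distrib] at *
      rw [ha, hb]
    | smul r a ha =>
      simp only [map_smul, LinearMap.smul_apply, ← ptLin_apply, ← Finset.smul_sum] at *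
      rw [ha]
    | @basis s t g f =>
      -- In each term `γ_l^f ⊗ γ_{l⁻¹g}^f` of the coproduct, the action on the second leg is moved
      -- to the first leg, where the antipode acts.
      have h1 : ∀ l : t ⟶ t, ∑ i, pt (X.ρ (DD.γ l f) (mul a (b i)))
            (X.ρ (DD.γ (g ≫ inv l) f) (b' i)) =
          ∑ i, pt (X.ρ (DD.γ l f) (mul a (X.ρ (DD.antipode (DD.γ (g ≫ inv l) f)) (b i)))) (b' i) :=
        fun l => hb.sum_adjoint (ptLin X X ∘ₗ X.ρ (DD.γ l f) ∘ₗ mul a) (H.η_ρ_γ (g ≫ inv l) f)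
      have h2 : ∀ l : t ⟶ t, ∀ c, X.ρ (DD.γ l f)
            (mul a (X.ρ (DD.antipode (DD.γ (g ≫ inv l) f)) c)) =
          mul (X.ρ (DD.γ g f) a) (X.ρ (DD.γ (l ≫ inv g) (𝟙 t)) c) := by
        intro l c
        rw [H.ρ_γ_mul, Finset.sum_eq_single g]
        · rw [DD.antipode_γ, ρ_γ_ρ_γ, if_pos (by simp), IsIso.inv_hom_id]
        · intro m _ hm
          rw [DD.antipode_γ, ρ_γ_ρ_γ, if_neg, map_zero]
          intro e
          have e1 := (cancel_mono _).1 ((cancel_epi f).1 e)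
          rw [IsIso.inv_comp, IsIso.inv_inv, cancel_epi, IsIso.inv_eq_inv] at e1
          exact hm e1
        · simp
      simp only [ρ_γ_pt]
      rw [Finset.sum_comm, Finset.sum_congr rfl fun l _ => h1 l, Finset.sum_comm]
      refine Finset.sum_congr rfl fun i _ => ?_
      simp only [h2, ← pt_sum_left]
      have h3 : ∑ l : t ⟶ t, X.ρ (DD.γ (l ≫ inv g) (𝟙 t)) (b i) = X.ρ (DD.e t) (b i) := by
        rw [ρ_e_eq_sum]
        exact Fintype.sum_equiv ⟨fun l => l ≫ inv g, fun l => l ≫ g, fun _ => by simp,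
          fun _ => by simp⟩ _ _ fun _ => rfl
      rw [← map_sum, h3, H.mul_ρ_e_right, ← H.mul_ρ_e_left, ρ_e_γ]

theorem comulHom_lin (H : IsFrobeniusModuleAlgebra X mul one η) (hb : IsDualPair η b b')
    (a : X.V) : (H.comulHom hb).lin a = ∑ i, pt (mul a (b i)) (b' i) := by
  simp [comulHom, ptLin_apply]

/-- `∑ bᵢ ⊗ b'ᵢ c = ∑ c bᵢ ⊗ b'ᵢ`. -/
theorem sum_mul_right (H : IsFrobeniusModuleAlgebra X mul one η) (hb : IsDualPair η b b')
    {M : Type*} [AddCommGroup M] [Module k M] (B : X.V →ₗ[k] X.V →ₗ[k] M) (c : X.V) :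
    ∑ i, B (b i) (mul (b' i) c) = ∑ i, B (mul c (b i)) (b' i) :=
  hb.sum_adjoint B (f := mul.flip c) (g := mul c) fun a d => H.η_mul a c d

/-- `∑ a bᵢ ⊗ b'ᵢ = ∑ b'ᵢ ⊗ bᵢ a`. -/
theorem sum_mul_swap (H : IsFrobeniusModuleAlgebra X mul one η) (hb : IsDualPair η b b')
    {M : Type*} [AddCommGroup M] [Module k M] (B : X.V →ₗ[k] X.V →ₗ[k] M) (a : X.V) :
    ∑ i, B (mul a (b i)) (b' i) = ∑ i, B (b' i) (mul (b i) a) := by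
  rw [← H.sum_mul_right hb]
  exact hb.sum_swap H.η_symm (B.compl₂ (mul.flip a))

/-- The identity `∑_g (a · φ(g)⁻¹c)_g = c a` at each object, which yields cocommutativity: moving
`φ(g)` to the other leg of the Casimir element turns the braiding of `Δ(a)` into the left-hand
side. It holds because the component of `φ(g)⁻¹c` that contributes to the degree-`l` part of `a`
is `φ(g)⁻¹c_{gl⁻¹}`; commuting it past `a_l` applies `φ(l)`, and `φ(l)φ(g)⁻¹` fixes `c_{gl⁻¹}`. -/
theorem sum_ρ_γ_mul_U_inv (H : IsFrobeniusModuleAlgebra X mul one η) (z : 𝒢) (a c : X.V) :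
    ∑ g : z ⟶ z, X.ρ (DD.γ g (𝟙 z)) (mul a (X.ρ (DD.U (inv g)) c)) =
      X.ρ (DD.e z) (mul c a) := by
  have h1 : ∀ g l : z ⟶ z, mul (X.ρ (DD.γ l (𝟙 z)) a)
      (X.ρ (DD.γ (g ≫ inv l) (𝟙 z)) (X.ρ (DD.U (inv g)) c)) =
        mul (X.ρ (DD.γ (inv l ≫ g) (𝟙 z)) c) (X.ρ (DD.γ l (𝟙 z)) a) := by
    intro g l
    have h2 : X.ρ (DD.γ (g ≫ inv l) (𝟙 z)) (X.ρ (DD.U (inv g)) c) =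
        X.ρ (DD.U (inv g)) (X.ρ (DD.γ (inv l ≫ g) (𝟙 z)) c) := by
      rw [ρ_γ_U, ρ_U_γ]
      simp
    rw [H.comm, h2, ρ_U_U]
    have h3 := H.ρ_U_inv_γ (inv l ≫ g) c
    simp only [IsIso.inv_comp, IsIso.inv_inv] at h3
    rw [h3]
  simp only [H.ρ_γ_mul, h1]
  rw [Finset.sum_comm, H.ρ_e_mul_ρ_e, ρ_e_eq_sum X z a, map_sum]
  refine Finset.sum_congr rfl fun l _ => ?_
  rw [ρ_e_eq_sum, map_sum, LinearMap.sum_apply]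
  exact Fintype.sum_equiv ⟨fun h => inv l ≫ h, fun h => l ≫ h, fun _ => by simp,
    fun _ => by simp⟩ _ _ fun _ => rfl

/-- The Frobenius object of a Frobenius module algebra, with coproduct `a ↦ ∑ a bᵢ ⊗ b'ᵢ`. -/
def frobeniusStructure (H : IsFrobeniusModuleAlgebra X mul one η) (hb : IsDualPair η b b') :
    FrobeniusStructure X where
  m := H.mulHom
  Δ := H.comulHom hb
  μ := H.unitHom
  ε := H.counitHom
  assoc := hom_ext <| lin_ext₃ fun a b c => by
    change H.mulHom.lin ((tensorHom' (𝟙 X) H.mulHom).lin ((associator' X X X).hom.lin _)) =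
      H.mulHom.lin ((tensorHom' H.mulHom (𝟙 X)).lin _)
    simp only [associator'_hom_pt, tensorHom'_pt, mulHom_pt, id_lin, LinearMap.id_apply,
      H.mul_assoc]
  unit_left := hom_ext <| lin_ext_left fun x a => by
    change H.mulHom.lin ((tensorHom' H.unitHom (𝟙 X)).lin _) = (leftUnitor' X).hom.lin _
    rw [tensorHom'_pt, leftUnitor'_hom_pt, mulHom_pt, unitHom_lin, toDD_E, id_lin,
      LinearMap.id_apply, H.mul_ρ_e_left, H.one_mul]
  unit_right := hom_ext <| lin_ext_right fun x a => by
    change H.mulHom.lin ((tensorHom' (𝟙 X) H.unitHom).lin _) = (rightUnitor' X).hom.lin _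
    rw [tensorHom'_pt, rightUnitor'_hom_pt, mulHom_pt, unitHom_lin, toDD_E, DD.antipode_e, id_lin,
      LinearMap.id_apply, H.mul_ρ_e_right, H.mul_one]
  comm := hom_ext <| lin_ext_hom_left fun x g a b => by
    change H.mulHom.lin (braidLin X X _) = _
    rw [braidLin_pt_γ, mulHom_pt, mulHom_pt, ← H.comm]
  coassoc := hom_ext <| LinearMap.ext fun a => by
    change (tensorHom' (𝟙 X) (H.comulHom hb)).lin ((H.comulHom hb).lin a) =
      (associator' X X X).hom.lin ((tensorHom' (H.comulHom hb) (𝟙 X)).lin ((H.comulHom hb).lin a))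
    simp only [comulHom_lin, map_sum, tensorHom'_pt, id_lin, LinearMap.id_apply, pt_sum_left,
      pt_sum_right, associator'_hom_pt]
    rw [Finset.sum_comm]
    refine Finset.sum_congr rfl fun j _ => ?_
    simp only [H.mul_assoc]
    exact H.sum_mul_right hb (((ptLin X (tensorObj' X X)).compl₂ ((ptLin X X).flip (b' j))) ∘ₗ
      mul a) (b j)
  counit_left := hom_ext <| LinearMap.ext fun a => by
    change (leftUnitor' X).hom.lin ((tensorHom' H.counitHom (𝟙 X)).lin ((H.comulHom hb).lin a)) = a
    simp only [comulHom_lin, map_sum, tensorHom'_pt, id_lin, LinearMap.id_apply,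
      leftUnitor'_hom_pt, counitHom_lin, map_smul, toDD_E, LinearMap.sum_apply,
      LinearMap.smul_apply]
    rw [Finset.sum_comm]
    conv_rhs => rw [← sum_ρ_e X a]
    refine Finset.sum_congr rfl fun x _ => ?_
    conv_rhs => rw [← ρ_e_e, ← hb.sum_right (X.ρ (DD.e x) a), map_sum]
    refine Finset.sum_congr rfl fun i _ => ?_
    rw [← H.mul_ρ_e_left, ← H.η_mul, H.one_mul, map_smul]
  counit_right := hom_ext <| LinearMap.ext fun a => by
    change (rightUnitor' X).hom.lin ((tensorHom' (𝟙 X) H.counitHom).lin ((H.comulHom hb).lin a)) = a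
    simp only [comulHom_lin, map_sum, tensorHom'_pt, id_lin, LinearMap.id_apply,
      rightUnitor'_hom_pt, counitHom_lin, map_smul, toDD_E, LinearMap.sum_apply,
      LinearMap.smul_apply, DD.antipode_e]
    rw [Finset.sum_comm]
    conv_rhs => rw [← H.mul_one a, ← sum_ρ_e X (mul a one)]
    refine Finset.sum_congr rfl fun x _ => ?_
    conv_rhs => rw [← ρ_e_e, ← H.mul_ρ_e_right, ← hb.sum_left (X.ρ (DD.e x) one), map_sum, map_sum]
    refine Finset.sum_congr rfl fun i _ => ?_
    rw [H.η_symm one, H.η_ρ_e, map_smul, map_smul]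
  cocomm := hom_ext <| LinearMap.ext fun a => by
    change braidLin X X ((H.comulHom hb).lin a) = (H.comulHom hb).lin a
    simp only [comulHom_lin, map_sum, braidLin_pt]
    have h1 : ∑ i, pt (mul a (b i)) (b' i) = ∑ i, pt (b' i) (mul (b i) a) :=
      H.sum_mul_swap hb (ptLin X X) a
    have h2 : ∀ (z : 𝒢) (g : z ⟶ z), ∑ i, pt (X.ρ (DD.U g) (b' i))
          (X.ρ (DD.γ g (𝟙 z)) (mul a (b i))) =
        ∑ i, pt (b' i) (X.ρ (DD.γ g (𝟙 z)) (mul a (X.ρ (DD.U (inv g)) (b i)))) := fun z g =>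
      hb.sum_adjoint ((ptLin X X).flip ∘ₗ X.ρ (DD.γ g (𝟙 z)) ∘ₗ mul a) (H.η_ρ_U g)
    rw [h1, Finset.sum_comm]
    conv_rhs =>
      enter [2, i]
      rw [← sum_ρ_e X (mul (b i) a), pt_sum_right]
    rw [Finset.sum_comm (s := Finset.univ (α := J))]
    refine Finset.sum_congr rfl fun z _ => ?_
    rw [Finset.sum_comm, Finset.sum_congr rfl fun g _ => h2 z g, Finset.sum_comm]
    refine Finset.sum_congr rfl fun i _ => ?_
    rw [← pt_sum_right, H.sum_ρ_γ_mul_U_inv]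
  frobenius_left := hom_ext <| lin_ext fun a c => by
    change (H.comulHom hb).lin (H.mulHom.lin _) = (tensorHom' H.mulHom (𝟙 X)).lin
      ((associator' X X X).inv.lin ((tensorHom' (𝟙 X) (H.comulHom hb)).lin _))
    simp only [tensorHom'_pt, mulHom_pt, comulHom_lin, pt_sum_right, map_sum, associator'_inv_pt,
      id_lin, LinearMap.id_apply, H.mul_assoc]
  frobenius_right := hom_ext <| lin_ext fun a c => by
    change (H.comulHom hb).lin (H.mulHom.lin _) = (tensorHom' (𝟙 X) H.mulHom).lin
      ((associator' X X X).hom.lin ((tensorHom' (H.comulHom hb) (𝟙 X)).lin _))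
    simp only [tensorHom'_pt, mulHom_pt, comulHom_lin, pt_sum_left, map_sum, associator'_hom_pt,
      id_lin, LinearMap.id_apply, H.mul_assoc]
    exact (H.sum_mul_right hb (ptLin X X ∘ₗ mul a) c).symm

theorem frobeniusStructure_prod (H : IsFrobeniusModuleAlgebra X mul one η)
    (hb : IsDualPair η b b') : (H.frobeniusStructure hb).prod = mul :=
  LinearMap.ext₂ fun a c => H.mulHom_pt a c

theorem frobeniusStructure_μ (H : IsFrobeniusModuleAlgebra X mul one η)
    (hb : IsDualPair η b b') : (H.frobeniusStructure hb).μ.lin (one' k 𝒢) = one := by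
  change X.ρ 1 one = one
  simp

theorem frobeniusStructure_ε' (H : IsFrobeniusModuleAlgebra X mul one η)
    (hb : IsDualPair η b b') : (H.frobeniusStructure hb).ε' = η one := by
  refine LinearMap.ext fun a => ?_
  change DD.counit (toDD (H.counitHom.lin a)) = _
  have one_E : ∀ x : 𝒢, DD.counit (DD.e (k := k) x) = 1 := fun x => by classical simp [DD.e]
  rw [counitHom_lin]
  simp only [map_sum, map_smul, toDD_E, one_E, smul_eq_mul, _root_.mul_one]
  rw [← map_sum, sum_ρ_e]

end Comul

end IsFrobeniusModuleAlgebra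

end ModuleAlgebra

/-! ### The action of the double on a groupoid Frobenius algebra -/

/-- An independent family of subspaces has a family of projections, each of which vanishes on the
other members of the family. -/
theorem exists_projections {k A J : Type*} [Field k] [AddCommGroup A] [Module k A]
    {V : J → Submodule k A} (h : iSupIndep V) :
    ∃ p : J → A →ₗ[k] A, (∀ i a, p i a ∈ V i) ∧ (∀ i, ∀ a ∈ V i, p i a = a) ∧
      ∀ i j, i ≠ j → ∀ a ∈ V j, p i a = 0 := by
  classical
  obtain ⟨q, hq⟩ := LinearMap.exists_leftInverse_of_injective _
    (LinearMap.ker_eq_bot.2 h.dfinsupp_lsum_injective)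
  have hV : ∀ j, ∀ a (ha : a ∈ V j), q a = DFinsupp.single j ⟨a, ha⟩ := by
    intro j a ha
    have := LinearMap.congr_fun hq (DFinsupp.single j ⟨a, ha⟩)
    simpa using this
  refine ⟨fun i => (V i).subtype ∘ₗ DFinsupp.lapply i ∘ₗ q, fun i a => (q a i).2,
    fun i a ha => ?_, fun i j hij a ha => ?_⟩
  · simp [hV i a ha]
  · simp [hV j a ha, DFinsupp.single_eq_of_ne hij]

theorem GFAData.ext_of_coe_φ_eq {k : Type w} [Field k] {𝒢 : Type u} [Groupoid.{v} 𝒢] {A : Type*}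
    [AddCommGroup A] [Module k A] {D D' : GFAData k 𝒢 A} (hmul : D.mul = D'.mul)
    (hone : D.one = D'.one) (hcomp : ∀ x, D.comp x = D'.comp x)
    (hgr : ∀ {x : 𝒢} (g : x ⟶ x), D.gr g = D'.gr g) (hη : D.η = D'.η)
    (hφ : ∀ {x y : 𝒢} (f : x ⟶ y) (a : A) (ha : a ∈ D.comp x) (ha' : a ∈ D'.comp x),
      (D.φ f ⟨a, ha⟩ : A) = D'.φ f ⟨a, ha'⟩) : D = D' := by
  obtain ⟨mul, one, comp, gr, η, φ⟩ := D
  obtain ⟨mul', one', comp', gr', η', φ'⟩ := D'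
  obtain rfl : mul = mul' := hmul
  obtain rfl : one = one' := hone
  obtain rfl : comp = comp' := funext hcomp
  obtain rfl : @gr = @gr' := by
    funext x g
    exact hgr g
  obtain rfl : η = η' := hη
  obtain rfl : @φ = @φ' := by
    funext x y f
    exact LinearMap.ext fun a => Subtype.ext (hφ f a a.2 a.2)
  rfl

namespace GFAData.IsGFA

variable {k : Type w} [Field k] {𝒢 : Type u} [Groupoid.{v} 𝒢] {A : Type*}
  [AddCommGroup A] [Module k A] {𝒜 : GFAData k 𝒢 A}

theorem gr_le_comp (h : 𝒜.IsGFA) {x : 𝒢} (g : x ⟶ x) : 𝒜.gr g ≤ 𝒜.comp x :=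
  (le_iSup (fun g : x ⟶ x => 𝒜.gr g) g).trans (h.gr_iSup x).le

/-- Linear maps that agree on homogeneous elements are equal. -/
theorem lin_ext (h : 𝒜.IsGFA) {M : Type*} [AddCommGroup M] [Module k M] {f f' : A →ₗ[k] M}
    (H : ∀ (x : 𝒢) (g : x ⟶ x), ∀ a ∈ 𝒜.gr g, f a = f' a) : f = f' := by
  have h1 : ⨆ x, 𝒜.comp x ≤ LinearMap.eqLocus f f' := by
    refine iSup_le fun x => ?_
    rw [← h.gr_iSup]
    exact iSup_le fun g a ha => H x g a ha
  rw [h.comp_iSup] at h1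
  exact LinearMap.ext fun a => h1 trivial

/-- The projection onto `A^x` along the other summands. -/
def compProj (h : 𝒜.IsGFA) (x : 𝒢) : A →ₗ[k] A :=
  (exists_projections h.comp_indep).choose x

theorem compProj_mem (h : 𝒜.IsGFA) (x : 𝒢) (a : A) : h.compProj x a ∈ 𝒜.comp x :=
  (exists_projections h.comp_indep).choose_spec.1 x a

theorem compProj_of_mem (h : 𝒜.IsGFA) {x : 𝒢} {a : A} (ha : a ∈ 𝒜.comp x) :
    h.compProj x a = a :=
  (exists_projections h.comp_indep).choose_spec.2.1 x a ha

theorem compProj_of_mem_of_ne (h : 𝒜.IsGFA) {x y : 𝒢} (hxy : x ≠ y) {a : A}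
    (ha : a ∈ 𝒜.comp y) : h.compProj x a = 0 :=
  (exists_projections h.comp_indep).choose_spec.2.2 x y hxy a ha

/-- The projection onto `A^x_g` along the other homogeneous summands of `A`. -/
def grProj (h : 𝒜.IsGFA) {x : 𝒢} (g : x ⟶ x) : A →ₗ[k] A :=
  (exists_projections (h.gr_indep x)).choose g ∘ₗ h.compProj x

theorem grProj_mem (h : 𝒜.IsGFA) {x : 𝒢} (g : x ⟶ x) (a : A) : h.grProj g a ∈ 𝒜.gr g :=
  (exists_projections (h.gr_indep x)).choose_spec.1 g _

theorem grProj_of_mem (h : 𝒜.IsGFA) {x : 𝒢} {g : x ⟶ x} {a : A} (ha : a ∈ 𝒜.gr g) :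
    h.grProj g a = a := by
  rw [grProj, LinearMap.comp_apply, h.compProj_of_mem (h.gr_le_comp g ha)]
  exact (exists_projections (h.gr_indep x)).choose_spec.2.1 g a ha

theorem grProj_of_mem_of_ne (h : 𝒜.IsGFA) {x : 𝒢} {g g' : x ⟶ x} (hg : g ≠ g') {a : A}
    (ha : a ∈ 𝒜.gr g') : h.grProj g a = 0 := by
  rw [grProj, LinearMap.comp_apply, h.compProj_of_mem (h.gr_le_comp g' ha)]
  exact (exists_projections (h.gr_indep x)).choose_spec.2.2 g g' hg a ha

theorem grProj_of_mem_comp_of_ne (h : 𝒜.IsGFA) {x y : 𝒢} (hxy : x ≠ y) (g : x ⟶ x) {a : A}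
    (ha : a ∈ 𝒜.comp y) : h.grProj g a = 0 := by
  rw [grProj, LinearMap.comp_apply, h.compProj_of_mem_of_ne hxy ha, map_zero]

theorem grProj_compProj (h : 𝒜.IsGFA) {x : 𝒢} (g : x ⟶ x) (a : A) :
    h.grProj g (h.compProj x a) = h.grProj g a := by
  rw [grProj, LinearMap.comp_apply, h.compProj_of_mem (h.compProj_mem x a)]
  rfl

/-- The action of a morphism `f`, extended by zero to the other summands of `A`. -/
def act (h : 𝒜.IsGFA) {x y : 𝒢} (f : x ⟶ y) : A →ₗ[k] A :=
  (𝒜.comp y).subtype ∘ₗ 𝒜.φ f ∘ₗ (h.compProj x).codRestrict (𝒜.comp x) (h.compProj_mem x)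

theorem act_mem (h : 𝒜.IsGFA) {x y : 𝒢} (f : x ⟶ y) (a : A) : h.act f a ∈ 𝒜.comp y :=
  (𝒜.φ f _).2

theorem act_of_mem (h : 𝒜.IsGFA) {x y : 𝒢} (f : x ⟶ y) {a : A} (ha : a ∈ 𝒜.comp x) :
    h.act f a = 𝒜.φ f ⟨a, ha⟩ := by
  have : (h.compProj x).codRestrict (𝒜.comp x) (h.compProj_mem x) a = ⟨a, ha⟩ :=
    Subtype.ext (h.compProj_of_mem ha)
  rw [act, LinearMap.comp_apply, LinearMap.comp_apply, this]
  rfl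

theorem act_compProj (h : 𝒜.IsGFA) {x y : 𝒢} (f : x ⟶ y) (a : A) :
    h.act f (h.compProj x a) = h.act f a := by
  rw [h.act_of_mem f (h.compProj_mem x a)]
  rfl

theorem act_of_mem_of_ne (h : 𝒜.IsGFA) {x y z : 𝒢} (hxz : x ≠ z) (f : x ⟶ y) {a : A}
    (ha : a ∈ 𝒜.comp z) : h.act f a = 0 := by
  rw [← act_compProj, h.compProj_of_mem_of_ne hxz ha, map_zero]

theorem act_gr (h : 𝒜.IsGFA) {x y : 𝒢} (f : x ⟶ y) {g : x ⟶ x} {a : A} (ha : a ∈ 𝒜.gr g) :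
    h.act f a ∈ 𝒜.gr (inv f ≫ g ≫ f) := by
  rw [h.act_of_mem f (h.gr_le_comp g ha)]
  exact h.φ_gr f g _ ha

theorem act_act (h : 𝒜.IsGFA) {x y z : 𝒢} (f' : y ⟶ z) (f : x ⟶ y) (a : A) :
    h.act f' (h.act f a) = h.act (f ≫ f') a := by
  rw [← h.act_compProj f a, ← h.act_compProj (f ≫ f') a, h.act_of_mem _ (h.compProj_mem x a),
    h.act_of_mem _ (h.compProj_mem x a), h.φ_comp, h.act_of_mem f' (Subtype.prop _)]

theorem act_id (h : 𝒜.IsGFA) (x : 𝒢) (a : A) : h.act (𝟙 x) a = h.compProj x a := by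
  rw [← act_compProj, h.act_of_mem _ (h.compProj_mem x a), h.φ_id]

theorem sum_compProj [Fintype 𝒢] (h : 𝒜.IsGFA) (a : A) : ∑ x : 𝒢, h.compProj x a = a := by
  classical
  suffices ∑ x : 𝒢, h.compProj x = LinearMap.id by
    simpa [LinearMap.sum_apply] using LinearMap.congr_fun this a
  refine h.lin_ext fun y l a ha => ?_
  rw [LinearMap.sum_apply, Finset.sum_eq_single y, h.compProj_of_mem (h.gr_le_comp l ha)]
  · rfl
  · exact fun x _ hx => h.compProj_of_mem_of_ne hx (h.gr_le_comp l ha)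
  · simp

theorem compProj_mul (h : 𝒜.IsGFA) (x : 𝒢) (a b : A) :
    h.compProj x (𝒜.mul a b) = 𝒜.mul (h.compProj x a) (h.compProj x b) := by
  suffices 𝒜.mul.compr₂ (h.compProj x) = 𝒜.mul.compl₁₂ (h.compProj x) (h.compProj x) from
    LinearMap.congr_fun₂ this a b
  refine h.lin_ext fun y g a ha => h.lin_ext fun z l b hb => ?_
  rw [LinearMap.compr₂_apply, LinearMap.compl₁₂_apply]
  have ha' := h.gr_le_comp g ha
  have hb' := h.gr_le_comp l hb
  by_cases hyz : y = z
  · subst hyz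
    by_cases hxy : x = y
    · subst hxy
      rw [h.compProj_of_mem ha', h.compProj_of_mem hb',
        h.compProj_of_mem (h.comp_mul x a b ha' hb')]
    · rw [h.compProj_of_mem_of_ne hxy ha', h.compProj_of_mem_of_ne hxy (h.comp_mul y a b ha' hb'),
        map_zero, LinearMap.zero_apply]
  · rw [h.comp_mul_of_ne y z a b hyz ha' hb', map_zero]
    by_cases hxy : x = y
    · rw [h.compProj_of_mem_of_ne (fun e => hyz (hxy.symm.trans e)) hb', map_zero]
    · rw [h.compProj_of_mem_of_ne hxy ha', map_zero, LinearMap.zero_apply]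

theorem mul_compProj (h : 𝒜.IsGFA) {x : 𝒢} {a : A} (ha : a ∈ 𝒜.comp x) (b : A) :
    𝒜.mul a (h.compProj x b) = 𝒜.mul a b := by
  suffices 𝒜.mul a ∘ₗ h.compProj x = 𝒜.mul a from LinearMap.congr_fun this b
  refine h.lin_ext fun y g b hb => ?_
  rw [LinearMap.comp_apply]
  by_cases hxy : x = y
  · subst hxy
    rw [h.compProj_of_mem (h.gr_le_comp g hb)]
  · rw [h.compProj_of_mem_of_ne hxy (h.gr_le_comp g hb), map_zero,
      h.comp_mul_of_ne x y a b hxy ha (h.gr_le_comp g hb)]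

theorem act_mul (h : 𝒜.IsGFA) {x y : 𝒢} (f : x ⟶ y) (a b : A) :
    h.act f (𝒜.mul a b) = 𝒜.mul (h.act f a) (h.act f b) := by
  have hab := h.comp_mul x _ _ (h.compProj_mem x a) (h.compProj_mem x b)
  rw [← h.act_compProj f a, ← h.act_compProj f b, ← act_compProj, compProj_mul,
    h.act_of_mem f (h.compProj_mem x a), h.act_of_mem f (h.compProj_mem x b), h.act_of_mem f hab]
  exact h.φ_mul f _ _ _ rfl

/-! ### The unit and the bilinear form -/

theorem compProj_one_mem (h : 𝒜.IsGFA) (x : 𝒢) : h.compProj x 𝒜.one ∈ 𝒜.gr (𝟙 x) := by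
  obtain ⟨e, he, hu⟩ := h.gr_one x
  have h1 := h.mul_compProj (h.gr_le_comp _ he) 𝒜.one
  rw [h.mul_one, (hu _ (h.compProj_mem x _)).1] at h1
  rwa [h1]

theorem act_one (h : 𝒜.IsGFA) {x y : 𝒢} (f : x ⟶ y) : h.act f 𝒜.one = h.compProj y 𝒜.one := by
  have h1 : 𝒜.mul (h.act f 𝒜.one) (h.compProj y 𝒜.one) = h.compProj y 𝒜.one := by
    have h2 : h.compProj y 𝒜.one = h.act f (h.act (inv f) 𝒜.one) := by
      rw [act_act, IsIso.inv_hom_id, act_id]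
    rw [h2, ← act_mul, h.one_mul]
  rwa [h.mul_compProj (h.act_mem f _), h.mul_one] at h1

theorem η_eq_η_one_mul (h : 𝒜.IsGFA) (a b : A) : 𝒜.η a b = 𝒜.η 𝒜.one (𝒜.mul a b) := by
  rw [← h.η_mul, h.one_mul]

theorem η_of_ne (h : 𝒜.IsGFA) {x y : 𝒢} (hxy : x ≠ y) {a b : A} (ha : a ∈ 𝒜.comp x)
    (hb : b ∈ 𝒜.comp y) : 𝒜.η a b = 0 := by
  rw [η_eq_η_one_mul h, h.comp_mul_of_ne x y a b hxy ha hb, map_zero]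

/-- On `A_g × A_{g⁻¹}` twisted commutativity is commutativity, because `φ(g)` fixes
`A_{g⁻¹}`. -/
theorem η_symm (h : 𝒜.IsGFA) (a b : A) : 𝒜.η a b = 𝒜.η b a := by
  suffices 𝒜.η = 𝒜.η.flip from LinearMap.congr_fun₂ this a b
  refine h.lin_ext fun x g a ha => h.lin_ext fun y l b hb => ?_
  rw [LinearMap.flip_apply]
  have ha' := h.gr_le_comp g ha
  have hb' := h.gr_le_comp l hb
  by_cases hxy : x = y
  · subst hxy
    by_cases hgl : l ≫ g = 𝟙 x
    · obtain rfl : l = inv g := by rw [← cancel_mono g, hgl, IsIso.inv_hom_id]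
      have h1 : 𝒜.φ g ⟨b, hb'⟩ = ⟨b, hb'⟩ := by
        conv_lhs => rw [← h.φ_self (inv g) ⟨b, hb'⟩ hb]
        rw [← h.φ_comp, IsIso.inv_hom_id, h.φ_id]
      have h2 := h.twisted_comm g (inv g) ⟨a, ha'⟩ ⟨b, hb'⟩ ha hb
      rw [h1] at h2
      change 𝒜.mul a b = 𝒜.mul b a at h2
      rw [h.η_eq_η_one_mul a, h.η_eq_η_one_mul b, h2]
    · rw [h.η_gr g l hgl a ha b hb, h.η_gr l g _ b hb a ha]
      intro e
      apply hgl
      rw [← cancel_epi g, ← Category.assoc, e, Category.id_comp, Category.comp_id]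
  · rw [h.η_of_ne hxy ha' hb', h.η_of_ne (Ne.symm hxy) hb' ha']

theorem η_grProj_inv (h : 𝒜.IsGFA) {x : 𝒢} {g : x ⟶ x} {a : A} (ha : a ∈ 𝒜.gr g) (b : A) :
    𝒜.η a (h.grProj (inv g) b) = 𝒜.η a b := by
  suffices 𝒜.η a ∘ₗ h.grProj (inv g) = 𝒜.η a from LinearMap.congr_fun this b
  refine h.lin_ext fun y l b hb => ?_
  rw [LinearMap.comp_apply]
  by_cases hxy : x = y
  · subst hxy
    by_cases hl : inv g = l
    · rw [hl, h.grProj_of_mem hb]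
    · rw [h.grProj_of_mem_of_ne hl hb, map_zero, h.η_gr g l _ a ha b hb]
      intro e
      apply hl
      rw [← cancel_mono g, e, IsIso.inv_hom_id]
  · rw [h.grProj_of_mem_comp_of_ne hxy _ (h.gr_le_comp l hb), map_zero,
      h.η_of_ne hxy (h.gr_le_comp g ha) (h.gr_le_comp l hb)]

theorem η_grProj (h : 𝒜.IsGFA) {x : 𝒢} (g : x ⟶ x) (a b : A) :
    𝒜.η (h.grProj g a) b = 𝒜.η a (h.grProj (inv g) b) := by
  have h1 := h.η_grProj_inv (h.grProj_mem (inv g) b) a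
  rw [IsIso.inv_inv] at h1
  rw [← h.η_grProj_inv (h.grProj_mem g a), h.η_symm, h1, h.η_symm]

/-! ### The components of the product, and the adjoint of the action -/

variable [∀ x y : 𝒢, Fintype (x ⟶ y)]

theorem sum_grProj (h : 𝒜.IsGFA) (x : 𝒢) (a : A) :
    ∑ g : x ⟶ x, h.grProj g a = h.compProj x a := by
  classical
  suffices ∑ g : x ⟶ x, h.grProj g = h.compProj x by
    simpa [LinearMap.sum_apply] using LinearMap.congr_fun this a
  refine h.lin_ext fun y l a ha => ?_
  rw [LinearMap.sum_apply]
  by_cases hxy : x = y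
  · subst hxy
    rw [Finset.sum_eq_single l, h.grProj_of_mem ha, h.compProj_of_mem (h.gr_le_comp l ha)]
    · exact fun g _ hg => h.grProj_of_mem_of_ne hg ha
    · simp
  · rw [h.compProj_of_mem_of_ne hxy (h.gr_le_comp l ha)]
    exact Finset.sum_eq_zero fun g _ => h.grProj_of_mem_comp_of_ne hxy g (h.gr_le_comp l ha)

/-- `(φ(f) a)_g = φ(f) (a_{f⁻¹gf})`. -/
theorem grProj_act (h : 𝒜.IsGFA) {x y : 𝒢} (f : x ⟶ y) (g : y ⟶ y) (a : A) :
    h.grProj g (h.act f a) = h.act f (h.grProj (f ≫ g ≫ inv f) a) := by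
  classical
  rw [← h.act_compProj, ← h.sum_grProj, map_sum, map_sum,
    Finset.sum_eq_single (f ≫ g ≫ inv f)]
  · have := h.act_gr f (h.grProj_mem (f ≫ g ≫ inv f) a)
    exact h.grProj_of_mem (by simpa using this)
  · intro l _ hl
    refine h.grProj_of_mem_of_ne ?_ (h.act_gr f (h.grProj_mem l a))
    rintro rfl
    simp at hl
  · simp

theorem grProj_mul (h : 𝒜.IsGFA) {x : 𝒢} (g : x ⟶ x) (a b : A) :
    h.grProj g (𝒜.mul a b) =
      ∑ l : x ⟶ x, 𝒜.mul (h.grProj l a) (h.grProj (g ≫ inv l) b) := by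
  classical
  rw [← grProj_compProj, compProj_mul, ← h.sum_grProj x a, map_sum, LinearMap.sum_apply, map_sum]
  refine Finset.sum_congr rfl fun l _ => ?_
  rw [← h.sum_grProj x b, map_sum, map_sum, Finset.sum_eq_single (g ≫ inv l)]
  · refine h.grProj_of_mem ?_
    have := h.gr_mul l (g ≫ inv l) _ _ (h.grProj_mem l a) (h.grProj_mem (g ≫ inv l) b)
    simpa using this
  · intro m _ hm
    refine h.grProj_of_mem_of_ne ?_ (h.gr_mul l m _ _ (h.grProj_mem l a) (h.grProj_mem m b))
    rintro rfl
    simp at hm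
  · simp

theorem η_compProj (h : 𝒜.IsGFA) (x : 𝒢) (a b : A) :
    𝒜.η (h.compProj x a) b = 𝒜.η a (h.compProj x b) := by
  rw [← h.sum_grProj, ← h.sum_grProj, map_sum, map_sum, LinearMap.sum_apply]
  exact Fintype.sum_equiv ⟨fun g => inv g, fun g => inv g, fun _ => by simp, fun _ => by simp⟩ _ _
    fun g => h.η_grProj g a b

theorem η_act (h : 𝒜.IsGFA) {x y : 𝒢} (f : x ⟶ y) (a b : A) :
    𝒜.η (h.act f a) b = 𝒜.η a (h.act (inv f) b) := by
  have h1 := h.η_φ f ⟨_, h.compProj_mem x a⟩ ⟨_, h.act_mem (inv f) b⟩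
  rw [← h.act_of_mem, ← h.act_of_mem, act_act, IsIso.inv_hom_id, act_id, act_compProj,
    ← η_compProj, h.compProj_of_mem (h.act_mem f a)] at h1
  rw [h1, η_compProj, h.compProj_of_mem (h.act_mem (inv f) b)]

/-! ### The Frobenius object of a groupoid Frobenius algebra -/

variable [Fintype 𝒢]

theorem η_nondeg (h : 𝒜.IsGFA) (a : A) (ha : ∀ b, 𝒜.η a b = 0) : a = 0 := by
  rw [← h.sum_compProj a]
  refine Finset.sum_eq_zero fun x _ => ?_
  rw [← h.sum_grProj]
  refine Finset.sum_eq_zero fun g _ =>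
    h.η_nondeg_left g (inv g) (IsIso.inv_hom_id g) _ (h.grProj_mem g a) fun b _ => ?_
  rw [η_grProj, ha]

/-- The action of the double: `γ_g^f` acts as `φ(f)` followed by the projection to degree `g`. -/
def ρ (h : 𝒜.IsGFA) : DD k 𝒢 →ₐ[k] Module.End k A :=
  AlgHom.ofLinearMap (DD.lift fun b => h.grProj b.loop ∘ₗ h.act b.arr)
    (by
      refine LinearMap.ext fun a => ?_
      simp only [DD.one_def, DD.e, map_sum, DD.lift_γ, LinearMap.sum_apply, LinearMap.comp_apply,
        act_id, grProj_compProj, sum_grProj]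
      exact h.sum_compProj a)
    (fun c d => by
      classical
      induction c using DD.induction with
      | zero => simp
      | add c c' hc hc' => simp only [add_mul, map_add, hc, hc']
      | smul r c hc => simp only [smul_mul_assoc, map_smul, hc]
      | @basis s t g f =>
        induction d using DD.induction with
        | zero => simp
        | add d d' hd hd' => simp only [mul_add, map_add, hd, hd']
        | smul r d hd => simp only [mul_smul_comm, map_smul, hd]
        | @basis s' t' g' f' =>
          refine LinearMap.ext fun a => ?_
          rw [DD.lift_γ, DD.lift_γ]
          change _ = h.grProj g (h.act f (h.grProj g' (h.act f' a)))
          by_cases hst : s = t'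
          · subst hst
            rw [DD.γ_mul_γ, grProj_act]
            split_ifs with e
            · rw [DD.lift_γ, e, h.grProj_of_mem (h.grProj_mem g' _), ← e, ← grProj_act, act_act]
              rfl
            · rw [h.grProj_of_mem_of_ne e (h.grProj_mem g' _), map_zero, map_zero,
                LinearMap.zero_apply]
          · rw [DD.γ_mul_γ_of_ne _ _ _ _ hst, h.act_of_mem_of_ne hst f
              (h.gr_le_comp _ (h.grProj_mem g' _)), map_zero, map_zero, LinearMap.zero_apply])

theorem ρ_γ (h : 𝒜.IsGFA) {s t : 𝒢} (g : t ⟶ t) (f : s ⟶ t) (a : A) :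
    h.ρ (DD.γ g f) a = h.grProj g (h.act f a) :=
  LinearMap.congr_fun (DD.lift_γ _ g f) a

theorem ρ_γ_id (h : 𝒜.IsGFA) {x : 𝒢} (g : x ⟶ x) (a : A) :
    h.ρ (DD.γ g (𝟙 x)) a = h.grProj g a := by
  rw [ρ_γ, act_id, grProj_compProj]

theorem ρ_U (h : 𝒜.IsGFA) {s t : 𝒢} (f : s ⟶ t) (a : A) :
    h.ρ (DD.U f) a = h.act f a := by
  rw [DD.U, map_sum, LinearMap.sum_apply]
  simp only [ρ_γ]
  rw [sum_grProj, h.compProj_of_mem (h.act_mem f a)]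

theorem ρ_e (h : 𝒜.IsGFA) (x : 𝒢) (a : A) : h.ρ (DD.e x) a = h.compProj x a := by
  rw [← DD.U_id, ρ_U, act_id]

end GFAData.IsGFA

section Object

variable {k : Type w} [Field k] {𝒢 : Type u} [Groupoid.{v} 𝒢] [Fintype 𝒢]
  [∀ x y : 𝒢, Fintype (x ⟶ y)] {A : Type (max u v w)} [AddCommGroup A] [Module k A]
  [FiniteDimensional k A] {𝒜 : GFAData k 𝒢 A}

theorem GFAData.IsGFA.isFrobeniusModuleAlgebra (h : 𝒜.IsGFA) :
    IsFrobeniusModuleAlgebra (RepD.mk A h.ρ) 𝒜.mul 𝒜.one 𝒜.η where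
  mul_assoc := h.mul_assoc
  one_mul := h.one_mul
  mul_one := h.mul_one
  ρ_γ_mul g f a b := by
    change h.ρ (DD.γ g f) (𝒜.mul a b) =
      ∑ l, 𝒜.mul (h.ρ (DD.γ l f) a) (h.ρ (DD.γ (g ≫ inv l) f) b)
    simp only [h.ρ_γ, h.act_mul, h.grProj_mul]
  ρ_γ_one {s t} g f := by
    classical
    change h.ρ (DD.γ g f) 𝒜.one = if g = 𝟙 t then h.ρ (DD.e t) 𝒜.one else 0
    rw [h.ρ_γ, h.act_one, h.ρ_e]
    split_ifs with hg
    · subst hg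
      exact h.grProj_of_mem (h.compProj_one_mem t)
    · exact h.grProj_of_mem_of_ne hg (h.compProj_one_mem t)
  comm {x} g a b := by
    change 𝒜.mul (h.ρ (DD.γ g (𝟙 x)) a) b = 𝒜.mul (h.ρ (DD.U g) b) (h.ρ (DD.γ g (𝟙 x)) a)
    rw [h.ρ_γ_id, h.ρ_U]
    have ha := h.grProj_mem g a
    rw [← h.mul_compProj (h.gr_le_comp g ha), ← h.act_compProj, ← h.sum_grProj, map_sum, map_sum,
      map_sum, LinearMap.sum_apply]
    refine Finset.sum_congr rfl fun l _ => ?_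
    have hb := h.grProj_mem l b
    rw [h.act_of_mem g (h.gr_le_comp l hb)]
    exact h.twisted_comm g l ⟨_, h.gr_le_comp g ha⟩ ⟨_, h.gr_le_comp l hb⟩ ha hb
  identity := (RepD.identityCondition_iff _).2 fun x g a => by
    change h.ρ (DD.γ g g) a = h.ρ (DD.γ g (𝟙 x)) a
    rw [h.ρ_γ, h.ρ_γ_id, h.grProj_act, IsIso.hom_inv_id, Category.comp_id,
      h.act_of_mem g (h.gr_le_comp g (h.grProj_mem g a)), h.φ_self _ _ (h.grProj_mem g a)]
  η_mul := h.η_mul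
  η_symm := h.η_symm
  η_nondeg := h.η_nondeg
  η_ρ_γ g f a b := by
    change 𝒜.η (h.ρ (DD.γ g f) a) b = 𝒜.η a (h.ρ (DD.antipode (DD.γ g f)) b)
    rw [DD.antipode_γ, h.ρ_γ, h.ρ_γ, h.η_grProj, h.η_act, h.grProj_act]
    simp

theorem GFAData.IsGFA.inducedGFA_eq (h : 𝒜.IsGFA)
    {F : FrobeniusStructure (RepD.mk A h.ρ)} (hm : F.prod = 𝒜.mul)
    (hμ : F.μ.lin (RepD.one' k 𝒢) = 𝒜.one) (hε : F.ε' = 𝒜.η 𝒜.one) : inducedGFA F = 𝒜 := by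
  refine GFAData.ext_of_coe_φ_eq hm hμ (fun x => ?_) (fun {x} g => ?_) ?_ fun f a ha ha' => ?_
  · refine Submodule.ext fun a => RepD.mem_range_e.trans ?_
    change h.ρ (DD.e x) a = a ↔ _
    rw [h.ρ_e]
    exact ⟨fun e => e ▸ h.compProj_mem x a, h.compProj_of_mem⟩
  · refine Submodule.ext fun a => RepD.mem_range_γ.trans ?_
    change h.ρ (DD.γ g (𝟙 x)) a = a ↔ _
    rw [h.ρ_γ_id]
    exact ⟨fun e => e ▸ h.grProj_mem g a, h.grProj_of_mem⟩
  · refine LinearMap.ext₂ fun a b => ?_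
    rw [FrobeniusStructure.inducedGFA_η, hm, hε, ← h.η_eq_η_one_mul]
  · rw [FrobeniusStructure.inducedGFA_φ_coe]
    exact (h.ρ_U f a).trans (h.act_of_mem f ha')

end Object

end GroupoidFA

end

/-- Every `𝒢`-Frobenius algebra is the one induced by a Frobenius object of `Rep(D(k[𝒢]))` that
satisfies the identity condition and the trace condition; conversely every such Frobenius object
induces a `𝒢`-Frobenius algebra. -/
theorem theorem3p1 (k : Type w) [Field k] [CharZero k] (𝒢 : Type u) [Groupoid.{v} 𝒢]
    [Fintype 𝒢] [∀ x y : 𝒢, Fintype (x ⟶ y)] :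
    (∀ (A : Type (max u v w)) [AddCommGroup A] [Module k A] [FiniteDimensional k A]
        (𝒜 : GroupoidFA.GFAData k 𝒢 A), 𝒜.IsGFA →
      ∃ (ρ : GroupoidFA.DD k 𝒢 →ₐ[k] Module.End k A)
        (F : GroupoidFA.FrobeniusStructure (GroupoidFA.RepD.mk A ρ)),
        GroupoidFA.IdentityCondition (GroupoidFA.RepD.mk A ρ) ∧ GroupoidFA.TraceCondition F ∧
          GroupoidFA.inducedGFA F = 𝒜) ∧
    (∀ (X : GroupoidFA.RepD.{u, v, w} k 𝒢) (F : GroupoidFA.FrobeniusStructure X),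
      GroupoidFA.IdentityCondition X → GroupoidFA.TraceCondition F → (GroupoidFA.inducedGFA F).IsGFA) := by
  refine ⟨fun A _ _ _ 𝒜 h => ?_, fun X F h₁ h₂ => F.inducedGFA_isGFA h₁ h₂⟩
  have H := h.isFrobeniusModuleAlgebra
  obtain ⟨n, b, b', hb⟩ := GroupoidFA.exists_isDualPair h.η_symm h.η_nondeg
  have e : GroupoidFA.inducedGFA (H.frobeniusStructure hb) = 𝒜 :=
    h.inducedGFA_eq (H.frobeniusStructure_prod hb) (H.frobeniusStructure_μ hb)
      (H.frobeniusStructure_ε' hb)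
  refine ⟨h.ρ, H.frobeniusStructure hb, H.identity, ?_, e⟩
  rw [GroupoidFA.FrobeniusStructure.traceCondition_iff, e]
  exact h.trace_eq
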